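/- **Setting.** All functions of $x$ are real-valued and $C^\infty$ on a nonempty open interval (bounded or not), and an equation is given by its arbitrary elements together with this interval. Consider the following classes. * Class $\mathcal P$: $f(x)u_t=(g(x)u_x)_x+h(x)u^m$, where $fgh\neq0$ on an interval $I$ and $m\in\mathbb R$, $m\ne0,1$; the arbitrary elements are $f,g,h,m$. * Class $\mathcal V$: $v_t=v_{xx}+H(x)v^m+F(x)v$, where $H\ne0$ on $I$, $m\ne0,1$, and $I$ is such that $y''+Fy=0$ has a positive solution on $I$; the arbitrary elements are $F,H,m$. * Class $\mathcal P_2$: $f(x)u_t=(g(x)u_x)_x+h(x)u^2$, where $fgh\neq0$ on $I$. * Class $\mathcal W$: $w_t=w_{xx}+H(x)w^2+G(x)$, where $H\ne0$ on $I$ and $I$ is such that $z''+Hz^2+G=0$ has a solution $z$ on $I$ for which $y''+2Hzy=0$ has a positive solution on $I$. In $\mathcal P$ and $\mathcal V$ one of two conventions is fixed. Either the dependent variable is positive, and then all multipliers of it in transformations are positive; or it may have any sign, and then $u^m$ stands for $|u|^m$ if $m\notin\mathbb Z$, the equations are imposed where the dependent variable is nonzero, and below $\psi^{m+1}$ and $\delta_4^{m-1}$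 mean $\psi\cdot\psi^m$ and $\delta_4^m/\delta_4$ with this meaning of the power. In $\mathcal P_2$ and $\mathcal W$ the dependent variable is arbitrary real. **Equivalence groups** ($\delta_i$ are constants, $\varphi_x\ne0$, $\psi\neq0$; the interval is mapped by $x\mapsto\tilde x$). * $\hat G^\sim$ of $\mathcal P$: $\tilde t=\delta_1t+\delta_2$, $\tilde x=\varphi(x)$, $\tilde u=\psi(x)u$, $\tilde f=\frac{\delta_0\delta_1}{\varphi_x\psi^2}f$, $\tilde g=\frac{\delta_0\varphi_x}{\psi^2}g$, $\tilde h=\frac{\delta_0}{\varphi_x\psi^{m+1}}h$, $\tilde m=m$, where $\delta_0\delta_1\ne0$ and $\left(g\psi_x/\psi^2\right)_x=0$. * $G^\sim_{FH}$ of $\mathcal V$: $\tilde t=\delta_1^2t+\delta_2$, $\tilde x=\delta_1x+\delta_3$, $\tilde v=\delta_4v$, $\tilde F=F/\delta_1^2$, $\tilde H=H/(\delta_1^2\delta_4^{m-1})$, $\tilde m=m$, where $\delta_1\delta_4\ne0$. * $\hat G^\sim_{m=2}$ of $\mathcal P_2$: $\tilde t=\delta_1t+\delta_2$, $\tilde x=\varphi(x)$,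 $\tilde u=\psi(x)u+\chi(x)$, $\tilde f=\frac{\delta_0\delta_1}{\varphi_x\psi^2}f$, $\tilde g=\frac{\delta_0\varphi_x}{\psi^2}g$, $\tilde h=\frac{\delta_0}{\varphi_x\psi^3}h$, where $\delta_0\delta_1\neq0$ and, with $E=(g\psi_x/\psi^2)_x$, $\chi=-\frac{\psi^2}{2h}E$ and $\left[\frac g{\psi^2}\left(\frac{\psi^2}{2h}E\right)_x\right]_x=\frac{\psi}{4h}E^2$. * $G^\sim_{HG}$ of $\mathcal W$: $\tilde t=\delta_1^2t+\delta_2$, $\tilde x=\delta_1x+\delta_3$, $\tilde w=\delta_4w$, $\tilde G=\delta_4G/\delta_1^2$, $\tilde H=H/(\delta_1^2\delta_4)$, where $\delta_1\delta_4\ne0$. **Mappings.** Choose for each $(f,g,h)$ a point $x_0$ of its interval. The first step is $t'=\operatorname{sign}(fg)\,t$, $x'=\int_{x_0}^x|f/g|^{1/2}dy+x_0$, $u'=u$, with $f'=g'=\operatorname{sign}(g)|fg|^{1/2}$ and $h'=|g/f|^{1/2}h$. The second step, from equations with $f=g$, is $v=|f|^{1/2}u$, with $F=-(|f|^{1/2})_{xx}/|f|^{1/2}$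 and $H=h\operatorname{sign}(f)/(|f|^{1/2})^{m+1}$. The third step (only for $m=2$) is $w=v+\frac F{2H}$, with $G=-\left(\frac F{2H}\right)_{xx}-\frac{F^2}{4H}$. The composition of the first two steps is a mapping $\mathcal P\to\mathcal V$, and the composition of all three is a mapping $\mathcal P_2\to\mathcal W$. **Classification lists.** $A_\theta$ is the maximal Lie invariance algebra of the equation with arbitrary elements $\theta$ (smooth vector fields on the whole domain of $(t,x,u)$ that satisfy the infinitesimal invariance criterion), and the kernel $A^\cap$ is the intersection of the $A_\theta$ over all equations of the class with the same interval. A classification list of a class with respect to a group is a family $(\mathcal S_\gamma,\{A_\theta:\theta\in\mathcal S_\gamma\})_{\gamma\in\Gamma}$ such that all members $\theta$ of all $\mathcal S_\gamma$ have $A_\theta\neq A^\cap$ and are pairwise inequivalent, the $\mathcal S_\gamma$ are disjoint, each $\theta$ of the class with $A_\theta\ne A^\cap$ is equivalent to a member of some $\mathcal S_\gamma$, and $\dim A_\theta$ is constant on each $\mathcal S_\gamma$. **Statement.** The group classification of $\mathcal P$ with respect to $\hat G^\sim$ is equivalent to the group classification of $\mathcal V$ with respect to $G^\sim_{FH}$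 by means of the mapping $\mathcal P\to\mathcal V$ (under each of the two conventions), and the group classification of $\mathcal P_2$ with respect to $\hat G^\sim_{m=2}$ is equivalent to the group classification of $\mathcal W$ with respect to $G^\sim_{HG}$ by means of the mapping $\mathcal P_2\to\mathcal W$. That is, in both cases: 1. the transformations of the two groups map the equations of the respective class to each other, and equivalence with respect to each group is an equivalence relation; 2. the mapping is defined and single-valued on the whole first class, is onto the second class, and is realized by nondegenerate point transformations that map each equation to its image; 3. two equations of the first class are equivalent if and only if their images are; 4. the algebra $A$ of the image is the push-forward of $A_\theta$ under the realizing transformation, and $A_\theta\ne A^\cap$ if and only if the same holds for the image; 5. every choice of a single preimage for each element of a classification list of the second class gives a classification list of the first class, such choices exist, and a family of single preimages is a classification list only if it comes from one in this way; conversely, the images of the elements of a classification list of the first class form a classification list of the second class. Moreover, the conditions on the interval in $\mathcal V$ and $\mathcal W$ always hold locally: for smooth $F,H$ (respectively $H,G$) with $H\ne0$ on an open set, every point of the set has an open interval around it on which the restricted functions belong to $\mathcal V$ (respectively $\mathcal W$). -/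

import Mathlib

open Set Filter Topology
open scoped ContDiff

namespace ReactionDiffusion

/-! ### Point space, vector fields, second-order jets, infinitesimal symmetries -/

/-- The space of the variables `(t, x, u)`. -/
abbrev Pt : Type := ℝ × ℝ × ℝ

/-- Partial derivative with respect to `t`. -/
noncomputable def dT (φ : Pt → ℝ) (p : Pt) : ℝ := deriv (fun s => φ (s, p.2.1, p.2.2)) p.1

/-- Partial derivative with respect to `x`. -/
noncomputable def dX (φ : Pt → ℝ) (p : Pt) : ℝ := deriv (fun y => φ (p.1, y, p.2.2)) p.2.1

/-- Partial derivative with respect to `u`. -/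
noncomputable def dU (φ : Pt → ℝ) (p : Pt) : ℝ := deriv (fun w => φ (p.1, p.2.1, w)) p.2.2

/-- The coordinates of the second-order jet space that occur below (`u_tt` never does). -/
structure Jet where
  t : ℝ
  x : ℝ
  u : ℝ
  ut : ℝ
  ux : ℝ
  utx : ℝ
  uxx : ℝ

/-- The base point `(t, x, u)` of a jet. -/
def Jet.pt (j : Jet) : Pt := (j.t, j.x, j.u)

/-- Total derivative `D_t φ` of a function of `(t, x, u)`. -/
noncomputable def totT (φ : Pt → ℝ) (j : Jet) : ℝ := dT φ j.pt + j.ut * dU φ j.pt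

/-- Total derivative `D_x φ` of a function of `(t, x, u)`. -/
noncomputable def totX (φ : Pt → ℝ) (j : Jet) : ℝ := dX φ j.pt + j.ux * dU φ j.pt

/-- Second total derivative `D_x (D_x φ)` of a function of `(t, x, u)`. -/
noncomputable def totXX (φ : Pt → ℝ) (j : Jet) : ℝ :=
  dX (dX φ) j.pt + 2 * j.ux * dX (dU φ) j.pt + j.ux ^ 2 * dU (dU φ) j.pt + j.uxx * dU φ j.pt

/-- The three coefficients of the vector field `τ ∂_t + ξ ∂_x + η ∂_u`. -/
def cτ (Q : Pt → Pt) (p : Pt) : ℝ := (Q p).1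
def cξ (Q : Pt → Pt) (p : Pt) : ℝ := (Q p).2.1
def cη (Q : Pt → Pt) (p : Pt) : ℝ := (Q p).2.2

/-- Coefficient of `∂_{u_t}` in the prolongation of `Q`. -/
noncomputable def etaT (Q : Pt → Pt) (j : Jet) : ℝ :=
  totT (cη Q) j - j.ut * totT (cτ Q) j - j.ux * totT (cξ Q) j

/-- Coefficient of `∂_{u_x}` in the prolongation of `Q`. -/
noncomputable def etaX (Q : Pt → Pt) (j : Jet) : ℝ :=
  totX (cη Q) j - j.ut * totX (cτ Q) j - j.ux * totX (cξ Q) j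

/-- Coefficient of `∂_{u_xx}` in the prolongation of `Q`, that is
`D_x η^x - u_tx D_x τ - u_xx D_x ξ` with `η^x` the coefficient of `∂_{u_x}`. -/
noncomputable def etaXX (Q : Pt → Pt) (j : Jet) : ℝ :=
  totXX (cη Q) j - j.ut * totXX (cτ Q) j - 2 * j.utx * totX (cτ Q) j
    - j.ux * totXX (cξ Q) j - 2 * j.uxx * totX (cξ Q) j

/-- An equation `f(x) u_t = (g(x) u_x)_x + N(x, u)`, with `x` in the open set `I`.
`range` is the open set of values of `u` on which vector fields live, and `vals` is the set of
values of `u` at which the equation is imposed. -/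
structure Equation where
  I : Set ℝ
  isOpen_I : IsOpen I
  range : Set ℝ
  isOpen_range : IsOpen range
  vals : Set ℝ
  vals_subset : vals ⊆ range
  f : ℝ → ℝ
  g : ℝ → ℝ
  N : ℝ → ℝ → ℝ

namespace Equation

/-- The domain of the variables `(t, x, u)`. -/
def space (E : Equation) : Set Pt := univ ×ˢ (E.I ×ˢ E.range)

/-- `u = u(t, x)` satisfies the equation at the point `(t, x)`. -/
def HoldsAt (E : Equation) (u : ℝ → ℝ → ℝ) (t x : ℝ) : Prop :=
  E.f x * deriv (fun s => u s x) t = deriv (fun y => E.g y * deriv (u t) y) x + E.N x (u t x)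

/-- The function on the jet space whose zero set is the equation. -/
noncomputable def L (E : Equation) (j : Jet) : ℝ :=
  E.f j.x * j.ut - (deriv E.g j.x * j.ux + E.g j.x * j.uxx) - E.N j.x j.u

/-- The second prolongation of `Q` applied to `L`. -/
noncomputable def prolongL (E : Equation) (Q : Pt → Pt) (j : Jet) : ℝ :=
  cτ Q j.pt * deriv (fun y => E.L { j with t := y }) j.t
    + cξ Q j.pt * deriv (fun y => E.L { j with x := y }) j.x
    + cη Q j.pt * deriv (fun y => E.L { j with u := y }) j.u
    + etaT Q j * deriv (fun y => E.L { j with ut := y }) j.ut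
    + etaX Q j * deriv (fun y => E.L { j with ux := y }) j.ux
    + etaXX Q j * deriv (fun y => E.L { j with uxx := y }) j.uxx

/-- Infinitesimal invariance criterion: the prolongation of the smooth vector field `Q`
annihilates the equation on its zero set. (Vector fields are extended by `0` outside the domain,
so that they are determined by their values on the domain.) -/
def IsSymmetry (E : Equation) (Q : Pt → Pt) : Prop :=
  ContDiffOn ℝ ∞ Q E.space ∧ (∀ p ∉ E.space, Q p = 0) ∧
    ∀ j : Jet, j.x ∈ E.I → j.u ∈ E.vals → E.L j = 0 → E.prolongL Q j = 0

end Equation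

/-! Linearity of the prolongation, needed to see that symmetries form a vector space. -/

lemma dT_eq {φ : Pt → ℝ} {p : Pt} (h : DifferentiableAt ℝ φ p) :
    dT φ p = fderiv ℝ φ p (1, 0, 0) := by
  have h1 : HasDerivAt (fun s : ℝ => ((s, p.2.1, p.2.2) : Pt)) (1, 0, 0) p.1 :=
    (hasDerivAt_id _).prodMk ((hasDerivAt_const _ _).prodMk (hasDerivAt_const _ _))
  exact (HasFDerivAt.comp_hasDerivAt (l := φ) (l' := fderiv ℝ φ p)
    (f := fun s : ℝ => ((s, p.2.1, p.2.2) : Pt)) p.1 h.hasFDerivAt h1).deriv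

lemma dX_eq {φ : Pt → ℝ} {p : Pt} (h : DifferentiableAt ℝ φ p) :
    dX φ p = fderiv ℝ φ p (0, 1, 0) := by
  have h1 : HasDerivAt (fun s : ℝ => ((p.1, s, p.2.2) : Pt)) (0, 1, 0) p.2.1 :=
    (hasDerivAt_const _ _).prodMk ((hasDerivAt_id _).prodMk (hasDerivAt_const _ _))
  exact (HasFDerivAt.comp_hasDerivAt (l := φ) (l' := fderiv ℝ φ p)
    (f := fun s : ℝ => ((p.1, s, p.2.2) : Pt)) p.2.1 h.hasFDerivAt h1).deriv

lemma dU_eq {φ : Pt → ℝ} {p : Pt} (h : DifferentiableAt ℝ φ p) :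
    dU φ p = fderiv ℝ φ p (0, 0, 1) := by
  have h1 : HasDerivAt (fun s : ℝ => ((p.1, p.2.1, s) : Pt)) (0, 0, 1) p.2.2 :=
    (hasDerivAt_const _ _).prodMk ((hasDerivAt_const _ _).prodMk (hasDerivAt_id _))
  exact (HasFDerivAt.comp_hasDerivAt (l := φ) (l' := fderiv ℝ φ p)
    (f := fun s : ℝ => ((p.1, p.2.1, s) : Pt)) p.2.2 h.hasFDerivAt h1).deriv

lemma differentiableAt_of_smooth {φ : Pt → ℝ} {Ω : Set Pt} (hΩ : IsOpen Ω)
    (h : ContDiffOn ℝ ∞ φ Ω) {p : Pt} (hp : p ∈ Ω) : DifferentiableAt ℝ φ p :=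
  (h.contDiffAt (hΩ.mem_nhds hp)).differentiableAt (by simp)

lemma smooth_fderiv_apply {φ : Pt → ℝ} {Ω : Set Pt} (hΩ : IsOpen Ω)
    (h : ContDiffOn ℝ ∞ φ Ω) (v : Pt) : ContDiffOn ℝ ∞ (fun p => fderiv ℝ φ p v) Ω :=
  (h.fderiv_of_isOpen hΩ (by simp)).clm_apply contDiffOn_const

lemma smooth_dX {φ : Pt → ℝ} {Ω : Set Pt} (hΩ : IsOpen Ω) (h : ContDiffOn ℝ ∞ φ Ω) :
    ContDiffOn ℝ ∞ (dX φ) Ω :=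
  (smooth_fderiv_apply hΩ h (0, 1, 0)).congr
    fun _ hp => dX_eq (differentiableAt_of_smooth hΩ h hp)

lemma smooth_dU {φ : Pt → ℝ} {Ω : Set Pt} (hΩ : IsOpen Ω) (h : ContDiffOn ℝ ∞ φ Ω) :
    ContDiffOn ℝ ∞ (dU φ) Ω :=
  (smooth_fderiv_apply hΩ h (0, 0, 1)).congr
    fun _ hp => dU_eq (differentiableAt_of_smooth hΩ h hp)

section Linear

variable {φ₁ φ₂ ψ₁ : Pt → ℝ} {Ω : Set Pt} {p : Pt} (a b : ℝ)

lemma dT_lin (hΩ : IsOpen Ω) (h₁ : ContDiffOn ℝ ∞ φ₁ Ω) (h₂ : ContDiffOn ℝ ∞ φ₂ Ω)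
    (hψ : ∀ q ∈ Ω, ψ₁ q = a * φ₁ q + b * φ₂ q) (hp : p ∈ Ω) :
    dT ψ₁ p = a * dT φ₁ p + b * dT φ₂ p := by
  have e : ψ₁ =ᶠ[𝓝 p] fun q => a * φ₁ q + b * φ₂ q :=
    Filter.eventuallyEq_of_mem (hΩ.mem_nhds hp) hψ
  have d₁ := differentiableAt_of_smooth hΩ h₁ hp
  have d₂ := differentiableAt_of_smooth hΩ h₂ hp
  have d : HasFDerivAt (fun q => a * φ₁ q + b * φ₂ q)
      (a • fderiv ℝ φ₁ p + b • fderiv ℝ φ₂ p) p :=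
    (d₁.hasFDerivAt.const_mul a).add (d₂.hasFDerivAt.const_mul b)
  rw [dT_eq (d.congr_of_eventuallyEq e).differentiableAt, dT_eq d₁, dT_eq d₂,
    (d.congr_of_eventuallyEq e).fderiv]
  simp

lemma dX_lin (hΩ : IsOpen Ω) (h₁ : ContDiffOn ℝ ∞ φ₁ Ω) (h₂ : ContDiffOn ℝ ∞ φ₂ Ω)
    (hψ : ∀ q ∈ Ω, ψ₁ q = a * φ₁ q + b * φ₂ q) (hp : p ∈ Ω) :
    dX ψ₁ p = a * dX φ₁ p + b * dX φ₂ p := by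
  have e : ψ₁ =ᶠ[𝓝 p] fun q => a * φ₁ q + b * φ₂ q :=
    Filter.eventuallyEq_of_mem (hΩ.mem_nhds hp) hψ
  have d₁ := differentiableAt_of_smooth hΩ h₁ hp
  have d₂ := differentiableAt_of_smooth hΩ h₂ hp
  have d : HasFDerivAt (fun q => a * φ₁ q + b * φ₂ q)
      (a • fderiv ℝ φ₁ p + b • fderiv ℝ φ₂ p) p :=
    (d₁.hasFDerivAt.const_mul a).add (d₂.hasFDerivAt.const_mul b)
  rw [dX_eq (d.congr_of_eventuallyEq e).differentiableAt, dX_eq d₁, dX_eq d₂,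
    (d.congr_of_eventuallyEq e).fderiv]
  simp

lemma dU_lin (hΩ : IsOpen Ω) (h₁ : ContDiffOn ℝ ∞ φ₁ Ω) (h₂ : ContDiffOn ℝ ∞ φ₂ Ω)
    (hψ : ∀ q ∈ Ω, ψ₁ q = a * φ₁ q + b * φ₂ q) (hp : p ∈ Ω) :
    dU ψ₁ p = a * dU φ₁ p + b * dU φ₂ p := by
  have e : ψ₁ =ᶠ[𝓝 p] fun q => a * φ₁ q + b * φ₂ q :=
    Filter.eventuallyEq_of_mem (hΩ.mem_nhds hp) hψ
  have d₁ := differentiableAt_of_smooth hΩ h₁ hp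
  have d₂ := differentiableAt_of_smooth hΩ h₂ hp
  have d : HasFDerivAt (fun q => a * φ₁ q + b * φ₂ q)
      (a • fderiv ℝ φ₁ p + b • fderiv ℝ φ₂ p) p :=
    (d₁.hasFDerivAt.const_mul a).add (d₂.hasFDerivAt.const_mul b)
  rw [dU_eq (d.congr_of_eventuallyEq e).differentiableAt, dU_eq d₁, dU_eq d₂,
    (d.congr_of_eventuallyEq e).fderiv]
  simp

lemma totT_lin {j : Jet} (hΩ : IsOpen Ω) (h₁ : ContDiffOn ℝ ∞ φ₁ Ω)
    (h₂ : ContDiffOn ℝ ∞ φ₂ Ω) (hψ : ∀ q ∈ Ω, ψ₁ q = a * φ₁ q + b * φ₂ q) (hp : j.pt ∈ Ω) :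
    totT ψ₁ j = a * totT φ₁ j + b * totT φ₂ j := by
  unfold totT
  rw [dT_lin a b hΩ h₁ h₂ hψ hp, dU_lin a b hΩ h₁ h₂ hψ hp]
  ring

lemma totX_lin {j : Jet} (hΩ : IsOpen Ω) (h₁ : ContDiffOn ℝ ∞ φ₁ Ω)
    (h₂ : ContDiffOn ℝ ∞ φ₂ Ω) (hψ : ∀ q ∈ Ω, ψ₁ q = a * φ₁ q + b * φ₂ q) (hp : j.pt ∈ Ω) :
    totX ψ₁ j = a * totX φ₁ j + b * totX φ₂ j := by
  unfold totX
  rw [dX_lin a b hΩ h₁ h₂ hψ hp, dU_lin a b hΩ h₁ h₂ hψ hp]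
  ring

lemma totXX_lin {j : Jet} (hΩ : IsOpen Ω) (h₁ : ContDiffOn ℝ ∞ φ₁ Ω)
    (h₂ : ContDiffOn ℝ ∞ φ₂ Ω) (hψ : ∀ q ∈ Ω, ψ₁ q = a * φ₁ q + b * φ₂ q) (hp : j.pt ∈ Ω) :
    totXX ψ₁ j = a * totXX φ₁ j + b * totXX φ₂ j := by
  have hX : ∀ q ∈ Ω, dX ψ₁ q = a * dX φ₁ q + b * dX φ₂ q :=
    fun q hq => dX_lin a b hΩ h₁ h₂ hψ hq
  have hU : ∀ q ∈ Ω, dU ψ₁ q = a * dU φ₁ q + b * dU φ₂ q :=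
    fun q hq => dU_lin a b hΩ h₁ h₂ hψ hq
  unfold totXX
  rw [dX_lin a b hΩ (smooth_dX hΩ h₁) (smooth_dX hΩ h₂) hX hp,
    dX_lin a b hΩ (smooth_dU hΩ h₁) (smooth_dU hΩ h₂) hU hp,
    dU_lin a b hΩ (smooth_dU hΩ h₁) (smooth_dU hΩ h₂) hU hp, hU _ hp]
  ring

end Linear

namespace Equation

lemma isOpen_space (E : Equation) : IsOpen E.space :=
  isOpen_univ.prod (E.isOpen_I.prod E.isOpen_range)

lemma prolongL_lin (E : Equation) {Q R : Pt → Pt} (a b : ℝ) (hQ : ContDiffOn ℝ ∞ Q E.space)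
    (hR : ContDiffOn ℝ ∞ R E.space) {j : Jet} (hj : j.pt ∈ E.space) :
    E.prolongL (a • Q + b • R) j = a * E.prolongL Q j + b * E.prolongL R j := by
  have o := E.isOpen_space
  have q1 : ContDiffOn ℝ ∞ (cτ Q) E.space := hQ.fst
  have q2 : ContDiffOn ℝ ∞ (cξ Q) E.space := hQ.snd.fst
  have q3 : ContDiffOn ℝ ∞ (cη Q) E.space := hQ.snd.snd
  have r1 : ContDiffOn ℝ ∞ (cτ R) E.space := hR.fst
  have r2 : ContDiffOn ℝ ∞ (cξ R) E.space := hR.snd.fst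
  have r3 : ContDiffOn ℝ ∞ (cη R) E.space := hR.snd.snd
  have e1 : ∀ q ∈ E.space, cτ (a • Q + b • R) q = a * cτ Q q + b * cτ R q := by
    intro q _; simp [cτ]
  have e2 : ∀ q ∈ E.space, cξ (a • Q + b • R) q = a * cξ Q q + b * cξ R q := by
    intro q _; simp [cξ]
  have e3 : ∀ q ∈ E.space, cη (a • Q + b • R) q = a * cη Q q + b * cη R q := by
    intro q _; simp [cη]
  unfold prolongL etaT etaX etaXX
  rw [e1 _ hj, e2 _ hj, e3 _ hj,
    totT_lin a b o q1 r1 e1 hj, totT_lin a b o q2 r2 e2 hj, totT_lin a b o q3 r3 e3 hj,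
    totX_lin a b o q1 r1 e1 hj, totX_lin a b o q2 r2 e2 hj, totX_lin a b o q3 r3 e3 hj,
    totXX_lin a b o q1 r1 e1 hj, totXX_lin a b o q2 r2 e2 hj, totXX_lin a b o q3 r3 e3 hj]
  ring

lemma IsSymmetry.lin (E : Equation) {Q R : Pt → Pt} (a b : ℝ) (hQ : E.IsSymmetry Q)
    (hR : E.IsSymmetry R) : E.IsSymmetry (a • Q + b • R) := by
  refine ⟨(contDiffOn_const.smul hQ.1).add (contDiffOn_const.smul hR.1), ?_, ?_⟩
  · intro p hp
    simp [hQ.2.1 p hp, hR.2.1 p hp]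
  · intro j hx hu hL
    have hj : j.pt ∈ E.space := ⟨trivial, hx, E.vals_subset hu⟩
    rw [E.prolongL_lin a b hQ.1 hR.1 hj, hQ.2.2 j hx hu hL, hR.2.2 j hx hu hL]
    simp

lemma IsSymmetry.zero (E : Equation) : E.IsSymmetry 0 := by
  refine ⟨contDiffOn_const, fun _ _ => rfl, ?_⟩
  intro j hx hu _
  have hj : j.pt ∈ E.space := ⟨trivial, hx, E.vals_subset hu⟩
  have := E.prolongL_lin (Q := 0) (R := 0) 0 0 contDiffOn_const contDiffOn_const hj
  simpa using this

/-- The maximal Lie invariance algebra of an equation (as a vector space of vector fields). -/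
def lieAlg (E : Equation) : Submodule ℝ (Pt → Pt) where
  carrier := {Q | E.IsSymmetry Q}
  add_mem' := by
    intro Q R hQ hR
    have := IsSymmetry.lin E 1 1 hQ hR
    simpa using this
  zero_mem' := IsSymmetry.zero E
  smul_mem' := by
    intro c Q hQ
    have := IsSymmetry.lin E c 0 hQ hQ
    simpa using this

end Equation

/-! ### Point transformations -/

/-- A transformation `t' = a t + b`, `x' = X(x)`, `u' = A(x) u + B(x)`. -/
structure PointMap where
  a : ℝ
  b : ℝ
  X : ℝ → ℝ
  A : ℝ → ℝ
  B : ℝ → ℝ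

namespace PointMap

def toFun (Φ : PointMap) (p : Pt) : Pt :=
  (Φ.a * p.1 + Φ.b, Φ.X p.2.1, Φ.A p.2.1 * p.2.2 + Φ.B p.2.1)

/-- `Ψ.comp Φ` is the transformation `Ψ ∘ Φ`. -/
def comp (Ψ Φ : PointMap) : PointMap where
  a := Ψ.a * Φ.a
  b := Ψ.a * Φ.b + Ψ.b
  X := fun x => Ψ.X (Φ.X x)
  A := fun x => Ψ.A (Φ.X x) * Φ.A x
  B := fun x => Ψ.A (Φ.X x) * Φ.B x + Ψ.B (Φ.X x)

lemma comp_toFun (Ψ Φ : PointMap) (p : Pt) : (Ψ.comp Φ).toFun p = Ψ.toFun (Φ.toFun p) := by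
  simp only [toFun, comp, Prod.mk.injEq, true_and]
  constructor <;> ring

/-- `Φ` is a nondegenerate point transformation of the domain of `E` onto the domain of `E'`
that maps the equation `E` to the equation `E'`: if `v` is the transform of `u`, then `u`
satisfies `E` at `(t, x)` exactly when `v` satisfies `E'` at the image of `(t, x)`. -/
def MapsEquation (Φ : PointMap) (E E' : Equation) : Prop :=
  ContDiffOn ℝ ∞ Φ.toFun E.space ∧ BijOn Φ.toFun E.space E'.space ∧
  (∀ p ∈ E.space, Function.Bijective (fderiv ℝ Φ.toFun p)) ∧
  (∀ x ∈ E.I, ∀ w : ℝ, w ∈ E.vals ↔ Φ.A x * w + Φ.B x ∈ E'.vals) ∧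
  ∀ u v : ℝ → ℝ → ℝ, ContDiffOn ℝ ∞ (fun q : ℝ × ℝ => u q.1 q.2) (univ ×ˢ E.I) →
    (∀ t, ∀ x ∈ E.I, v (Φ.a * t + Φ.b) (Φ.X x) = Φ.A x * u t x + Φ.B x) →
    ∀ t, ∀ x ∈ E.I, u t x ∈ E.vals →
      (E.HoldsAt u t x ↔ E'.HoldsAt v (Φ.a * t + Φ.b) (Φ.X x))

/-- Push-forward under `Φ` of a set of vector fields on `Ω` to vector fields on `Ω'`. -/
def push (Φ : PointMap) (Ω Ω' : Set Pt) (V : Set (Pt → Pt)) : Set (Pt → Pt) :=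
  {Q' | (∀ q ∉ Ω', Q' q = 0) ∧
    ∃ Q ∈ V, ∀ p ∈ Ω, Q' (Φ.toFun p) = fderiv ℝ Φ.toFun p (Q p)}

end PointMap

/-! ### Classes of equations and their group classification -/

/-- A class of equations: the equation with arbitrary elements `θ`, and a set of equivalence
transformations, where `group θ Φ θ'` says that some element of this set maps `θ` to `θ'` and acts
by `Φ` on the variables `(t, x, u)` when the arbitrary elements are `θ`. -/
structure EqClass (Θ : Type) where
  eqn : Θ → Equation
  group : Θ → PointMap → Θ → Prop

namespace EqClass

variable {Θ Θ' : Type}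

/-- Equivalence of arbitrary elements with respect to the equivalence group. -/
def Equivalent (C : EqClass Θ) (θ θ' : Θ) : Prop := ∃ Φ, C.group θ Φ θ'

/-- The kernel of the maximal Lie invariance algebras, over a given interval `I`: the common part
of the algebras of all equations of the class that are defined over `I`. -/
def kernel (C : EqClass Θ) (I : Set ℝ) : Submodule ℝ (Pt → Pt) :=
  ⨅ θ : {θ : Θ // (C.eqn θ).I = I}, (C.eqn θ.1).lieAlg

/-- The equation admits an extension of the kernel Lie symmetry. -/
def HasExtension (C : EqClass Θ) (θ : Θ) : Prop :=
  (C.eqn θ).lieAlg ≠ C.kernel (C.eqn θ).I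

/-- `{(S γ, {A_θ : θ ∈ S γ}) : γ ∈ Γ}` solves the group classification problem for the class:
the members of the `S γ` admit Lie symmetry extensions and are pairwise inequivalent, every `θ`
with an extension is equivalent to some member, and inside each `S γ` the Lie invariance algebras
have the same dimension. -/
structure IsClassificationList (C : EqClass Θ) {Γ : Type} (S : Γ → Set Θ) : Prop where
  extension : ∀ γ, ∀ θ ∈ S γ, C.HasExtension θ
  inequivalent : ∀ γ γ', ∀ θ ∈ S γ, ∀ θ' ∈ S γ', C.Equivalent θ θ' → γ = γ' ∧ θ = θ'
  complete : ∀ θ, C.HasExtension θ → ∃ γ, ∃ θ' ∈ S γ, C.Equivalent θ θ'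
  dim_eq : ∀ γ, ∀ θ ∈ S γ, ∀ θ' ∈ S γ,
    Module.rank ℝ (C.eqn θ).lieAlg = Module.rank ℝ (C.eqn θ').lieAlg

/-- `S` consists of a single preimage, under the mapping `M`, of each element of `S'`. -/
def IsPreimageSelection (M : Θ → PointMap → Θ' → Prop) {Γ : Type} (S : Γ → Set Θ)
    (S' : Γ → Set Θ') : Prop :=
  ∀ γ, (∀ θ ∈ S γ, ∃ θ' ∈ S' γ, ∃ Φ, M θ Φ θ') ∧
    ∀ θ' ∈ S' γ, ∃! θ, θ ∈ S γ ∧ ∃ Φ, M θ Φ θ'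

/-- The group classification of the class `C` is equivalent to that of the class `C'` by means
of the mapping `M` of classes; `M θ Φ θ'` says that `θ'` is the image of `θ` and that the mapping
is realized by the point transformation `Φ`. -/
structure ClassificationEquivalence (C : EqClass Θ) (C' : EqClass Θ')
    (M : Θ → PointMap → Θ' → Prop) : Prop where
  /-- The equivalence transformations do map equations of the class to each other. -/
  group_maps : ∀ θ Φ θ', C.group θ Φ θ' → Φ.MapsEquation (C.eqn θ) (C.eqn θ')
  group_maps' : ∀ θ Φ θ', C'.group θ Φ θ' → Φ.MapsEquation (C'.eqn θ) (C'.eqn θ')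
  equivalence : Equivalence C.Equivalent
  equivalence' : Equivalence C'.Equivalent
  /-- The mapping is defined on the whole class, single-valued, and onto. -/
  existsUnique_image : ∀ θ, ∃! θ', ∃ Φ, M θ Φ θ'
  surjective : ∀ θ', ∃ θ Φ, M θ Φ θ'
  /-- The mapping is realized by point transformations. -/
  maps : ∀ θ Φ θ', M θ Φ θ' → Φ.MapsEquation (C.eqn θ) (C'.eqn θ')
  /-- Equations are equivalent if and only if their images are. -/
  equivalent_iff : ∀ θ₁ Φ₁ θ₁' θ₂ Φ₂ θ₂', M θ₁ Φ₁ θ₁' → M θ₂ Φ₂ θ₂' →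
    (C.Equivalent θ₁ θ₂ ↔ C'.Equivalent θ₁' θ₂')
  /-- The Lie invariance algebra of the image is the push-forward of the Lie invariance algebra. -/
  lieAlg_image : ∀ θ Φ θ', M θ Φ θ' →
    ((C'.eqn θ').lieAlg : Set (Pt → Pt)) =
      Φ.push (C.eqn θ).space (C'.eqn θ').space ((C.eqn θ).lieAlg : Set (Pt → Pt))
  extension_iff : ∀ θ Φ θ', M θ Φ θ' → (C.HasExtension θ ↔ C'.HasExtension θ')
  /-- A single preimage of each element of a classification list gives a classification list
  (and only classification lists do so). -/
  list_of_preimages : ∀ (Γ : Type) (S : Γ → Set Θ) (S' : Γ → Set Θ'),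
    IsPreimageSelection M S S' → (C.IsClassificationList S ↔ C'.IsClassificationList S')
  exists_preimages : ∀ (Γ : Type) (S' : Γ → Set Θ'), ∃ S : Γ → Set Θ, IsPreimageSelection M S S'
  /-- The images of the elements of a classification list form a classification list. -/
  list_of_images : ∀ (Γ : Type) (S : Γ → Set Θ), C.IsClassificationList S →
    C'.IsClassificationList (fun γ => {θ' | ∃ θ ∈ S γ, ∃ Φ, M θ Φ θ'}) ∧
      IsPreimageSelection M S (fun γ => {θ' | ∃ θ ∈ S γ, ∃ Φ, M θ Φ θ'})

end EqClass

/-! ### Arbitrary elements -/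

/-- A nonempty open interval (bounded or not). -/
structure IsInterval (I : Set ℝ) : Prop where
  isOpen : IsOpen I
  nonempty : I.Nonempty
  ordConnected : I.OrdConnected

/-- A smooth function on `I`, extended by `0` outside `I`, so that it is determined by its values
on `I`. -/
structure IsSmoothOn (I : Set ℝ) (f : ℝ → ℝ) : Prop where
  smooth : ContDiffOn ℝ ∞ f I
  zero_off : ∀ x ∉ I, f x = 0

/-- Coefficients `f, g, h`, smooth and nonvanishing on an open interval. -/
structure Coeffs where
  I : Set ℝ
  f : ℝ → ℝ
  g : ℝ → ℝ
  h : ℝ → ℝ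
  isInterval : IsInterval I
  smooth_f : IsSmoothOn I f
  smooth_g : IsSmoothOn I g
  smooth_h : IsSmoothOn I h
  ne_zero : ∀ x ∈ I, f x * g x * h x ≠ 0

/-- Coefficients `F, H`, smooth on an open interval, with `H` nonvanishing. The interval is one
on which `y'' + F y = 0` has a positive solution. -/
structure ImagedCoeffs where
  I : Set ℝ
  F : ℝ → ℝ
  H : ℝ → ℝ
  isInterval : IsInterval I
  smooth_F : IsSmoothOn I F
  smooth_H : IsSmoothOn I H
  H_ne_zero : ∀ x ∈ I, H x ≠ 0
  exists_pos : ∃ s : ℝ → ℝ, ContDiffOn ℝ ∞ s I ∧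
    ∀ x ∈ I, 0 < s x ∧ deriv (deriv s) x + F x * s x = 0

/-- Coefficients `H, G`, smooth on an open interval, with `H` nonvanishing. The interval is one
on which `z'' + H z² + G = 0` has a solution `z` such that `y'' + 2 H z y = 0` has a positive
solution. -/
structure DoubleImagedCoeffs where
  I : Set ℝ
  H : ℝ → ℝ
  G : ℝ → ℝ
  isInterval : IsInterval I
  smooth_H : IsSmoothOn I H
  smooth_G : IsSmoothOn I G
  H_ne_zero : ∀ x ∈ I, H x ≠ 0
  exists_pos : ∃ z s : ℝ → ℝ, ContDiffOn ℝ ∞ z I ∧ ContDiffOn ℝ ∞ s I ∧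
    ∀ x ∈ I, deriv (deriv z) x + H x * z x ^ 2 + G x = 0 ∧
      0 < s x ∧ deriv (deriv s) x + 2 * H x * z x * s x = 0

/-- Arbitrary elements of the class `f u_t = (g u_x)_x + h u^m`. -/
structure PowerElt extends Coeffs where
  m : ℝ
  m_ne_zero : m ≠ 0
  m_ne_one : m ≠ 1

/-- Arbitrary elements of the class `v_t = v_xx + H v^m + F v`. -/
structure ImagedElt extends ImagedCoeffs where
  m : ℝ
  m_ne_zero : m ≠ 0
  m_ne_one : m ≠ 1

/-! ### The classes and their equivalence groups -/

/-- The two conventions on the dependent variable: either it is positive (and multipliers of the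
dependent variable in transformations are positive), or it has any sign. -/
inductive Convention
  | positive
  | signed

/-- The values on which vector fields live. -/
def Convention.range : Convention → Set ℝ
  | .positive => Ioi 0
  | .signed => univ

/-- The values at which an equation with a power nonlinearity is imposed: powers need not be
smooth (or defined) at `0`. -/
def Convention.vals : Convention → Set ℝ
  | .positive => Ioi 0
  | .signed => {0}ᶜ

/-- Admissible multipliers of the dependent variable. -/
def Convention.Multiplier : Convention → ℝ → Prop
  | .positive, c => 0 < c
  | .signed, c => c ≠ 0

lemma Convention.isOpen_range (c : Convention) : IsOpen c.range := by
  cases c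
  · exact isOpen_Ioi
  · exact isOpen_univ

lemma Convention.vals_subset (c : Convention) : c.vals ⊆ c.range := by
  cases c
  · exact fun _ h => h
  · exact fun _ _ => trivial

open Classical in
/-- The power `u ^ m`, with the modulus of `u` as its base if `m` is not an integer. -/
noncomputable def spow (m u : ℝ) : ℝ := if m = (⌊m⌋ : ℝ) then u ^ ⌊m⌋ else |u| ^ m

/-- `f u_t = (g u_x)_x + h u^m` -/
noncomputable def powerEqn (c : Convention) (θ : PowerElt) : Equation where
  I := θ.I
  isOpen_I := θ.isInterval.isOpen
  range := c.range
  isOpen_range := c.isOpen_range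
  vals := c.vals
  vals_subset := c.vals_subset
  f := θ.f
  g := θ.g
  N := fun x u => θ.h x * spow θ.m u

/-- `v_t = v_xx + H v^m + F v` -/
noncomputable def imagedEqn (c : Convention) (ϑ : ImagedElt) : Equation where
  I := ϑ.I
  isOpen_I := ϑ.isInterval.isOpen
  range := c.range
  isOpen_range := c.isOpen_range
  vals := c.vals
  vals_subset := c.vals_subset
  f := fun _ => 1
  g := fun _ => 1
  N := fun x v => ϑ.H x * spow ϑ.m v + ϑ.F x * v

/-- `f u_t = (g u_x)_x + h u²` -/
def quadEqn (θ : Coeffs) : Equation where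
  I := θ.I
  isOpen_I := θ.isInterval.isOpen
  range := univ
  isOpen_range := isOpen_univ
  vals := univ
  vals_subset := subset_rfl
  f := θ.f
  g := θ.g
  N := fun x u => θ.h x * u ^ 2

/-- `w_t = w_xx + H w² + G` -/
def doubleImagedEqn (ϑ : DoubleImagedCoeffs) : Equation where
  I := ϑ.I
  isOpen_I := ϑ.isInterval.isOpen
  range := univ
  isOpen_range := isOpen_univ
  vals := univ
  vals_subset := subset_rfl
  f := fun _ => 1
  g := fun _ => 1
  N := fun x w => ϑ.H x * w ^ 2 + ϑ.G x

/-- The function `(g ψ_x / ψ²)_x`. -/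
noncomputable def psiExpr (g ψ : ℝ → ℝ) (x : ℝ) : ℝ :=
  deriv (fun y => g y * deriv ψ y / ψ y ^ 2) x

/-- The generalized extended equivalence group of `f u_t = (g u_x)_x + h u^m`; here `ψ ^ (m + 1)`
is written as `ψ * ψ ^ m`, which is correct also for negative `ψ`. -/
def powerGroup (c : Convention) (θ : PowerElt) (Φ : PointMap) (θ' : PowerElt) : Prop :=
  ∃ (δ₀ δ₁ δ₂ : ℝ) (φ ψ : ℝ → ℝ), δ₀ * δ₁ ≠ 0 ∧
    ContDiffOn ℝ ∞ φ θ.I ∧ (∀ x ∈ θ.I, deriv φ x ≠ 0) ∧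
    ContDiffOn ℝ ∞ ψ θ.I ∧ (∀ x ∈ θ.I, c.Multiplier (ψ x)) ∧
    (∀ x ∈ θ.I, psiExpr θ.g ψ x = 0) ∧
    Φ = ⟨δ₁, δ₂, φ, ψ, fun _ => 0⟩ ∧
    θ'.I = φ '' θ.I ∧ θ'.m = θ.m ∧
    ∀ x ∈ θ.I,
      θ'.f (φ x) = δ₀ * δ₁ / (deriv φ x * ψ x ^ 2) * θ.f x ∧
      θ'.g (φ x) = δ₀ * deriv φ x / ψ x ^ 2 * θ.g x ∧
      θ'.h (φ x) = δ₀ / (deriv φ x * (ψ x * spow θ.m (ψ x))) * θ.h x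

/-- The usual equivalence group of `v_t = v_xx + H v^m + F v`; here `δ₄ ^ (m - 1)` is written as
`δ₄ ^ m / δ₄`. -/
def imagedGroup (c : Convention) (ϑ : ImagedElt) (Φ : PointMap) (ϑ' : ImagedElt) : Prop :=
  ∃ δ₁ δ₂ δ₃ δ₄ : ℝ, δ₁ ≠ 0 ∧ c.Multiplier δ₄ ∧
    Φ = ⟨δ₁ ^ 2, δ₂, fun x => δ₁ * x + δ₃, fun _ => δ₄, fun _ => 0⟩ ∧
    ϑ'.I = (fun x => δ₁ * x + δ₃) '' ϑ.I ∧ ϑ'.m = ϑ.m ∧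
    ∀ x ∈ ϑ.I,
      ϑ'.F (δ₁ * x + δ₃) = ϑ.F x / δ₁ ^ 2 ∧
      ϑ'.H (δ₁ * x + δ₃) = ϑ.H x / (δ₁ ^ 2 * (spow ϑ.m δ₄ / δ₄))

/-- The generalized extended equivalence group of `f u_t = (g u_x)_x + h u²`. -/
def quadGroup (θ : Coeffs) (Φ : PointMap) (θ' : Coeffs) : Prop :=
  ∃ (δ₀ δ₁ δ₂ : ℝ) (φ ψ χ : ℝ → ℝ), δ₀ * δ₁ ≠ 0 ∧
    ContDiffOn ℝ ∞ φ θ.I ∧ (∀ x ∈ θ.I, deriv φ x ≠ 0) ∧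
    ContDiffOn ℝ ∞ ψ θ.I ∧ (∀ x ∈ θ.I, ψ x ≠ 0) ∧
    (∀ x ∈ θ.I,
      deriv (fun y => θ.g y / ψ y ^ 2 *
        deriv (fun z => ψ z ^ 2 / (2 * θ.h z) * psiExpr θ.g ψ z) y) x =
      ψ x / (4 * θ.h x) * psiExpr θ.g ψ x ^ 2) ∧
    (∀ x ∈ θ.I, χ x = -(ψ x ^ 2 / (2 * θ.h x)) * psiExpr θ.g ψ x) ∧
    Φ = ⟨δ₁, δ₂, φ, ψ, χ⟩ ∧
    θ'.I = φ '' θ.I ∧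
    ∀ x ∈ θ.I,
      θ'.f (φ x) = δ₀ * δ₁ / (deriv φ x * ψ x ^ 2) * θ.f x ∧
      θ'.g (φ x) = δ₀ * deriv φ x / ψ x ^ 2 * θ.g x ∧
      θ'.h (φ x) = δ₀ / (deriv φ x * ψ x ^ 3) * θ.h x

/-- The usual equivalence group of `w_t = w_xx + H w² + G`. -/
def doubleImagedGroup (ϑ : DoubleImagedCoeffs) (Φ : PointMap) (ϑ' : DoubleImagedCoeffs) : Prop :=
  ∃ δ₁ δ₂ δ₃ δ₄ : ℝ, δ₁ * δ₄ ≠ 0 ∧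
    Φ = ⟨δ₁ ^ 2, δ₂, fun x => δ₁ * x + δ₃, fun _ => δ₄, fun _ => 0⟩ ∧
    ϑ'.I = (fun x => δ₁ * x + δ₃) '' ϑ.I ∧
    ∀ x ∈ ϑ.I,
      ϑ'.G (δ₁ * x + δ₃) = δ₄ * ϑ.G x / δ₁ ^ 2 ∧
      ϑ'.H (δ₁ * x + δ₃) = ϑ.H x / (δ₁ ^ 2 * δ₄)

noncomputable def powerClass (c : Convention) : EqClass PowerElt := ⟨powerEqn c, powerGroup c⟩
noncomputable def imagedClass (c : Convention) : EqClass ImagedElt := ⟨imagedEqn c, imagedGroup c⟩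
def quadClass : EqClass Coeffs := ⟨quadEqn, quadGroup⟩
def doubleImagedClass : EqClass DoubleImagedCoeffs := ⟨doubleImagedEqn, doubleImagedGroup⟩

/-! ### The mappings between the classes -/

/-- The new variable `∫_{x₀}^x |f/g|^{1/2} dy + x₀`. -/
noncomputable def gaugeX (θ : Coeffs) (x₀ x : ℝ) : ℝ :=
  (∫ y in x₀..x, √|θ.f y / θ.g y|) + x₀

/-- The transformation `t₁ = sign(f g) t`, `x₁ = ∫_{x₀}^x |f/g|^{1/2} dy + x₀`, `u₁ = u`;
the sign of `f g` is constant on the interval. -/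
noncomputable def gaugeMap (θ : Coeffs) (x₀ : ℝ) : PointMap :=
  ⟨SignType.sign (θ.f x₀ * θ.g x₀), 0, gaugeX θ x₀, fun _ => 1, fun _ => 0⟩

/-- `θ₁`, with `f₁ = g₁`, is the image of `θ` under `gaugeMap`. -/
def GaugesTo (θ : Coeffs) (x₀ : ℝ) (θ₁ : Coeffs) : Prop :=
  θ₁.I = gaugeX θ x₀ '' θ.I ∧
  ∀ x ∈ θ.I,
    θ₁.f (gaugeX θ x₀ x) = SignType.sign (θ.g x) * √|θ.f x * θ.g x| ∧
    θ₁.g (gaugeX θ x₀ x) = SignType.sign (θ.g x) * √|θ.f x * θ.g x| ∧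
    θ₁.h (gaugeX θ x₀ x) = √|θ.g x / θ.f x| * θ.h x

/-- The transformation `v = |f|^{1/2} u`. -/
noncomputable def imageMap (θ : Coeffs) : PointMap :=
  ⟨1, 0, fun x => x, fun x => √|θ.f x|, fun _ => 0⟩

/-- `(F, H)` is the image of `(f, f, h)` under `imageMap`, for the exponent `m`. -/
def ImagesTo (θ : Coeffs) (m : ℝ) (ϑ : ImagedCoeffs) : Prop :=
  ϑ.I = θ.I ∧
  ∀ x ∈ θ.I,
    ϑ.F x = -(deriv (deriv (fun y => √|θ.f y|)) x / √|θ.f x|) ∧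
    ϑ.H x = θ.h x * SignType.sign (θ.f x) / √|θ.f x| ^ (m + 1)

/-- The transformation `w = v + F / (2 H)`. -/
noncomputable def doubleMap (ϑ : ImagedCoeffs) : PointMap :=
  ⟨1, 0, fun x => x, fun _ => 1, fun x => ϑ.F x / (2 * ϑ.H x)⟩

/-- `(H, G)` is the image of `(F, H)` under `doubleMap`. -/
def DoublesTo (ϑ : ImagedCoeffs) (κ : DoubleImagedCoeffs) : Prop :=
  κ.I = ϑ.I ∧
  ∀ x ∈ ϑ.I,
    κ.H x = ϑ.H x ∧
    κ.G x = -deriv (deriv (fun y => ϑ.F y / (2 * ϑ.H y))) x - ϑ.F x ^ 2 / (4 * ϑ.H x)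

/-- The resulting mapping from `f u_t = (g u_x)_x + h u^m` onto `v_t = v_xx + H v^m + F v`, for
the choice `x₀` of base points. -/
def powerMapping (x₀ : Coeffs → ℝ) (θ : PowerElt) (Φ : PointMap) (ϑ : ImagedElt) : Prop :=
  ∃ θ₁ : Coeffs, GaugesTo θ.toCoeffs (x₀ θ.toCoeffs) θ₁ ∧ ImagesTo θ₁ θ.m ϑ.toImagedCoeffs ∧
    ϑ.m = θ.m ∧ Φ = (imageMap θ₁).comp (gaugeMap θ.toCoeffs (x₀ θ.toCoeffs))

/-- The resulting mapping from `f u_t = (g u_x)_x + h u²` onto `w_t = w_xx + H w² + G`, for the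
choice `x₀` of base points. -/
def quadMapping (x₀ : Coeffs → ℝ) (θ : Coeffs) (Φ : PointMap) (κ : DoubleImagedCoeffs) : Prop :=
  ∃ (θ₁ : Coeffs) (ϑ : ImagedCoeffs), GaugesTo θ (x₀ θ) θ₁ ∧ ImagesTo θ₁ 2 ϑ ∧ DoublesTo ϑ κ ∧
    Φ = (doubleMap ϑ).comp ((imageMap θ₁).comp (gaugeMap θ (x₀ θ)))

end ReactionDiffusion

namespace ReactionDiffusion

/-! ### Calculus of smooth functions on open sets -/

section Smooth

variable {I J : Set ℝ} {f g : ℝ → ℝ} {x : ℝ}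

/-! Everything rests on one notion. A transformation t' = at + b, x' = X(x), u' = A(x)u + B(x) is a
conjugation (`PointMap.Conj`) of two equations if its second prolongation carries the defining
function L' of one on jets to l(x) L, with l smooth and nonvanishing. Conjugations form a groupoid
(`refl`, `trans`, `symm`), and they transport all that a group classification sees: solutions
(`mapsEquation`), the Lie invariance algebra (`lieAlg_eq_push`) and its dimension (`rank_eq`). The
algebra is transported because pr Q (L) is the derivative of L along a curve of jets with velocity
pr Q: differentiating L' ∘ pr Φ = l L along such a curve gives pr Q' (L') = l · pr Q (L) where L = 0
(`prolongL_conj`).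

Comparing the coefficients of the jet variables (`Conj.coefficients`,
`Nondegenerate.conj_of_coefficients`) turns conjugation into transformation laws for f, g and the
nonlinearity, with a single constant c = l A X'. In each of the four classes these are the laws of
its equivalence group. Hence two equations are equivalent exactly when they have the same exponent
and some conjugation joins them (`IsExhaustive.equivalent_iff`). The steps of the mappings are
conjugations too (`GaugesTo.conj`, `ImagesTo.conj`, `DoublesTo.conj`), so two equations are
equivalent if and only if their images are: compose around a square.

The kernel of every class consists of the multiples of ∂_t (`mem_kernel_iff`): each class contains
u_t = u_xx + H u² for all smooth nonvanishing H, and these equations share no other symmetry. A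
conjugation sends ∂_t to a ∂_t, so it preserves the property of having an extension. The statements
about lists are then formal (`list_of_preimages_iff`).

The conditions on the interval are exactly what makes the mappings onto. The function |f|^{1/2} is a
positive solution of y'' + Fy = 0; conversely a positive solution s yields the preimage f = g = s²,
h = H s^{m+1}. In the third step z = F/(2H) plays the same role. Locally such solutions exist by
Picard–Lindelöf. -/

lemma smooth_deriv (hI : IsOpen I) (hf : ContDiffOn ℝ ∞ f I) : ContDiffOn ℝ ∞ (deriv f) I :=
  ((contDiffOn_infty_iff_deriv_of_isOpen hI).1 hf).2

lemma smooth_hasDerivAt (hI : IsOpen I) (hf : ContDiffOn ℝ ∞ f I) (hx : x ∈ I) :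
    HasDerivAt f (deriv f x) x :=
  ((hf.contDiffAt (hI.mem_nhds hx)).differentiableAt (by simp)).hasDerivAt

lemma smooth_hasDerivAt_deriv (hI : IsOpen I) (hf : ContDiffOn ℝ ∞ f I) (hx : x ∈ I) :
    HasDerivAt (deriv f) (deriv (deriv f) x) x :=
  smooth_hasDerivAt hI (smooth_deriv hI hf) hx

lemma deriv_congr_of_isOpen (hI : IsOpen I) (h : ∀ y ∈ I, f y = g y) (hx : x ∈ I) :
    deriv f x = deriv g x :=
  (eventuallyEq_of_mem (hI.mem_nhds hx) h).deriv_eq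

lemma deriv_deriv_congr_of_isOpen (hI : IsOpen I) (h : ∀ y ∈ I, f y = g y) (hx : x ∈ I) :
    deriv (deriv f) x = deriv (deriv g) x :=
  deriv_congr_of_isOpen hI (fun _ hy => deriv_congr_of_isOpen hI h hy) hx

lemma deriv_smooth_comp (hI : IsOpen I) (hJ : IsOpen J) (hf : ContDiffOn ℝ ∞ f I)
    (hg : ContDiffOn ℝ ∞ g J) (h : MapsTo f I J) (hx : x ∈ I) :
    deriv (fun y => g (f y)) x = deriv g (f x) * deriv f x :=
  ((smooth_hasDerivAt hJ hg (h hx)).comp x (smooth_hasDerivAt hI hf hx)).deriv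

lemma deriv_deriv_smooth_comp (hI : IsOpen I) (hJ : IsOpen J) (hf : ContDiffOn ℝ ∞ f I)
    (hg : ContDiffOn ℝ ∞ g J) (h : MapsTo f I J) (hx : x ∈ I) :
    deriv (deriv (fun y => g (f y))) x =
      deriv (deriv g) (f x) * deriv f x ^ 2 + deriv g (f x) * deriv (deriv f) x := by
  rw [deriv_congr_of_isOpen hI (fun y hy => deriv_smooth_comp hI hJ hf hg h hy) hx]
  have h1 : HasDerivAt (fun y => deriv g (f y)) (deriv (deriv g) (f x) * deriv f x) x :=
    (smooth_hasDerivAt_deriv hJ hg (h hx)).comp x (smooth_hasDerivAt hI hf hx)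
  refine (h1.mul (smooth_hasDerivAt_deriv hI hf hx)).deriv.trans ?_
  ring

lemma deriv_smooth_mul (hI : IsOpen I) (hf : ContDiffOn ℝ ∞ f I)
    (hg : ContDiffOn ℝ ∞ g I) (hx : x ∈ I) :
    deriv (fun y => f y * g y) x = deriv f x * g x + f x * deriv g x :=
  ((smooth_hasDerivAt hI hf hx).mul (smooth_hasDerivAt hI hg hx)).deriv

lemma deriv_deriv_smooth_mul (hI : IsOpen I) (hf : ContDiffOn ℝ ∞ f I)
    (hg : ContDiffOn ℝ ∞ g I) (hx : x ∈ I) :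
    deriv (deriv (fun y => f y * g y)) x =
      deriv (deriv f) x * g x + 2 * deriv f x * deriv g x + f x * deriv (deriv g) x := by
  rw [deriv_congr_of_isOpen hI (fun y hy => deriv_smooth_mul hI hf hg hy) hx]
  refine (((smooth_hasDerivAt_deriv hI hf hx).mul (smooth_hasDerivAt hI hg hx)).add
      ((smooth_hasDerivAt hI hf hx).mul (smooth_hasDerivAt_deriv hI hg hx))).deriv.trans ?_
  ring

lemma deriv_smooth_add (hI : IsOpen I) (hf : ContDiffOn ℝ ∞ f I)
    (hg : ContDiffOn ℝ ∞ g I) (hx : x ∈ I) :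
    deriv (fun y => f y + g y) x = deriv f x + deriv g x :=
  ((smooth_hasDerivAt hI hf hx).add (smooth_hasDerivAt hI hg hx)).deriv

lemma deriv_deriv_smooth_add (hI : IsOpen I) (hf : ContDiffOn ℝ ∞ f I)
    (hg : ContDiffOn ℝ ∞ g I) (hx : x ∈ I) :
    deriv (deriv (fun y => f y + g y)) x = deriv (deriv f) x + deriv (deriv g) x := by
  rw [deriv_congr_of_isOpen hI (fun y hy => deriv_smooth_add hI hf hg hy) hx]
  exact ((smooth_hasDerivAt_deriv hI hf hx).add (smooth_hasDerivAt_deriv hI hg hx)).deriv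

/-- A smooth bijection between open sets of the line with nonvanishing derivative has a smooth
inverse. -/
lemma exists_smooth_inverse (hI : IsOpen I) (hf : ContDiffOn ℝ ∞ f I)
    (hf' : ∀ x ∈ I, deriv f x ≠ 0) (hb : BijOn f I J) :
    ∃ Y : ℝ → ℝ, ContDiffOn ℝ ∞ Y J ∧ BijOn Y J I ∧ (∀ x ∈ I, Y (f x) = x) ∧
      ∀ y ∈ J, f (Y y) = y := by
  have hinv : InvOn (Function.invFunOn f I) f I J := hb.invOn_invFunOn
  refine ⟨Function.invFunOn f I, ?_, hb.symm hinv.symm, fun x hx => hinv.1 hx, fun y hy => hinv.2 hy⟩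
  intro y hy
  obtain ⟨x, hx, rfl⟩ := hb.surjOn hy
  have hc : ContDiffAt ℝ ∞ f x := hf.contDiffAt (hI.mem_nhds hx)
  have hd : HasFDerivAt f (ContinuousLinearEquiv.unitsEquivAut ℝ (Units.mk0 _ (hf' x hx)) :
      ℝ →L[ℝ] ℝ) x := by
    exact (smooth_hasDerivAt hI hf hx).hasFDerivAt.congr_fderiv (by ext; simp)
  have hg := hc.to_localInverse hd (by simp)
  refine (hg.congr_of_eventuallyEq ?_).contDiffWithinAt
  have h1 : ∀ᶠ y in 𝓝 (f x), f (hc.localInverse hd (by simp) y) = y :=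
    (hc.toOpenPartialHomeomorph f hd (by simp)).eventually_right_inverse
      (hc.image_mem_toOpenPartialHomeomorph_target hd (by simp))
  have h2 : ∀ᶠ y in 𝓝 (f x), hc.localInverse hd (by simp) y ∈ I := by
    have h3 : hc.localInverse hd (by simp) (f x) = x := hc.localInverse_apply_image hd (by simp)
    exact hg.continuousAt.eventually_mem (by rw [h3]; exact hI.mem_nhds hx)
  -- Near `f x` the local inverse takes values in `I` and inverts `f`, so by injectivity on `I` it
  -- coincides with the global inverse, which inherits its smoothness.
  filter_upwards [h1, h2] with y hy1 hy2
  conv_lhs => rw [← hy1]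
  exact hinv.1 hy2

lemma isOpen_bijOn_image (hI : IsOpen I) (hf : ContDiffOn ℝ ∞ f I)
    (hf' : ∀ x ∈ I, deriv f x ≠ 0) : IsOpen (f '' I) := by
  refine isOpen_iff_mem_nhds.2 ?_
  rintro _ ⟨x, hx, rfl⟩
  have hc : ContDiffAt ℝ ∞ f x := hf.contDiffAt (hI.mem_nhds hx)
  have hs : HasStrictDerivAt f (deriv f x) x := hc.hasStrictDerivAt (by simp)
  rw [← hs.map_nhds_eq (hf' x hx)]
  exact image_mem_map (hI.mem_nhds hx)

end Smooth

/-! ### The second prolongation of a point transformation -/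

/-- The action of a point transformation on jets. -/
noncomputable def PointMap.jet (Φ : PointMap) (j : Jet) : Jet where
  t := Φ.a * j.t + Φ.b
  x := Φ.X j.x
  u := Φ.A j.x * j.u + Φ.B j.x
  ut := Φ.A j.x * j.ut / Φ.a
  ux := (deriv Φ.A j.x * j.u + Φ.A j.x * j.ux + deriv Φ.B j.x) / deriv Φ.X j.x
  utx := (deriv Φ.A j.x * j.ut + Φ.A j.x * j.utx) / (Φ.a * deriv Φ.X j.x)
  uxx := (deriv (deriv Φ.A) j.x * j.u + 2 * deriv Φ.A j.x * j.ux + Φ.A j.x * j.uxx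
    + deriv (deriv Φ.B) j.x
    - deriv (deriv Φ.X) j.x * ((deriv Φ.A j.x * j.u + Φ.A j.x * j.ux + deriv Φ.B j.x)
      / deriv Φ.X j.x)) / deriv Φ.X j.x ^ 2

lemma PointMap.jet_pt (Φ : PointMap) (j : Jet) : (Φ.jet j).pt = Φ.toFun j.pt := rfl

/-- `Φ` is smooth and nondegenerate over the open set `I`. -/
structure PointMap.Nondegenerate (Φ : PointMap) (I : Set ℝ) : Prop where
  a_ne : Φ.a ≠ 0
  smooth_X : ContDiffOn ℝ ∞ Φ.X I
  smooth_A : ContDiffOn ℝ ∞ Φ.A I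
  smooth_B : ContDiffOn ℝ ∞ Φ.B I
  deriv_X_ne : ∀ x ∈ I, deriv Φ.X x ≠ 0
  A_ne : ∀ x ∈ I, Φ.A x ≠ 0

namespace PointMap

variable {Φ Ψ : PointMap} {I J : Set ℝ} {j : Jet}

/-- Functoriality of the second prolongation, by the chain and product rules up to order two. It
makes conjugations composable and invertible. -/
lemma jet_comp (hI : IsOpen I) (hJ : IsOpen J) (hΦ : Φ.Nondegenerate I) (hΨ : Ψ.Nondegenerate J)
    (h : MapsTo Φ.X I J) (hj : j.x ∈ I) : (Ψ.comp Φ).jet j = Ψ.jet (Φ.jet j) := by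
  have hAX := hΨ.smooth_A.comp hΦ.smooth_X h
  have hBX := hΨ.smooth_B.comp hΦ.smooth_X h
  have a1 := hΦ.a_ne
  have a2 := hΨ.a_ne
  have x1 := hΦ.deriv_X_ne _ hj
  have x2 := hΨ.deriv_X_ne _ (h hj)
  have hAA : ContDiffOn ℝ ∞ (fun x => Ψ.A (Φ.X x) * Φ.A x) I := hAX.mul hΦ.smooth_A
  have hAB : ContDiffOn ℝ ∞ (fun x => Ψ.A (Φ.X x) * Φ.B x) I := hAX.mul hΦ.smooth_B
  have e1 := deriv_smooth_comp hI hJ hΦ.smooth_X hΨ.smooth_X h hj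
  have e2 := deriv_deriv_smooth_comp hI hJ hΦ.smooth_X hΨ.smooth_X h hj
  have e3 := deriv_smooth_comp hI hJ hΦ.smooth_X hΨ.smooth_A h hj
  have e4 := deriv_deriv_smooth_comp hI hJ hΦ.smooth_X hΨ.smooth_A h hj
  have e5 := deriv_smooth_comp hI hJ hΦ.smooth_X hΨ.smooth_B h hj
  have e6 := deriv_deriv_smooth_comp hI hJ hΦ.smooth_X hΨ.smooth_B h hj
  have e7 := deriv_smooth_mul hI hAX hΦ.smooth_A hj
  have e8 := deriv_deriv_smooth_mul hI hAX hΦ.smooth_A hj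
  have e9 := deriv_smooth_mul hI hAX hΦ.smooth_B hj
  have e10 := deriv_deriv_smooth_mul hI hAX hΦ.smooth_B hj
  have e11 := deriv_smooth_add hI hAB hBX hj
  have e12 := deriv_deriv_smooth_add hI hAB hBX hj
  simp only [Function.comp_def] at e7 e8 e9 e10 e11 e12
  simp only [jet, comp, Jet.mk.injEq]
  rw [e12, e11, e10, e9, e8, e7, e6, e5, e4, e3, e2, e1]
  refine ⟨by ring, trivial, by ring, by field_simp, by field_simp; ring, by field_simp; ring,
    by field_simp; ring⟩

/-- The hypotheses are imposed on `I` only: a transformation composed with its inverse is the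
identity just there, and openness of `I` suffices for the derivatives. -/
lemma jet_eq_self (hI : IsOpen I) (ha : Φ.a = 1) (hb : Φ.b = 0) (hX : ∀ x ∈ I, Φ.X x = x)
    (hA : ∀ x ∈ I, Φ.A x = 1) (hB : ∀ x ∈ I, Φ.B x = 0) (hj : j.x ∈ I) : Φ.jet j = j := by
  have e1 := deriv_congr_of_isOpen (g := fun x => x) hI hX hj
  have e2 := deriv_deriv_congr_of_isOpen (g := fun x => x) hI hX hj
  have e3 := deriv_congr_of_isOpen (g := fun _ => (1 : ℝ)) hI hA hj
  have e4 := deriv_deriv_congr_of_isOpen (g := fun _ => (1 : ℝ)) hI hA hj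
  have e5 := deriv_congr_of_isOpen (g := fun _ => (0 : ℝ)) hI hB hj
  have e6 := deriv_deriv_congr_of_isOpen (g := fun _ => (0 : ℝ)) hI hB hj
  have e7 : deriv (fun x : ℝ => x) = fun _ => 1 := by ext; simp
  simp only [jet, e1, e2, e3, e4, e5, e6, ha, hb, hX _ hj, hA _ hj, hB _ hj]
  simp [e7]

lemma Nondegenerate.comp (hΦ : Φ.Nondegenerate I) (hΨ : Ψ.Nondegenerate J) (hI : IsOpen I)
    (hJ : IsOpen J) (h : MapsTo Φ.X I J) : (Ψ.comp Φ).Nondegenerate I where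
  a_ne := mul_ne_zero hΨ.a_ne hΦ.a_ne
  smooth_X := hΨ.smooth_X.comp hΦ.smooth_X h
  smooth_A := (hΨ.smooth_A.comp hΦ.smooth_X h).mul hΦ.smooth_A
  smooth_B := ((hΨ.smooth_A.comp hΦ.smooth_X h).mul hΦ.smooth_B).add
    (hΨ.smooth_B.comp hΦ.smooth_X h)
  deriv_X_ne x hx := by
    have := deriv_smooth_comp hI hJ hΦ.smooth_X hΨ.smooth_X h hx
    simp only [PointMap.comp]
    rw [this]
    exact mul_ne_zero (hΨ.deriv_X_ne _ (h hx)) (hΦ.deriv_X_ne _ hx)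
  A_ne x hx := mul_ne_zero (hΨ.A_ne _ (h hx)) (hΦ.A_ne _ hx)

/-- The inverse of a point transformation, `Y` being the inverse of `x ↦ X(x)`. -/
noncomputable def inv (Φ : PointMap) (Y : ℝ → ℝ) : PointMap where
  a := Φ.a⁻¹
  b := -(Φ.a⁻¹ * Φ.b)
  X := Y
  A := fun x => (Φ.A (Y x))⁻¹
  B := fun x => -((Φ.A (Y x))⁻¹ * Φ.B (Y x))

end PointMap

/-! ### Point transformations conjugating equations -/

namespace Equation

/-- Regularity of the coefficients of an equation. -/
structure Regular (E : Equation) : Prop where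
  smooth_f : ContDiffOn ℝ ∞ E.f E.I
  smooth_g : ContDiffOn ℝ ∞ E.g E.I
  isOpen_vals : IsOpen E.vals
  differentiableAt_N : ∀ x ∈ E.I, ∀ u ∈ E.vals,
    DifferentiableAt ℝ (fun q : ℝ × ℝ => E.N q.1 q.2) (x, u)

end Equation

/-- `Φ` carries the equation `E` to the equation `E'`, on the level of jets. -/
structure PointMap.Conj (Φ : PointMap) (E E' : Equation) : Prop extends
    Φ.Nondegenerate E.I where
  bijOn : BijOn Φ.X E.I E'.I
  range_iff : ∀ x ∈ E.I, ∀ w, w ∈ E.range ↔ Φ.A x * w + Φ.B x ∈ E'.range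
  vals_iff : ∀ x ∈ E.I, ∀ w, w ∈ E.vals ↔ Φ.A x * w + Φ.B x ∈ E'.vals
  exists_factor : ∃ l : ℝ → ℝ, ContDiffOn ℝ ∞ l E.I ∧ (∀ x ∈ E.I, l x ≠ 0) ∧
    ∀ j : Jet, j.x ∈ E.I → j.u ∈ E.vals → E'.L (Φ.jet j) = l j.x * E.L j

namespace PointMap.Conj

variable {Φ Ψ : PointMap} {E E' E'' : Equation}

lemma refl (E : Equation) : (⟨1, 0, fun x => x, fun _ => 1, fun _ => 0⟩ : PointMap).Conj E E where
  a_ne := one_ne_zero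
  smooth_X := contDiffOn_id
  smooth_A := contDiffOn_const
  smooth_B := contDiffOn_const
  deriv_X_ne := by simp
  A_ne := by simp
  bijOn := bijOn_id _
  range_iff := by simp
  vals_iff := by simp
  exists_factor := by
    refine ⟨fun _ => 1, contDiffOn_const, by simp, fun j hj _ => ?_⟩
    rw [PointMap.jet_eq_self E.isOpen_I rfl rfl (fun _ _ => rfl) (fun _ _ => rfl)
      (fun _ _ => rfl) hj, one_mul]

lemma trans (hΦ : Φ.Conj E E') (hΨ : Ψ.Conj E' E'') : (Ψ.comp Φ).Conj E E'' where
  toNondegenerate := hΦ.toNondegenerate.comp hΨ.toNondegenerate E.isOpen_I E'.isOpen_I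
    hΦ.bijOn.mapsTo
  bijOn := hΨ.bijOn.comp hΦ.bijOn
  range_iff x hx w := by
    rw [hΦ.range_iff x hx w, hΨ.range_iff _ (hΦ.bijOn.mapsTo hx)]
    simp only [PointMap.comp]
    ring_nf
  vals_iff x hx w := by
    rw [hΦ.vals_iff x hx w, hΨ.vals_iff _ (hΦ.bijOn.mapsTo hx)]
    simp only [PointMap.comp]
    ring_nf
  exists_factor := by
    obtain ⟨l, hl, hl0, h⟩ := hΦ.exists_factor
    obtain ⟨k, hk, hk0, h'⟩ := hΨ.exists_factor
    refine ⟨fun x => k (Φ.X x) * l x, (hk.comp hΦ.smooth_X hΦ.bijOn.mapsTo).mul hl,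
      fun x hx => mul_ne_zero (hk0 _ (hΦ.bijOn.mapsTo hx)) (hl0 _ hx), fun j hj hu => ?_⟩
    rw [PointMap.jet_comp E.isOpen_I E'.isOpen_I hΦ.toNondegenerate hΨ.toNondegenerate
      hΦ.bijOn.mapsTo hj, h' _ (hΦ.bijOn.mapsTo hj) ((hΦ.vals_iff _ hj _).1 hu), h j hj hu,
      mul_assoc]
    rfl

/-- The factor of the inverse is the reciprocal of `l` along the inverse of `Φ.X`. The inversion
formulas on points and on jets are part of the conclusion because push-forwards are evaluated at
preimages. -/
lemma symm (hΦ : Φ.Conj E E') : ∃ Ψ : PointMap, Ψ.Conj E' E ∧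
    (∀ p ∈ E.space, Ψ.toFun (Φ.toFun p) = p) ∧ (∀ q ∈ E'.space, Φ.toFun (Ψ.toFun q) = q) ∧
    ∀ j : Jet, j.x ∈ E'.I → Φ.jet (Ψ.jet j) = j := by
  obtain ⟨Y, hY, hYb, hYX, hXY⟩ :=
    exists_smooth_inverse E.isOpen_I hΦ.smooth_X hΦ.deriv_X_ne hΦ.bijOn
  have a0 := hΦ.a_ne
  have hAY : ContDiffOn ℝ ∞ (fun x => (Φ.A (Y x))⁻¹) E'.I :=
    (hΦ.smooth_A.comp hY hYb.mapsTo).inv fun x hx => hΦ.A_ne _ (hYb.mapsTo hx)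
  -- If `Y'` vanished somewhere, the chain rule for `Φ.X ∘ Y = id` would give 1 = 0.
  have hY' : ∀ y ∈ E'.I, deriv Y y ≠ 0 := by
    intro y hy h0
    have h1 := deriv_smooth_comp E'.isOpen_I E.isOpen_I hY hΦ.smooth_X hYb.mapsTo hy
    rw [deriv_congr_of_isOpen (g := fun y => y) E'.isOpen_I hXY hy, h0] at h1
    simp at h1
  have hN : (Φ.inv Y).Nondegenerate E'.I :=
    { a_ne := inv_ne_zero a0
      smooth_X := hY
      smooth_A := hAY
      smooth_B := (hAY.mul (hΦ.smooth_B.comp hY hYb.mapsTo)).neg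
      deriv_X_ne := hY'
      A_ne := fun x hx => inv_ne_zero (hΦ.A_ne _ (hYb.mapsTo hx)) }
  have key : ∀ y ∈ E'.I, ∀ w : ℝ,
      Φ.A (Y y) * ((Φ.A (Y y))⁻¹ * w + -((Φ.A (Y y))⁻¹ * Φ.B (Y y))) + Φ.B (Y y) = w := by
    intro y hy w
    have := hΦ.A_ne _ (hYb.mapsTo hy)
    field_simp
    ring
  have e : ∀ j : Jet, j.x ∈ E'.I → Φ.jet ((Φ.inv Y).jet j) = j := by
    intro j hj
    rw [← PointMap.jet_comp E'.isOpen_I E.isOpen_I hN hΦ.toNondegenerate hYb.mapsTo hj]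
    refine PointMap.jet_eq_self E'.isOpen_I (mul_inv_cancel₀ a0) ?_ hXY ?_ ?_ hj
    · simp only [PointMap.comp, PointMap.inv]; field_simp; ring
    · intro y hy
      exact mul_inv_cancel₀ (hΦ.A_ne _ (hYb.mapsTo hy))
    · intro y hy
      have := hΦ.A_ne _ (hYb.mapsTo hy)
      simp only [PointMap.comp, PointMap.inv]; field_simp; ring
  refine ⟨Φ.inv Y, ⟨hN, hYb, ?_, ?_, ?_⟩, ?_, ?_, e⟩
  · intro y hy w
    rw [hΦ.range_iff _ (hYb.mapsTo hy)]
    simp only [PointMap.inv]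
    rw [key y hy w]
  · intro y hy w
    rw [hΦ.vals_iff _ (hYb.mapsTo hy)]
    simp only [PointMap.inv]
    rw [key y hy w]
  · obtain ⟨l, hl, hl0, h⟩ := hΦ.exists_factor
    refine ⟨fun y => (l (Y y))⁻¹, (hl.comp hY hYb.mapsTo).inv fun y hy => hl0 _ (hYb.mapsTo hy),
      fun y hy => inv_ne_zero (hl0 _ (hYb.mapsTo hy)), fun j hj hu => ?_⟩
    have hjY : ((Φ.inv Y).jet j).x ∈ E.I := hYb.mapsTo hj
    have h1 := h ((Φ.inv Y).jet j) hjY (by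
      rw [hΦ.vals_iff _ hjY]
      have := key _ hj j.u
      simp only [PointMap.inv, PointMap.jet]
      rwa [this])
    rw [e j hj] at h1
    rw [h1]
    have := hl0 _ hjY
    simp only [PointMap.inv, PointMap.jet] at this ⊢
    field_simp
  · rintro ⟨t, x, u⟩ ⟨-, hx, -⟩
    have := hΦ.A_ne _ hx
    simp only [PointMap.toFun, PointMap.inv, hYX x hx, Prod.mk.injEq, true_and]
    constructor <;> field_simp <;> ring
  · rintro ⟨t, y, u⟩ ⟨-, hy, -⟩
    simp only [PointMap.toFun, PointMap.inv, hXY y hy, Prod.mk.injEq, key y hy u, and_true]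
    field_simp
    ring

end PointMap.Conj


/-! ### The differential of a point transformation and its action on solutions -/

namespace PointMap

variable {Φ : PointMap} {E E' : Equation}

lemma Nondegenerate.smooth_toFun {I R : Set ℝ} (hΦ : Φ.Nondegenerate I) :
    ContDiffOn ℝ ∞ Φ.toFun ((univ : Set ℝ) ×ˢ (I ×ˢ R)) := by
  have h1 : ContDiffOn ℝ ∞ (fun p : Pt => p.2.1) ((univ : Set ℝ) ×ˢ (I ×ˢ R)) :=
    (contDiff_fst.comp contDiff_snd).contDiffOn
  have h2 : ContDiffOn ℝ ∞ (fun p : Pt => p.2.2) ((univ : Set ℝ) ×ˢ (I ×ˢ R)) :=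
    (contDiff_snd.comp contDiff_snd).contDiffOn
  have hm : MapsTo (fun p : Pt => p.2.1) ((univ : Set ℝ) ×ˢ (I ×ˢ R)) I := fun p hp => hp.2.1
  have h0 : ContDiffOn ℝ ∞ (fun p : Pt => Φ.a * p.1 + Φ.b) ((univ : Set ℝ) ×ˢ (I ×ˢ R)) :=
    ((contDiff_const.mul contDiff_fst).add contDiff_const).contDiffOn
  exact h0.prodMk ((hΦ.smooth_X.comp h1 hm).prodMk
    (((hΦ.smooth_A.comp h1 hm).mul h2).add (hΦ.smooth_B.comp h1 hm)))

/-- The triangular Jacobian is obtained by differentiating `Φ` along the line through `p` with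
direction `v`, once componentwise and once by the chain rule. -/
lemma Nondegenerate.fderiv_toFun {I R : Set ℝ} (hI : IsOpen I) (hR : IsOpen R)
    (hΦ : Φ.Nondegenerate I) {p : Pt} (hp : p ∈ (univ : Set ℝ) ×ˢ (I ×ˢ R)) (v : Pt) :
    fderiv ℝ Φ.toFun p v = (Φ.a * v.1, deriv Φ.X p.2.1 * v.2.1,
      (deriv Φ.A p.2.1 * p.2.2 + deriv Φ.B p.2.1) * v.2.1 + Φ.A p.2.1 * v.2.2) := by
  have hd : DifferentiableAt ℝ Φ.toFun p :=
    (hΦ.smooth_toFun.contDiffAt ((isOpen_univ.prod (hI.prod hR)).mem_nhds hp)).differentiableAt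
      (by simp)
  have hx : p.2.1 ∈ I := hp.2.1
  have l1 : HasDerivAt (fun s : ℝ => p.1 + s * v.1) v.1 0 := by
    simpa using ((hasDerivAt_id (0 : ℝ)).mul_const v.1).const_add p.1
  have l2 : HasDerivAt (fun s : ℝ => p.2.1 + s * v.2.1) v.2.1 0 := by
    simpa using ((hasDerivAt_id (0 : ℝ)).mul_const v.2.1).const_add p.2.1
  have l3 : HasDerivAt (fun s : ℝ => p.2.2 + s * v.2.2) v.2.2 0 := by
    simpa using ((hasDerivAt_id (0 : ℝ)).mul_const v.2.2).const_add p.2.2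
  have e2 : p.2.1 = p.2.1 + 0 * v.2.1 := by simp
  have hX := HasDerivAt.comp (h₂ := Φ.X) (h := fun s : ℝ => p.2.1 + s * v.2.1) 0
    (e2 ▸ smooth_hasDerivAt hI hΦ.smooth_X hx) l2
  have hA := HasDerivAt.comp (h₂ := Φ.A) (h := fun s : ℝ => p.2.1 + s * v.2.1) 0
    (e2 ▸ smooth_hasDerivAt hI hΦ.smooth_A hx) l2
  have hB := HasDerivAt.comp (h₂ := Φ.B) (h := fun s : ℝ => p.2.1 + s * v.2.1) 0
    (e2 ▸ smooth_hasDerivAt hI hΦ.smooth_B hx) l2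
  have hl : HasDerivAt (fun s : ℝ => Φ.toFun (p.1 + s * v.1, p.2.1 + s * v.2.1, p.2.2 + s * v.2.2))
      _ 0 := ((l1.const_mul Φ.a).add_const Φ.b).prodMk (hX.prodMk ((hA.mul l3).add hB))
  have hl' := HasFDerivAt.comp_hasDerivAt (l := Φ.toFun) (l' := fderiv ℝ Φ.toFun p)
    (f := fun s : ℝ => ((p.1 + s * v.1, p.2.1 + s * v.2.1, p.2.2 + s * v.2.2) : Pt)) (0 : ℝ)
    (by simpa using hd.hasFDerivAt) (l1.prodMk (l2.prodMk l3))
  have := hl'.unique hl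
  refine this.trans ?_
  simp only [Function.comp_apply, zero_mul, add_zero, Prod.mk.injEq, true_and]
  ring

end PointMap

namespace Equation

/-- The slot `r` for u_tx is free because `L` does not contain u_tx; it can be filled with whatever
value `PointMap.jet` produces. -/
lemma holdsAt_iff {E : Equation} (hE : E.Regular) {u : ℝ → ℝ → ℝ} {t x : ℝ} (hx : x ∈ E.I)
    (hu : ContDiffOn ℝ ∞ (u t) E.I) (r : ℝ) :
    E.HoldsAt u t x ↔ E.L ⟨t, x, u t x, deriv (fun s => u s x) t, deriv (u t) x, r,
      deriv (deriv (u t)) x⟩ = 0 := by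
  have h := deriv_smooth_mul E.isOpen_I hE.smooth_g (smooth_deriv E.isOpen_I hu) hx
  unfold HoldsAt L
  rw [h]
  constructor <;> intro h <;> simp only at h ⊢ <;> linarith

end Equation

namespace PointMap.Conj

variable {Φ : PointMap} {E E' : Equation}

lemma mapsTo_space (hΦ : Φ.Conj E E') : MapsTo Φ.toFun E.space E'.space := by
  rintro ⟨t, x, u⟩ ⟨-, hx, hu⟩
  exact ⟨trivial, hΦ.bijOn.mapsTo hx, (hΦ.range_iff x hx u).1 hu⟩

lemma smooth_toFun (hΦ : Φ.Conj E E') : ContDiffOn ℝ ∞ Φ.toFun E.space :=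
  hΦ.toNondegenerate.smooth_toFun

lemma fderiv_toFun (hΦ : Φ.Conj E E') {p : Pt} (hp : p ∈ E.space) (v : Pt) :
    fderiv ℝ Φ.toFun p v = (Φ.a * v.1, deriv Φ.X p.2.1 * v.2.1,
      (deriv Φ.A p.2.1 * p.2.2 + deriv Φ.B p.2.1) * v.2.1 + Φ.A p.2.1 * v.2.2) :=
  hΦ.toNondegenerate.fderiv_toFun E.isOpen_I E.isOpen_range hp v

lemma injective_fderiv (hΦ : Φ.Conj E E') {p : Pt} (hp : p ∈ E.space) :
    Function.Injective (fderiv ℝ Φ.toFun p) := by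
  have ha := hΦ.a_ne
  have hX := hΦ.deriv_X_ne _ hp.2.1
  have hA := hΦ.A_ne _ hp.2.1
  refine (injective_iff_map_eq_zero _).2 ?_
  rintro ⟨τ, ξ, η⟩ h
  rw [hΦ.fderiv_toFun hp] at h
  simp only [Prod.mk_eq_zero, mul_eq_zero, ha, hX, false_or] at h
  obtain ⟨rfl, rfl, h⟩ := h
  simp only [mul_zero, zero_add, mul_eq_zero, hA, false_or] at h
  rw [h]; rfl

/-- A conjugation of equations maps solutions to solutions. -/
lemma mapsEquation (hΦ : Φ.Conj E E') (hE : E.Regular) (hE' : E'.Regular) :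
    Φ.MapsEquation E E' := by
  obtain ⟨Ψ, hΨ, hΨΦ, hΦΨ, -⟩ := hΦ.symm
  refine ⟨hΦ.smooth_toFun, ⟨hΦ.mapsTo_space, ?_, ?_⟩, ?_, hΦ.vals_iff, ?_⟩
  · intro p hp q hq h
    rw [← hΨΦ p hp, h, hΨΦ q hq]
  · intro q hq
    exact ⟨Ψ.toFun q, hΨ.mapsTo_space hq, hΦΨ q hq⟩
  · intro p hp
    have hi := hΦ.injective_fderiv hp
    exact ⟨hi, LinearMap.surjective_of_injective (f := (fderiv ℝ Φ.toFun p).toLinearMap) hi⟩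
  · intro u v hu huv t x hx hux
    have a0 := hΦ.a_ne
    have hX0 := hΦ.deriv_X_ne x hx
    obtain ⟨Y, hY, hYb, hYX, hXY⟩ :=
      exists_smooth_inverse E.isOpen_I hΦ.smooth_X hΦ.deriv_X_ne hΦ.bijOn
    have hut : ContDiffOn ℝ ∞ (u t) E.I :=
      hu.comp (contDiffOn_const.prodMk contDiffOn_id) fun y hy => ⟨trivial, hy⟩
    have hW : ContDiffOn ℝ ∞ (fun y => Φ.A y * u t y + Φ.B y) E.I :=
      (hΦ.smooth_A.mul hut).add hΦ.smooth_B
    -- `v` is known only through its values at image points, so its smoothness in `x` comes from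
    -- writing it with the inverse `Y` of `Φ.X`.
    have hv : ContDiffOn ℝ ∞ (v (Φ.a * t + Φ.b)) E'.I := by
      refine (hW.comp hY hYb.mapsTo).congr fun y hy => ?_
      have := huv t (Y y) (hYb.mapsTo hy)
      rwa [hXY y hy] at this
    have e0 := huv t x hx
    have e1 := deriv_smooth_comp E.isOpen_I E'.isOpen_I hΦ.smooth_X hv hΦ.bijOn.mapsTo hx
    have e2 := deriv_deriv_smooth_comp E.isOpen_I E'.isOpen_I hΦ.smooth_X hv hΦ.bijOn.mapsTo hx
    have hAu : ContDiffOn ℝ ∞ (fun y => Φ.A y * u t y) E.I := hΦ.smooth_A.mul hut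
    rw [deriv_congr_of_isOpen E.isOpen_I (huv t) hx,
      deriv_smooth_add E.isOpen_I hAu hΦ.smooth_B hx,
      deriv_smooth_mul E.isOpen_I hΦ.smooth_A hut hx] at e1
    rw [deriv_deriv_congr_of_isOpen E.isOpen_I (huv t) hx,
      deriv_deriv_smooth_add E.isOpen_I hAu hΦ.smooth_B hx,
      deriv_deriv_smooth_mul E.isOpen_I hΦ.smooth_A hut hx] at e2
    have e3 : deriv (fun s => v s (Φ.X x)) (Φ.a * t + Φ.b) =
        Φ.A x * deriv (fun s => u s x) t / Φ.a := by
      have h1 : ∀ s, v s (Φ.X x) = Φ.A x * u (Φ.a⁻¹ * s - Φ.a⁻¹ * Φ.b) x + Φ.B x := by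
        intro s
        rw [← huv _ x hx]
        congr 1
        field_simp
        ring
      have hd : HasDerivAt (fun s => u s x) (deriv (fun s => u s x) t)
          (Φ.a⁻¹ * (Φ.a * t + Φ.b) - Φ.a⁻¹ * Φ.b) := by
        have e : Φ.a⁻¹ * (Φ.a * t + Φ.b) - Φ.a⁻¹ * Φ.b = t := by field_simp; ring
        rw [e]
        have : ContDiffOn ℝ ∞ (fun s => u s x) univ :=
          hu.comp (contDiffOn_id.prodMk contDiffOn_const) fun s _ => ⟨trivial, hx⟩
        exact smooth_hasDerivAt isOpen_univ this trivial
      have hd2 : HasDerivAt (fun s => Φ.a⁻¹ * s - Φ.a⁻¹ * Φ.b) Φ.a⁻¹ (Φ.a * t + Φ.b) := by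
        simpa using ((hasDerivAt_id (Φ.a * t + Φ.b)).const_mul Φ.a⁻¹).sub_const (Φ.a⁻¹ * Φ.b)
      have h3 := ((HasDerivAt.comp (h₂ := fun s => u s x)
        (h := fun s => Φ.a⁻¹ * s - Φ.a⁻¹ * Φ.b) (Φ.a * t + Φ.b) hd hd2).const_mul
        (Φ.A x)).add_const (Φ.B x)
      rw [show (fun s => v s (Φ.X x)) =
        fun s => Φ.A x * u (Φ.a⁻¹ * s - Φ.a⁻¹ * Φ.b) x + Φ.B x from funext h1]
      refine h3.deriv.trans ?_
      field_simp
    obtain ⟨l, -, hl0, h⟩ := hΦ.exists_factor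
    have hj := h ⟨t, x, u t x, deriv (fun s => u s x) t, deriv (u t) x, 0,
      deriv (deriv (u t)) x⟩ hx hux
    rw [Equation.holdsAt_iff hE hx hut 0, Equation.holdsAt_iff hE' (hΦ.bijOn.mapsTo hx) hv
      ((deriv Φ.A x * deriv (fun s => u s x) t + Φ.A x * 0) / (Φ.a * deriv Φ.X x))]
    -- The jet of `v` is the image of the jet of `u`. The slot u_tx holds 0 on one side and the
    -- image of that choice on the other, which is harmless.
    have hjet : Φ.jet ⟨t, x, u t x, deriv (fun s => u s x) t, deriv (u t) x, 0,
      deriv (deriv (u t)) x⟩ = ⟨Φ.a * t + Φ.b, Φ.X x, v (Φ.a * t + Φ.b) (Φ.X x),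
        deriv (fun s => v s (Φ.X x)) (Φ.a * t + Φ.b), deriv (v (Φ.a * t + Φ.b)) (Φ.X x),
        (deriv Φ.A x * deriv (fun s => u s x) t + Φ.A x * 0) / (Φ.a * deriv Φ.X x),
        deriv (deriv (v (Φ.a * t + Φ.b))) (Φ.X x)⟩ := by
      simp only [PointMap.jet, Jet.mk.injEq, true_and]
      refine ⟨e0.symm, e3.symm, ?_, ?_⟩
      · rw [e1]; field_simp
      · rw [e1, eq_comm, eq_div_iff (pow_ne_zero 2 hX0), eq_sub_iff_add_eq]
        rw [mul_div_cancel_right₀ _ hX0, mul_comm (deriv (deriv Φ.X) x), ← e2]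
    rw [← hjet, hj, mul_eq_zero, or_iff_right (hl0 x hx)]

end PointMap.Conj


/-! ### Functions of `(t, x, u)` along curves -/

section Curves

variable {φ : Pt → ℝ} {Ω : Set Pt}

lemma hasDerivAt_curve {a b c : ℝ → ℝ} {s a' b' c' : ℝ}
    (hφ : DifferentiableAt ℝ φ (a s, b s, c s)) (ha : HasDerivAt a a' s) (hb : HasDerivAt b b' s)
    (hc : HasDerivAt c c' s) :
    HasDerivAt (fun r => φ (a r, b r, c r))
      (a' * dT φ (a s, b s, c s) + b' * dX φ (a s, b s, c s) + c' * dU φ (a s, b s, c s)) s := by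
  have h := HasFDerivAt.comp_hasDerivAt (l := φ) (l' := fderiv ℝ φ (a s, b s, c s))
    (f := fun r : ℝ => ((a r, b r, c r) : Pt)) s hφ.hasFDerivAt (ha.prodMk (hb.prodMk hc))
  refine h.congr_deriv ?_
  rw [dT_eq hφ, dX_eq hφ, dU_eq hφ]
  have e : ((a', b', c') : Pt) = a' • (1, 0, 0) + b' • (0, 1, 0) + c' • (0, 0, 1) := by
    ext <;> simp
  rw [e, map_add, map_add, map_smul, map_smul, map_smul]
  simp

/-- Symmetry of the second differential. It is needed because `totXX` writes both mixed derivatives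
as `dX (dU φ)`. -/
lemma dU_dX (hΩ : IsOpen Ω) (h : ContDiffOn ℝ ∞ φ Ω) {p : Pt} (hp : p ∈ Ω) :
    dU (dX φ) p = dX (dU φ) p := by
  rw [dU_eq (differentiableAt_of_smooth hΩ (smooth_dX hΩ h) hp),
    dX_eq (differentiableAt_of_smooth hΩ (smooth_dU hΩ h) hp)]
  have e1 : dX φ =ᶠ[𝓝 p] fun q => fderiv ℝ φ q (0, 1, 0) :=
    eventuallyEq_of_mem (hΩ.mem_nhds hp) fun q hq => dX_eq (differentiableAt_of_smooth hΩ h hq)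
  have e2 : dU φ =ᶠ[𝓝 p] fun q => fderiv ℝ φ q (0, 0, 1) :=
    eventuallyEq_of_mem (hΩ.mem_nhds hp) fun q hq => dU_eq (differentiableAt_of_smooth hΩ h hq)
  have hd : DifferentiableAt ℝ (fderiv ℝ φ) p :=
    ((h.fderiv_of_isOpen (m := ∞) hΩ (by simp)).contDiffAt (hΩ.mem_nhds hp)).differentiableAt
      (by simp)
  rw [e1.fderiv_eq, e2.fderiv_eq, fderiv_clm_apply hd (differentiableAt_const _),
    fderiv_clm_apply hd (differentiableAt_const _)]
  have hs : IsSymmSndFDerivAt ℝ φ p :=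
    (h.contDiffAt (hΩ.mem_nhds hp)).isSymmSndFDerivAt
      (by rw [minSmoothness_of_isRCLikeNormedField]; exact WithTop.coe_le_coe.2 le_top)
  simpa using hs.eq (0, 0, 1) (0, 1, 0)

variable {t : ℝ} {J : Set ℝ} {X W : ℝ → ℝ}

lemma smooth_curve (hφ : ContDiffOn ℝ ∞ φ Ω) (hX : ContDiffOn ℝ ∞ X J) (hW : ContDiffOn ℝ ∞ W J)
    (h : ∀ y ∈ J, (t, X y, W y) ∈ Ω) : ContDiffOn ℝ ∞ (fun y => φ (t, X y, W y)) J :=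
  hφ.comp (contDiffOn_const.prodMk (hX.prodMk hW)) h

lemma deriv_curve (hΩ : IsOpen Ω) (hφ : ContDiffOn ℝ ∞ φ Ω) (hJ : IsOpen J)
    (hX : ContDiffOn ℝ ∞ X J) (hW : ContDiffOn ℝ ∞ W J) (h : ∀ y ∈ J, (t, X y, W y) ∈ Ω)
    {y : ℝ} (hy : y ∈ J) :
    HasDerivAt (fun y => φ (t, X y, W y))
      (deriv X y * dX φ (t, X y, W y) + deriv W y * dU φ (t, X y, W y)) y := by
  refine (hasDerivAt_curve (a := fun _ => t) (differentiableAt_of_smooth hΩ hφ (h y hy))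
    (hasDerivAt_const y t) (smooth_hasDerivAt hJ hX hy) (smooth_hasDerivAt hJ hW hy)).congr_deriv ?_
  ring

/-- Total derivatives are derivatives along graphs. The parametrization `X` lets one lemma serve
both for a graph over `x` (with `X` the identity) and for its image under a point transformation;
the second-order version below has the same purpose. -/
lemma deriv_curve_eq_totX (hΩ : IsOpen Ω) (hφ : ContDiffOn ℝ ∞ φ Ω) (hJ : IsOpen J)
    (hX : ContDiffOn ℝ ∞ X J) (hW : ContDiffOn ℝ ∞ W J) (h : ∀ y ∈ J, (t, X y, W y) ∈ Ω)
    {y : ℝ} (hy : y ∈ J) {j : Jet} (hj : j.pt = (t, X y, W y)) (h1 : deriv W y = deriv X y * j.ux) :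
    deriv (fun y => φ (t, X y, W y)) y = deriv X y * totX φ j := by
  rw [(deriv_curve hΩ hφ hJ hX hW h hy).deriv, totX, hj, h1]
  ring

lemma deriv_deriv_curve_eq_totXX (hΩ : IsOpen Ω) (hφ : ContDiffOn ℝ ∞ φ Ω) (hJ : IsOpen J)
    (hX : ContDiffOn ℝ ∞ X J) (hW : ContDiffOn ℝ ∞ W J) (h : ∀ y ∈ J, (t, X y, W y) ∈ Ω)
    {y : ℝ} (hy : y ∈ J) {j : Jet} (hj : j.pt = (t, X y, W y)) (h1 : deriv W y = deriv X y * j.ux)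
    (h2 : deriv (deriv W) y = deriv X y ^ 2 * j.uxx + deriv (deriv X) y * j.ux) :
    deriv (deriv (fun y => φ (t, X y, W y))) y =
      deriv X y ^ 2 * totXX φ j + deriv (deriv X) y * totX φ j := by
  rw [deriv_congr_of_isOpen hJ (fun y hy => (deriv_curve hΩ hφ hJ hX hW h hy).deriv) hy]
  have d1 := deriv_curve hΩ (smooth_dX hΩ hφ) hJ hX hW h hy
  have d2 := deriv_curve hΩ (smooth_dU hΩ hφ) hJ hX hW h hy
  refine (((smooth_hasDerivAt_deriv hJ hX hy).mul d1).add
    ((smooth_hasDerivAt_deriv hJ hW hy).mul d2)).deriv.trans ?_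
  rw [dU_dX hΩ hφ (h y hy), totXX, totX, hj, h1, h2]
  ring

lemma deriv_time_curve (hΩ : IsOpen Ω) (hφ : ContDiffOn ℝ ∞ φ Ω) {a x : ℝ} {T W : ℝ → ℝ} {s : ℝ}
    (hT : HasDerivAt T a s) {j : Jet} (hW : HasDerivAt W (a * j.ut) s) (hj : j.pt = (T s, x, W s))
    (hp : (T s, x, W s) ∈ Ω) :
    HasDerivAt (fun s => φ (T s, x, W s)) (a * totT φ j) s := by
  refine (hasDerivAt_curve (b := fun _ => x) (differentiableAt_of_smooth hΩ hφ hp) hT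
    (hasDerivAt_const s x) hW).congr_deriv ?_
  rw [totT, hj]
  ring

end Curves

/-! ### Prolonged vector fields -/

namespace Equation

/-- The prolongation of `Q` applied to `L` is the derivative of `L` along any curve of jets whose
velocity is the prolongation of `Q`. -/
lemma hasDerivAt_L {E : Equation} (hE : E.Regular) {Q : Pt → Pt} {γ : ℝ → Jet} {j : Jet} {s : ℝ}
    (hγ : γ s = j) (hx : j.x ∈ E.I) (hu : j.u ∈ E.vals)
    (dx : HasDerivAt (fun r => (γ r).x) (cξ Q j.pt) s)
    (du : HasDerivAt (fun r => (γ r).u) (cη Q j.pt) s)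
    (dut : HasDerivAt (fun r => (γ r).ut) (etaT Q j) s)
    (dux : HasDerivAt (fun r => (γ r).ux) (etaX Q j) s)
    (duxx : HasDerivAt (fun r => (γ r).uxx) (etaXX Q j) s) :
    HasDerivAt (fun r => E.L (γ r)) (E.prolongL Q j) s := by
  subst hγ
  set j := γ s with hj
  have hN := hE.differentiableAt_N _ hx _ hu
  have nx : HasDerivAt (fun y => E.N y j.u)
      (fderiv ℝ (fun q : ℝ × ℝ => E.N q.1 q.2) (j.x, j.u) (1, 0)) j.x :=
    HasFDerivAt.comp_hasDerivAt (l := fun q : ℝ × ℝ => E.N q.1 q.2) (f := fun y => (y, j.u)) j.x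
      hN.hasFDerivAt ((hasDerivAt_id _).prodMk (hasDerivAt_const _ _))
  have nu : HasDerivAt (fun y => E.N j.x y)
      (fderiv ℝ (fun q : ℝ × ℝ => E.N q.1 q.2) (j.x, j.u) (0, 1)) j.u :=
    HasFDerivAt.comp_hasDerivAt (l := fun q : ℝ × ℝ => E.N q.1 q.2) (f := fun y => (j.x, y)) j.u
      hN.hasFDerivAt ((hasDerivAt_const _ _).prodMk (hasDerivAt_id _))
  have df := smooth_hasDerivAt E.isOpen_I hE.smooth_f hx
  have dg := smooth_hasDerivAt E.isOpen_I hE.smooth_g hx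
  have dg' := smooth_hasDerivAt_deriv E.isOpen_I hE.smooth_g hx
  have cN := HasFDerivAt.comp_hasDerivAt (l := fun q : ℝ × ℝ => E.N q.1 q.2)
    (f := fun r => ((γ r).x, (γ r).u)) s hN.hasFDerivAt (dx.prodMk du)
  have cf := HasDerivAt.comp (h₂ := E.f) (h := fun r => (γ r).x) s df dx
  have cg := HasDerivAt.comp (h₂ := E.g) (h := fun r => (γ r).x) s dg dx
  have cg' := HasDerivAt.comp (h₂ := deriv E.g) (h := fun r => (γ r).x) s dg' dx
  have hall := ((cf.mul dut).sub ((cg'.mul dux).add (cg.mul duxx))).sub cN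
  refine hall.congr_deriv ?_
  have e1 : deriv (fun y => E.L { j with t := y }) j.t = 0 := by
    simp [L]
  have e2 : deriv (fun y => E.L { j with x := y }) j.x =
      deriv E.f j.x * j.ut - (deriv (deriv E.g) j.x * j.ux + deriv E.g j.x * j.uxx) -
        fderiv ℝ (fun q : ℝ × ℝ => E.N q.1 q.2) (j.x, j.u) (1, 0) :=
    (((df.mul_const j.ut).sub ((dg'.mul_const j.ux).add (dg.mul_const j.uxx))).sub nx).deriv
  have e3 : deriv (fun y => E.L { j with u := y }) j.u =
      -fderiv ℝ (fun q : ℝ × ℝ => E.N q.1 q.2) (j.x, j.u) (0, 1) :=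
    (nu.const_sub (E.f j.x * j.ut - (deriv E.g j.x * j.ux + E.g j.x * j.uxx))).deriv
  have e4 : deriv (fun y => E.L { j with ut := y }) j.ut = E.f j.x := by
    exact ((((hasDerivAt_id j.ut).const_mul (E.f j.x)).sub_const
      (deriv E.g j.x * j.ux + E.g j.x * j.uxx)).sub_const (E.N j.x j.u)).deriv.trans (by simp)
  have e5 : deriv (fun y => E.L { j with ux := y }) j.ux = -deriv E.g j.x := by
    exact ((((hasDerivAt_id j.ux).const_mul (deriv E.g j.x)).add_const
      (E.g j.x * j.uxx)).const_sub (E.f j.x * j.ut) |>.sub_const (E.N j.x j.u)).deriv.trans (by simp)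
  have e6 : deriv (fun y => E.L { j with uxx := y }) j.uxx = -E.g j.x := by
    exact ((((hasDerivAt_id j.uxx).const_mul (E.g j.x)).const_add
      (deriv E.g j.x * j.ux)).const_sub (E.f j.x * j.ut) |>.sub_const (E.N j.x j.u)).deriv.trans (by simp)
  have e7 : ((cξ Q j.pt, cη Q j.pt) : ℝ × ℝ) = cξ Q j.pt • (1, 0) + cη Q j.pt • (0, 1) := by
    ext <;> simp
  rw [prolongL, e1, e2, e3, e4, e5, e6, e7, map_add, map_smul, map_smul, smul_eq_mul, smul_eq_mul]
  simp only [Function.comp_apply, ← hj]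
  ring

end Equation

/-! ### Prolongations of vector fields related by a point transformation -/

namespace PointMap.Conj

variable {Φ : PointMap} {E E' : Equation} {Q Q' : Pt → Pt}

/-- Vector fields related by a point transformation have related prolongations: the components. -/
lemma related_components (hΦ : Φ.Conj E E')
    (hQQ' : ∀ p ∈ E.space, Q' (Φ.toFun p) = fderiv ℝ Φ.toFun p (Q p)) {p : Pt}
    (hp : p ∈ E.space) :
    cτ Q' (Φ.toFun p) = Φ.a * cτ Q p ∧ cξ Q' (Φ.toFun p) = deriv Φ.X p.2.1 * cξ Q p ∧
    cη Q' (Φ.toFun p) = Φ.A p.2.1 * cη Q p +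
      (deriv Φ.A p.2.1 * p.2.2 + deriv Φ.B p.2.1) * cξ Q p := by
  have h := hQQ' p hp
  rw [hΦ.fderiv_toFun hp] at h
  simp only [cτ, cξ, cη, h, true_and]
  ring

/-- The relations between components are differentiated along the curve s ↦ (s, x, u + (s - t) u_t).
Its image is a curve of the same kind with time velocity `Φ.a` and slope the transformed u_t. -/
lemma related_totT (hΦ : Φ.Conj E E') (hQ : ContDiffOn ℝ ∞ Q E.space)
    (hQ' : ContDiffOn ℝ ∞ Q' E'.space)
    (hQQ' : ∀ p ∈ E.space, Q' (Φ.toFun p) = fderiv ℝ Φ.toFun p (Q p)) {j : Jet}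
    (hp : j.pt ∈ E.space) :
    totT (cτ Q') (Φ.jet j) = totT (cτ Q) j ∧
    Φ.a * totT (cξ Q') (Φ.jet j) = deriv Φ.X j.x * totT (cξ Q) j ∧
    Φ.a * totT (cη Q') (Φ.jet j) = Φ.A j.x * totT (cη Q) j +
      (deriv Φ.A j.x * j.u + deriv Φ.B j.x) * totT (cξ Q) j + deriv Φ.A j.x * j.ut * cξ Q j.pt := by
  have a0 := hΦ.a_ne
  have o := E.isOpen_space
  have o' := E'.isOpen_space
  have q1 : ContDiffOn ℝ ∞ (cτ Q) E.space := hQ.fst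
  have q2 : ContDiffOn ℝ ∞ (cξ Q) E.space := hQ.snd.fst
  have q3 : ContDiffOn ℝ ∞ (cη Q) E.space := hQ.snd.snd
  have r1 : ContDiffOn ℝ ∞ (cτ Q') E'.space := hQ'.fst
  have r2 : ContDiffOn ℝ ∞ (cξ Q') E'.space := hQ'.snd.fst
  have r3 : ContDiffOn ℝ ∞ (cη Q') E'.space := hQ'.snd.snd
  have hw : HasDerivAt (fun s => j.u + (s - j.t) * j.ut) (1 * j.ut) j.t := by
    simpa using (((hasDerivAt_id j.t).sub_const j.t).mul_const j.ut).const_add j.u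
  have hw' : HasDerivAt (fun s => Φ.A j.x * (j.u + (s - j.t) * j.ut) + Φ.B j.x)
      (Φ.a * (Φ.jet j).ut) j.t := by
    refine ((hw.const_mul (Φ.A j.x)).add_const (Φ.B j.x)).congr_deriv ?_
    simp only [PointMap.jet]; field_simp
  have hT : HasDerivAt (fun s : ℝ => Φ.a * s + Φ.b) Φ.a j.t := by
    simpa using ((hasDerivAt_id j.t).const_mul Φ.a).add_const Φ.b
  have ept : j.pt = (j.t, j.x, j.u + (j.t - j.t) * j.ut) := by simp [Jet.pt]
  have ept' : (Φ.jet j).pt = (Φ.a * j.t + Φ.b, Φ.X j.x,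
      Φ.A j.x * (j.u + (j.t - j.t) * j.ut) + Φ.B j.x) := by simp [Jet.pt, PointMap.jet]
  have hp' : (Φ.jet j).pt ∈ E'.space := hΦ.mapsTo_space hp
  have ev : ∀ᶠ s in 𝓝 j.t, ((s, j.x, j.u + (s - j.t) * j.ut) : Pt) ∈ E.space := by
    have hc : ContinuousAt (fun s => ((s, j.x, j.u + (s - j.t) * j.ut) : Pt)) j.t := by fun_prop
    exact hc.eventually_mem (by rw [← ept]; exact o.mem_nhds hp)
  have c (φ : Pt → ℝ) (hφ : ContDiffOn ℝ ∞ φ E.space) :=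
    deriv_time_curve o hφ (hasDerivAt_id j.t) hw ept (ept ▸ hp)
  have c' (φ : Pt → ℝ) (hφ : ContDiffOn ℝ ∞ φ E'.space) :=
    deriv_time_curve o' hφ hT hw' ept' (ept' ▸ hp')
  refine ⟨?_, ?_, ?_⟩
  · have h := (c' _ r1).unique (((c _ q1).const_mul Φ.a).congr_of_eventuallyEq ?_)
    · exact mul_left_cancel₀ a0 (by simpa using h)
    · filter_upwards [ev] with s hs
      exact (hΦ.related_components hQQ' hs).1
  · have h := (c' _ r2).unique
      (((c _ q2).const_mul (deriv Φ.X j.x)).congr_of_eventuallyEq ?_)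
    · simpa using h
    · filter_upwards [ev] with s hs
      exact (hΦ.related_components hQQ' hs).2.1
  · have h := (c' _ r3).unique ((((c _ q3).const_mul (Φ.A j.x)).add
      (((hw.const_mul (deriv Φ.A j.x)).add_const (deriv Φ.B j.x)).mul
        (c _ q2))).congr_of_eventuallyEq ?_)
    · refine h.trans ?_
      simp only [sub_self, zero_mul, add_zero, Jet.pt, id]
      ring
    · filter_upwards [ev] with s hs
      exact (hΦ.related_components hQQ' hs).2.2

end PointMap.Conj


namespace PointMap.Conj

variable {Φ : PointMap} {E E' : Equation} {Q Q' : Pt → Pt}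

/-- The relations between components are differentiated twice along the graph of a function with the
2-jet (u, u_x, u_xx) at the base point. The image of that graph has the transformed 2-jet, so both
sides become total derivatives. -/
lemma related_totX (hΦ : Φ.Conj E E') (hQ : ContDiffOn ℝ ∞ Q E.space)
    (hQ' : ContDiffOn ℝ ∞ Q' E'.space)
    (hQQ' : ∀ p ∈ E.space, Q' (Φ.toFun p) = fderiv ℝ Φ.toFun p (Q p)) {j : Jet}
    (hp : j.pt ∈ E.space) :
    (deriv Φ.X j.x * totX (cτ Q') (Φ.jet j) = Φ.a * totX (cτ Q) j ∧
      deriv Φ.X j.x ^ 2 * totXX (cτ Q') (Φ.jet j) +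
        deriv (deriv Φ.X) j.x * totX (cτ Q') (Φ.jet j) = Φ.a * totXX (cτ Q) j) ∧
    (deriv Φ.X j.x * totX (cξ Q') (Φ.jet j) = deriv (deriv Φ.X) j.x * cξ Q j.pt +
        deriv Φ.X j.x * totX (cξ Q) j ∧
      deriv Φ.X j.x ^ 2 * totXX (cξ Q') (Φ.jet j) +
        deriv (deriv Φ.X) j.x * totX (cξ Q') (Φ.jet j) =
        deriv (deriv (deriv Φ.X)) j.x * cξ Q j.pt + 2 * deriv (deriv Φ.X) j.x * totX (cξ Q) j +
          deriv Φ.X j.x * totXX (cξ Q) j) ∧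
    (deriv Φ.X j.x * totX (cη Q') (Φ.jet j) = deriv Φ.A j.x * cη Q j.pt + Φ.A j.x * totX (cη Q) j +
        ((deriv (deriv Φ.A) j.x * j.u + deriv Φ.A j.x * j.ux + deriv (deriv Φ.B) j.x) * cξ Q j.pt +
          (deriv Φ.A j.x * j.u + deriv Φ.B j.x) * totX (cξ Q) j) ∧
      deriv Φ.X j.x ^ 2 * totXX (cη Q') (Φ.jet j) +
        deriv (deriv Φ.X) j.x * totX (cη Q') (Φ.jet j) =
        (deriv (deriv Φ.A) j.x * cη Q j.pt + 2 * deriv Φ.A j.x * totX (cη Q) j +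
          Φ.A j.x * totXX (cη Q) j) +
        ((deriv (deriv (deriv Φ.A)) j.x * j.u + 2 * deriv (deriv Φ.A) j.x * j.ux +
            deriv Φ.A j.x * j.uxx + deriv (deriv (deriv Φ.B)) j.x) * cξ Q j.pt +
          2 * (deriv (deriv Φ.A) j.x * j.u + deriv Φ.A j.x * j.ux + deriv (deriv Φ.B) j.x)
            * totX (cξ Q) j +
          (deriv Φ.A j.x * j.u + deriv Φ.B j.x) * totXX (cξ Q) j)) := by
  have q1 : ContDiffOn ℝ ∞ (cτ Q) E.space := hQ.fst
  have q2 : ContDiffOn ℝ ∞ (cξ Q) E.space := hQ.snd.fst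
  have q3 : ContDiffOn ℝ ∞ (cη Q) E.space := hQ.snd.snd
  have r1 : ContDiffOn ℝ ∞ (cτ Q') E'.space := hQ'.fst
  have r2 : ContDiffOn ℝ ∞ (cξ Q') E'.space := hQ'.snd.fst
  have r3 : ContDiffOn ℝ ∞ (cη Q') E'.space := hQ'.snd.snd
  have o := E.isOpen_space
  have o' := E'.isOpen_space
  have X0 : deriv Φ.X j.x ≠ 0 := hΦ.deriv_X_ne _ hp.2.1
  -- The parabola with value u, slope u_x and second derivative u_xx at `j.x`.
  set w : ℝ → ℝ := fun y => j.u + (y - j.x) * j.ux + (y - j.x) ^ 2 * (j.uxx / 2) with hw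
  have w0 : w j.x = j.u := by simp [hw]
  have hwd : ∀ y, HasDerivAt w (j.ux + (y - j.x) * j.uxx) y := by
    intro y
    have h1 := (hasDerivAt_id y).sub_const j.x
    refine (((h1.mul_const j.ux).const_add j.u).add
      ((h1.pow 2).mul_const (j.uxx / 2))).congr_deriv ?_
    simp; ring
  have w1 : deriv w = fun y => j.ux + (y - j.x) * j.uxx := funext fun y => (hwd y).deriv
  have w2 : deriv (deriv w) j.x = j.uxx := by
    rw [w1]
    refine ((((hasDerivAt_id j.x).sub_const j.x).mul_const j.uxx).const_add j.ux).deriv.trans ?_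
    simp
  have w1' : deriv w j.x = j.ux := by rw [w1]; simp
  have ws : ContDiff ℝ ∞ w := by rw [hw]; fun_prop
  -- The open set over which the graph of the parabola stays in the domain.
  set J : Set ℝ := E.I ∩ w ⁻¹' E.range with hJd
  have hJ : IsOpen J := E.isOpen_I.inter (E.isOpen_range.preimage ws.continuous)
  have hxJ : j.x ∈ J := ⟨hp.2.1, by
    have : w j.x ∈ E.range := by rw [w0]; exact hp.2.2
    exact this⟩
  have hJI : J ⊆ E.I := inter_subset_left
  have sX := hΦ.smooth_X.mono hJI
  have sA := hΦ.smooth_A.mono hJI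
  have sB := hΦ.smooth_B.mono hJI
  have sX' := smooth_deriv hJ sX
  have sA' := smooth_deriv hJ sA
  have sB' := smooth_deriv hJ sB
  have sw : ContDiffOn ℝ ∞ w J := ws.contDiffOn
  have hc : ∀ y ∈ J, ((j.t, y, w y) : Pt) ∈ E.space := fun y hy => ⟨trivial, hy.1, hy.2⟩
  have hc' : ∀ y ∈ J, ((Φ.a * j.t + Φ.b, Φ.X y, Φ.A y * w y + Φ.B y) : Pt) ∈ E'.space :=
    fun y hy => hΦ.mapsTo_space (hc y hy)
  have sAw : ContDiffOn ℝ ∞ (fun y => Φ.A y * w y) J := sA.mul sw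
  have sZ : ContDiffOn ℝ ∞ (fun y => Φ.A y * w y + Φ.B y) J := sAw.add sB
  have sA'w : ContDiffOn ℝ ∞ (fun y => deriv Φ.A y * w y) J := sA'.mul sw
  have sZ' : ContDiffOn ℝ ∞ (fun y => deriv Φ.A y * w y + deriv Φ.B y) J := sA'w.add sB'
  have z1 : deriv (fun y => Φ.A y * w y + Φ.B y) j.x =
      deriv Φ.A j.x * j.u + Φ.A j.x * j.ux + deriv Φ.B j.x := by
    rw [deriv_smooth_add hJ sAw sB hxJ, deriv_smooth_mul hJ sA sw hxJ, w0, w1']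
  have z2 : deriv (deriv (fun y => Φ.A y * w y + Φ.B y)) j.x = deriv (deriv Φ.A) j.x * j.u +
      2 * deriv Φ.A j.x * j.ux + Φ.A j.x * j.uxx + deriv (deriv Φ.B) j.x := by
    rw [deriv_deriv_smooth_add hJ sAw sB hxJ, deriv_deriv_smooth_mul hJ sA sw hxJ, w0, w1', w2]
  have y1 : deriv (fun y => deriv Φ.A y * w y + deriv Φ.B y) j.x =
      deriv (deriv Φ.A) j.x * j.u + deriv Φ.A j.x * j.ux + deriv (deriv Φ.B) j.x := by
    rw [deriv_smooth_add hJ sA'w sB' hxJ, deriv_smooth_mul hJ sA' sw hxJ, w0, w1']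
  have y2 : deriv (deriv (fun y => deriv Φ.A y * w y + deriv Φ.B y)) j.x =
      deriv (deriv (deriv Φ.A)) j.x * j.u + 2 * deriv (deriv Φ.A) j.x * j.ux +
      deriv Φ.A j.x * j.uxx + deriv (deriv (deriv Φ.B)) j.x := by
    rw [deriv_deriv_smooth_add hJ sA'w sB' hxJ, deriv_deriv_smooth_mul hJ sA' sw hxJ, w0, w1', w2]
  have hpt : j.pt = (j.t, j.x, w j.x) := by rw [w0]; rfl
  have hpt' : (Φ.jet j).pt = (Φ.a * j.t + Φ.b, Φ.X j.x, Φ.A j.x * w j.x + Φ.B j.x) := by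
    rw [w0]; rfl
  have i1 : deriv (fun y : ℝ => y) = fun _ => 1 := by ext; simp
  have c1 (φ : Pt → ℝ) (hφ : ContDiffOn ℝ ∞ φ E.space) :
      deriv (fun y => φ (j.t, y, w y)) j.x = totX φ j := by
    rw [deriv_curve_eq_totX o hφ hJ (X := fun y => y) contDiffOn_id sw hc hxJ hpt (by simp [w1'])]
    simp
  have c2 (φ : Pt → ℝ) (hφ : ContDiffOn ℝ ∞ φ E.space) :
      deriv (deriv (fun y => φ (j.t, y, w y))) j.x = totXX φ j := by
    have := deriv_deriv_curve_eq_totXX o hφ hJ (X := fun y => y) contDiffOn_id sw hc hxJ hpt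
      (by simp [w1']) (by simp [w2, i1])
    simpa [i1] using this
  have d1 (φ : Pt → ℝ) (hφ : ContDiffOn ℝ ∞ φ E'.space) :=
    deriv_curve_eq_totX o' hφ hJ sX sZ hc' hxJ hpt' (by
      rw [z1]; simp only [PointMap.jet]; field_simp)
  have d2 (φ : Pt → ℝ) (hφ : ContDiffOn ℝ ∞ φ E'.space) :=
    deriv_deriv_curve_eq_totXX o' hφ hJ sX sZ hc' hxJ hpt' (by
      rw [z1]; simp only [PointMap.jet]; field_simp) (by
      rw [z2]; simp only [PointMap.jet]; field_simp; ring)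
  have kτ := smooth_curve (t := j.t) q1 contDiffOn_id sw hc
  have kξ := smooth_curve (t := j.t) q2 contDiffOn_id sw hc
  have kη := smooth_curve (t := j.t) q3 contDiffOn_id sw hc
  simp only [id] at kτ kξ kη
  have hτ : ∀ y ∈ J, cτ Q' (Φ.a * j.t + Φ.b, Φ.X y, Φ.A y * w y + Φ.B y) =
      Φ.a * cτ Q (j.t, y, w y) := fun y hy => (hΦ.related_components hQQ' (hc y hy)).1
  have hξ : ∀ y ∈ J, cξ Q' (Φ.a * j.t + Φ.b, Φ.X y, Φ.A y * w y + Φ.B y) =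
      deriv Φ.X y * cξ Q (j.t, y, w y) := fun y hy => (hΦ.related_components hQQ' (hc y hy)).2.1
  have hη : ∀ y ∈ J, cη Q' (Φ.a * j.t + Φ.b, Φ.X y, Φ.A y * w y + Φ.B y) =
      Φ.A y * cη Q (j.t, y, w y) + (deriv Φ.A y * w y + deriv Φ.B y) * cξ Q (j.t, y, w y) :=
    fun y hy => (hΦ.related_components hQQ' (hc y hy)).2.2
  have sAη : ContDiffOn ℝ ∞ (fun y => Φ.A y * cη Q (j.t, y, w y)) J := sA.mul kη
  have sZξ : ContDiffOn ℝ ∞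
      (fun y => (deriv Φ.A y * w y + deriv Φ.B y) * cξ Q (j.t, y, w y)) J := sZ'.mul kξ
  refine ⟨⟨?_, ?_⟩, ⟨?_, ?_⟩, ?_, ?_⟩
  · rw [← d1 _ r1, deriv_congr_of_isOpen hJ hτ hxJ,
      deriv_smooth_mul (f := fun _ => Φ.a) hJ contDiffOn_const kτ hxJ, c1 _ q1]
    simp
  · rw [← d2 _ r1, deriv_deriv_congr_of_isOpen hJ hτ hxJ,
      deriv_deriv_smooth_mul (f := fun _ => Φ.a) hJ contDiffOn_const kτ hxJ, c2 _ q1]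
    simp
  · rw [← d1 _ r2, deriv_congr_of_isOpen hJ hξ hxJ, deriv_smooth_mul hJ sX' kξ hxJ, c1 _ q2, hpt]
  · rw [← d2 _ r2, deriv_deriv_congr_of_isOpen hJ hξ hxJ, deriv_deriv_smooth_mul hJ sX' kξ hxJ,
      c2 _ q2, c1 _ q2, hpt]
  · rw [← d1 _ r3, deriv_congr_of_isOpen hJ hη hxJ, deriv_smooth_add hJ sAη sZξ hxJ,
      deriv_smooth_mul hJ sA kη hxJ, deriv_smooth_mul hJ sZ' kξ hxJ, c1 _ q2, c1 _ q3, y1, ← hpt, w0]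
  · rw [← d2 _ r3, deriv_deriv_congr_of_isOpen hJ hη hxJ, deriv_deriv_smooth_add hJ sAη sZξ hxJ,
      deriv_deriv_smooth_mul hJ sA kη hxJ, deriv_deriv_smooth_mul hJ sZ' kξ hxJ, c1 _ q2, c1 _ q3,
      c2 _ q2, c2 _ q3, y1, y2, ← hpt, w0]

/-- The identity L' ∘ pr Φ = l L is differentiated along a line of jets with velocity pr Q; its
image has velocity pr Q'. On the equation the derivative of `l` is multiplied by L = 0, so the
constant is `l j.x`. -/
lemma prolongL_conj (hΦ : Φ.Conj E E') (hE : E.Regular) (hE' : E'.Regular)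
    (hQ : ContDiffOn ℝ ∞ Q E.space) (hQ' : ContDiffOn ℝ ∞ Q' E'.space)
    (hQQ' : ∀ p ∈ E.space, Q' (Φ.toFun p) = fderiv ℝ Φ.toFun p (Q p)) {j : Jet}
    (hx : j.x ∈ E.I) (hu : j.u ∈ E.vals) (hL : E.L j = 0) :
    ∃ c : ℝ, E'.prolongL Q' (Φ.jet j) = c * E.prolongL Q j := by
  obtain ⟨l, hl, hl0, hfac⟩ := hΦ.exists_factor
  have hp : j.pt ∈ E.space := ⟨trivial, hx, E.vals_subset hu⟩
  have a0 := hΦ.a_ne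
  have X0 := hΦ.deriv_X_ne _ hx
  obtain ⟨-, t2, t3⟩ := hΦ.related_totT hQ hQ' hQQ' hp
  have t1 := (hΦ.related_totT hQ hQ' hQQ' hp).1
  obtain ⟨⟨x1, x2⟩, ⟨x3, x4⟩, x5, x6⟩ := hΦ.related_totX hQ hQ' hQQ' hp
  obtain ⟨-, b2, b3⟩ := hΦ.related_components hQQ' hp
  have t2' : totT (cξ Q') (Φ.jet j) = deriv Φ.X j.x * totT (cξ Q) j / Φ.a := by
    rw [eq_div_iff a0, ← t2, mul_comm]
  have t3' := (eq_div_iff a0).2 ((mul_comm _ _).trans t3)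
  have x1' := (eq_div_iff X0).2 ((mul_comm _ _).trans x1)
  have x3' := (eq_div_iff X0).2 ((mul_comm _ _).trans x3)
  have x5' := (eq_div_iff X0).2 ((mul_comm _ _).trans x5)
  have x2' := (eq_div_iff (pow_ne_zero 2 X0)).2 ((mul_comm _ _).trans (eq_sub_of_add_eq x2))
  have x4' := (eq_div_iff (pow_ne_zero 2 X0)).2 ((mul_comm _ _).trans (eq_sub_of_add_eq x4))
  have x6' := (eq_div_iff (pow_ne_zero 2 X0)).2 ((mul_comm _ _).trans (eq_sub_of_add_eq x6))
  -- The slots t and u_tx stay fixed: `L` depends on neither.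
  set γ : ℝ → Jet := fun s => ⟨j.t, j.x + s * cξ Q j.pt, j.u + s * cη Q j.pt, j.ut + s * etaT Q j,
    j.ux + s * etaX Q j, j.utx, j.uxx + s * etaXX Q j⟩ with hγ
  have γ0 : γ 0 = j := by simp [hγ]
  have lin : ∀ c d : ℝ, HasDerivAt (fun s : ℝ => c + s * d) d 0 := fun c d => by
    simpa using ((hasDerivAt_id (0 : ℝ)).mul_const d).const_add c
  have hx' := lin j.x (cξ Q j.pt)
  have hu' := lin j.u (cη Q j.pt)
  have hut' := lin j.ut (etaT Q j)
  have hux' := lin j.ux (etaX Q j)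
  have huxx' := lin j.uxx (etaXX Q j)
  have dL := Equation.hasDerivAt_L hE (Q := Q) γ0 hx hu hx' hu' hut' hux' huxx'
  have along : ∀ f : ℝ → ℝ, ContDiffOn ℝ ∞ f E.I →
      HasDerivAt (fun s => f (j.x + s * cξ Q j.pt)) (deriv f j.x * cξ Q j.pt) 0 := by
    intro f hf
    have e : j.x = j.x + 0 * cξ Q j.pt := by simp
    exact HasDerivAt.comp (h₂ := f) (h := fun s => j.x + s * cξ Q j.pt) 0
      (e ▸ smooth_hasDerivAt E.isOpen_I hf hx) hx'
  have oI := E.isOpen_I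
  have aX := along _ hΦ.smooth_X
  have aX1 := along _ (smooth_deriv oI hΦ.smooth_X)
  have aX2 := along _ (smooth_deriv oI (smooth_deriv oI hΦ.smooth_X))
  have aA := along _ hΦ.smooth_A
  have aA1 := along _ (smooth_deriv oI hΦ.smooth_A)
  have aA2 := along _ (smooth_deriv oI (smooth_deriv oI hΦ.smooth_A))
  have aB := along _ hΦ.smooth_B
  have aB1 := along _ (smooth_deriv oI hΦ.smooth_B)
  have aB2 := along _ (smooth_deriv oI (smooth_deriv oI hΦ.smooth_B))
  have al := along _ hl
  have e0 : deriv Φ.X (j.x + 0 * cξ Q j.pt) ≠ 0 := by simpa using X0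
  have kux := (((aA1.mul hu').add (aA.mul hux')).add aB1).div aX1 e0
  have kuxx := (((((aA2.mul hu').add ((aA1.const_mul 2).mul hux')).add (aA.mul huxx')).add
    aB2).sub (aX2.mul kux)).div (aX1.pow 2) (pow_ne_zero 2 e0)
  have dL' := Equation.hasDerivAt_L hE' (Q := Q') (γ := fun s => Φ.jet (γ s)) (j := Φ.jet j) (s := 0)
    (by rw [γ0]) (hΦ.bijOn.mapsTo hx) ((hΦ.vals_iff _ hx _).1 hu)
    (aX.congr_deriv b2.symm)
    (((aA.mul hu').add aB).congr_deriv (by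
      rw [PointMap.jet_pt, b3]; simp only [zero_mul, add_zero, Jet.pt]; ring))
    (((aA.mul hut').div_const Φ.a).congr_deriv (by
      simp only [etaT, t1, t2', t3', zero_mul, add_zero]
      simp only [PointMap.jet]; field_simp; ring))
    (kux.congr_deriv (by
      simp only [etaX, x1', x3', x5', zero_mul, add_zero, Pi.add_apply, Pi.mul_apply]
      simp only [PointMap.jet]; field_simp; ring))
    (kuxx.congr_deriv (by
      simp only [etaXX, etaX, x2', x4', x6', x1', x3', x5', zero_mul, add_zero, Pi.add_apply,
        Pi.mul_apply, Pi.sub_apply, Pi.div_apply, Pi.pow_apply]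
      simp only [PointMap.jet]; field_simp; norm_num; ring))
  refine ⟨l j.x, ?_⟩
  -- The factor identity is available only over `E.I` and `E.vals`; both are open, so it persists
  -- for small s.
  have ev : (fun s => E'.L (Φ.jet (γ s))) =ᶠ[𝓝 0] fun s => l (γ s).x * E.L (γ s) := by
    have c1 : ContinuousAt (fun s => (γ s).x) 0 := hx'.continuousAt
    have c2 : ContinuousAt (fun s => (γ s).u) 0 := hu'.continuousAt
    filter_upwards [c1.eventually_mem (by rw [γ0]; exact oI.mem_nhds hx),
      c2.eventually_mem (by rw [γ0]; exact hE.isOpen_vals.mem_nhds hu)] with s h1 h2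
    exact hfac _ h1 h2
  have := (dL'.congr_of_eventuallyEq ev.symm).unique (al.mul dL)
  rw [this, γ0, hL]
  simp

end PointMap.Conj


/-! ### Push-forward of Lie invariance algebras -/

namespace PointMap.Conj

variable {Φ : PointMap} {E E' : Equation}

/-- The push-forward of vector fields, as a linear map carrying symmetries to symmetries. -/
lemma exists_pushforward (hΦ : Φ.Conj E E') (hE : E.Regular) (hE' : E'.Regular) :
    ∃ T : (Pt → Pt) →ₗ[ℝ] (Pt → Pt), (∀ Q ∈ E.lieAlg, T Q ∈ E'.lieAlg) ∧
      (∀ Q, ∀ p ∈ E.space, T Q (Φ.toFun p) = fderiv ℝ Φ.toFun p (Q p)) ∧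
      ∀ Q, ∀ q ∉ E'.space, T Q q = 0 := by
  classical
  obtain ⟨Ψ, hΨ, hΨΦ, hΦΨ, hjet⟩ := hΦ.symm
  -- Extending by zero off `E'.space` respects the convention for vector fields and keeps the
  -- push-forward linear on all maps.
  let T : (Pt → Pt) →ₗ[ℝ] (Pt → Pt) :=
    { toFun := fun Q q =>
        if q ∈ E'.space then fderiv ℝ Φ.toFun (Ψ.toFun q) (Q (Ψ.toFun q)) else 0
      map_add' := by
        intro Q R
        funext q
        by_cases hq : q ∈ E'.space <;> simp [hq]
      map_smul' := by
        intro c Q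
        funext q
        by_cases hq : q ∈ E'.space <;> simp [hq] }
  have hT1 : ∀ Q, ∀ p ∈ E.space, T Q (Φ.toFun p) = fderiv ℝ Φ.toFun p (Q p) := by
    intro Q p hp
    simp only [T, LinearMap.coe_mk, AddHom.coe_mk, hΦ.mapsTo_space hp, if_true, hΨΦ p hp]
  have hT0 : ∀ Q, ∀ q ∉ E'.space, T Q q = 0 := by
    intro Q q hq
    simp only [T, LinearMap.coe_mk, AddHom.coe_mk, hq, if_false]
  refine ⟨T, ?_, hT1, hT0⟩
  intro Q hQ
  have hQs : ContDiffOn ℝ ∞ (T Q) E'.space := by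
    have h1 : ContDiffOn ℝ ∞ (fun p => fderiv ℝ Φ.toFun p (Q p)) E.space :=
      (hΦ.smooth_toFun.fderiv_of_isOpen E.isOpen_space (by simp)).clm_apply hQ.1
    refine (h1.comp hΨ.smooth_toFun hΨ.mapsTo_space).congr fun q hq => ?_
    simp only [T, LinearMap.coe_mk, AddHom.coe_mk, hq, if_true, Function.comp_apply]
  refine ⟨hQs, hT0 Q, fun j hx hu hL => ?_⟩
  have hx' : (Ψ.jet j).x ∈ E.I := hΨ.bijOn.mapsTo hx
  have hu' : (Ψ.jet j).u ∈ E.vals := (hΨ.vals_iff _ hx _).1 hu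
  have hL' : E.L (Ψ.jet j) = 0 := by
    obtain ⟨l, -, -, h⟩ := hΨ.exists_factor
    rw [h j hx hu, hL, mul_zero]
  obtain ⟨c, hc⟩ := hΦ.prolongL_conj hE hE' hQ.1 hQs (hT1 Q) hx' hu' hL'
  rw [hjet j hx, hQ.2.2 _ hx' hu' hL', mul_zero] at hc
  exact hc

lemma lieAlg_eq_push (hΦ : Φ.Conj E E') (hE : E.Regular) (hE' : E'.Regular) :
    (E'.lieAlg : Set (Pt → Pt)) = Φ.push E.space E'.space (E.lieAlg : Set (Pt → Pt)) := by
  obtain ⟨Ψ, hΨ, hΨΦ, hΦΨ, -⟩ := hΦ.symm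
  ext Q'
  constructor
  · intro hQ'
    -- `Q'` is pulled back as a push-forward along `Ψ`; differentiating `Φ ∘ Ψ = id` shows that
    -- pushing the result forward returns `Q'`.
    obtain ⟨T, hT, hT1, -⟩ := hΨ.exists_pushforward hE' hE
    refine ⟨hQ'.2.1, T Q', hT Q' hQ', fun p hp => ?_⟩
    have hq := hΦ.mapsTo_space hp
    have h := hT1 Q' _ hq
    rw [hΨΦ p hp] at h
    rw [h]
    have d1 : HasFDerivAt Ψ.toFun (fderiv ℝ Ψ.toFun (Φ.toFun p)) (Φ.toFun p) :=
      ((hΨ.smooth_toFun.contDiffAt (E'.isOpen_space.mem_nhds hq)).differentiableAt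
        (by simp)).hasFDerivAt
    have d2 : HasFDerivAt Φ.toFun (fderiv ℝ Φ.toFun p) (Ψ.toFun (Φ.toFun p)) := by
      rw [hΨΦ p hp]
      exact ((hΦ.smooth_toFun.contDiffAt (E.isOpen_space.mem_nhds hp)).differentiableAt
        (by simp)).hasFDerivAt
    have d3 : HasFDerivAt (fun q => Φ.toFun (Ψ.toFun q)) (ContinuousLinearMap.id ℝ Pt)
        (Φ.toFun p) :=
      (hasFDerivAt_id _).congr_of_eventuallyEq
        (eventuallyEq_of_mem (E'.isOpen_space.mem_nhds hq) hΦΨ)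
    have := (d2.comp _ d1).unique d3
    exact (DFunLike.congr_fun this (Q' (Φ.toFun p))).symm
  · rintro ⟨h0, Q, hQ, h⟩
    obtain ⟨T, hT, hT1, hT0⟩ := hΦ.exists_pushforward hE hE'
    have e : Q' = T Q := by
      funext q
      by_cases hq : q ∈ E'.space
      · rw [← hΦΨ q hq, h _ (hΨ.mapsTo_space hq), hT1 Q _ (hΨ.mapsTo_space hq)]
      · rw [h0 q hq, hT0 Q q hq]
    rw [e]
    exact hT Q hQ

/-- The push-forward is injective on symmetries: the differential is injective at each point of the
domain, and off the domain symmetries vanish by convention. -/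
lemma rank_le (hΦ : Φ.Conj E E') (hE : E.Regular) (hE' : E'.Regular) :
    Module.rank ℝ E.lieAlg ≤ Module.rank ℝ E'.lieAlg := by
  obtain ⟨T, hT, hT1, -⟩ := hΦ.exists_pushforward hE hE'
  refine LinearMap.rank_le_of_injective (T.restrict hT) ?_
  refine (injective_iff_map_eq_zero _).2 ?_
  rintro ⟨Q, hQ⟩ h
  have h' : T Q = 0 := congrArg Subtype.val h
  refine Subtype.ext (funext fun p => ?_)
  by_cases hp : p ∈ E.space
  · refine (injective_iff_map_eq_zero _).1 (hΦ.injective_fderiv hp) _ ?_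
    rw [← hT1 Q p hp, h']
    rfl
  · exact hQ.2.1 p hp

lemma rank_eq (hΦ : Φ.Conj E E') (hE : E.Regular) (hE' : E'.Regular) :
    Module.rank ℝ E.lieAlg = Module.rank ℝ E'.lieAlg := by
  obtain ⟨Ψ, hΨ, -⟩ := hΦ.symm
  exact le_antisymm (hΦ.rank_le hE hE') (hΨ.rank_le hE' hE)

end PointMap.Conj

/-! ### Time translations -/

namespace Equation

/-- `Q` is a multiple of `∂_t` on the domain of `E`. -/
def IsTimeTranslation (E : Equation) (Q : Pt → Pt) : Prop :=
  ∃ c : ℝ, (∀ p ∈ E.space, Q p = (c, 0, 0)) ∧ ∀ p ∉ E.space, Q p = 0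

lemma tot_eq_zero_of_const {φ : Pt → ℝ} {Ω : Set Pt} (hΩ : IsOpen Ω) {c : ℝ}
    (h : ∀ q ∈ Ω, φ q = c) {j : Jet} (hj : j.pt ∈ Ω) :
    totT φ j = 0 ∧ totX φ j = 0 ∧ totXX φ j = 0 := by
  have h1 : ContDiffOn ℝ ∞ (fun _ : Pt => (1 : ℝ)) Ω := contDiffOn_const
  have h' : ∀ q ∈ Ω, φ q = c * (fun _ : Pt => (1 : ℝ)) q + 0 * (fun _ : Pt => (1 : ℝ)) q := by
    intro q hq; simp [h q hq]
  have e1 : dX (fun _ => (1 : ℝ)) = fun _ => 0 := by ext; simp [dX]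
  have e2 : dU (fun _ => (1 : ℝ)) = fun _ => 0 := by ext; simp [dU]
  rw [totT_lin c 0 hΩ h1 h1 h' hj, totX_lin c 0 hΩ h1 h1 h' hj, totXX_lin c 0 hΩ h1 h1 h' hj]
  simp only [totT, totX, totXX, e1, e2]
  simp [dT, dX, dU]

lemma IsTimeTranslation.isSymmetry {E : Equation} {Q : Pt → Pt} (h : E.IsTimeTranslation Q) :
    E.IsSymmetry Q := by
  obtain ⟨c, h1, h0⟩ := h
  refine ⟨(contDiffOn_const (c := ((c, 0, 0) : Pt))).congr h1, h0, fun j hx hu _ => ?_⟩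
  have hp : j.pt ∈ E.space := ⟨trivial, hx, E.vals_subset hu⟩
  obtain ⟨a1, a2, a3⟩ := tot_eq_zero_of_const (φ := cτ Q) E.isOpen_space (c := c)
    (fun q hq => by simp [cτ, h1 q hq]) hp
  obtain ⟨b1, b2, b3⟩ := tot_eq_zero_of_const (φ := cξ Q) E.isOpen_space (c := 0)
    (fun q hq => by simp [cξ, h1 q hq]) hp
  obtain ⟨c1, c2, c3⟩ := tot_eq_zero_of_const (φ := cη Q) E.isOpen_space (c := 0)
    (fun q hq => by simp [cη, h1 q hq]) hp
  have e1 : deriv (fun y => E.L { j with t := y }) j.t = 0 := by simp [L]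
  simp only [prolongL, etaT, etaX, etaXX, a1, a2, a3, b1, b2, b3, c1, c2, c3, e1]
  simp [cξ, cη, h1 _ hp]

/-- `E` is the equation `u_t = u_xx + H(x) u²`. -/
structure IsQuadraticModel (E : Equation) (H : ℝ → ℝ) : Prop where
  f_eq : ∀ x ∈ E.I, E.f x = 1
  g_eq : ∀ x ∈ E.I, E.g x = 1
  N_eq : ∀ x ∈ E.I, ∀ u, E.N x u = H x * u ^ 2

/-- Solving the equation for u_t leaves u_x, u_tx, u_xx as free parameters, so the invariance
condition can be split with respect to them. -/
lemma IsQuadraticModel.criterion {E : Equation} {H : ℝ → ℝ} (hE : E.IsQuadraticModel H)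
    (hH : ContDiff ℝ ∞ H) {Q : Pt → Pt} (hQ : E.IsSymmetry Q) {t x u : ℝ} (hx : x ∈ E.I)
    (hu : u ∈ E.vals) (ux utx uxx : ℝ) :
    etaT Q ⟨t, x, u, uxx + H x * u ^ 2, ux, utx, uxx⟩
      - etaXX Q ⟨t, x, u, uxx + H x * u ^ 2, ux, utx, uxx⟩
      - deriv H x * u ^ 2 * cξ Q (t, x, u) - 2 * H x * u * cη Q (t, x, u) = 0 := by
  have dg : ∀ y ∈ E.I, deriv E.g y = 0 := fun y hy => by
    rw [deriv_congr_of_isOpen (g := fun _ => (1 : ℝ)) E.isOpen_I hE.g_eq hy]; simp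
  have hL : ∀ j : Jet, j.x ∈ E.I → E.L j = j.ut - j.uxx - H j.x * j.u ^ 2 := by
    intro j hj
    rw [L, hE.f_eq _ hj, hE.g_eq _ hj, hE.N_eq _ hj, dg _ hj]
    ring
  set j : Jet := ⟨t, x, u, uxx + H x * u ^ 2, ux, utx, uxx⟩ with hj
  have h := hQ.2.2 j hx hu (by rw [hL j hx]; simp [hj])
  have e1 : deriv (fun y => E.L { j with t := y }) j.t = 0 := by simp [L]
  have e2 : deriv (fun y => E.L { j with x := y }) j.x = -(deriv H x * u ^ 2) := by
    rw [deriv_congr_of_isOpen E.isOpen_I (fun y hy => hL { j with x := y } hy) hx]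
    have hd : HasDerivAt H (deriv H x) x := (hH.differentiable (by simp) x).hasDerivAt
    exact ((hd.mul_const (u ^ 2)).const_sub (j.ut - j.uxx)).deriv
  have e3 : deriv (fun y => E.L { j with u := y }) j.u = -(2 * H x * u) := by
    rw [show (fun y => E.L { j with u := y }) = fun y => j.ut - j.uxx - H x * y ^ 2 from
      funext fun y => hL { j with u := y } hx]
    refine ((((hasDerivAt_id j.u).pow 2).const_mul (H x)).const_sub (j.ut - j.uxx)).deriv.trans ?_
    simp [hj]; ring
  have e4 : deriv (fun y => E.L { j with ut := y }) j.ut = 1 := by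
    rw [show (fun y => E.L { j with ut := y }) = fun y => y - j.uxx - H x * u ^ 2 from
      funext fun y => hL { j with ut := y } hx]
    simp
  have e5 : deriv (fun y => E.L { j with ux := y }) j.ux = 0 := by
    rw [show (fun y => E.L { j with ux := y }) = fun y => j.ut - j.uxx - H x * u ^ 2 from
      funext fun y => hL { j with ux := y } hx]
    simp
  have e6 : deriv (fun y => E.L { j with uxx := y }) j.uxx = -1 := by
    rw [show (fun y => E.L { j with uxx := y }) = fun y => j.ut - y - H x * u ^ 2 from
      funext fun y => hL { j with uxx := y } hx]
    exact ((((hasDerivAt_id j.uxx).const_sub j.ut)).sub_const (H x * u ^ 2)).deriv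
  rw [prolongL, e1, e2, e3, e4, e5, e6] at h
  have ep : j.pt = (t, x, u) := rfl
  rw [ep] at h
  linear_combination h

end Equation


/-! ### The kernel -/

lemma dT_of_const {φ : Pt → ℝ} {Ω : Set Pt} (hΩ : IsOpen Ω) {c : ℝ} (h : ∀ q ∈ Ω, φ q = c)
    {p : Pt} (hp : p ∈ Ω) : dT φ p = 0 ∧ dX φ p = 0 ∧ dU φ p = 0 := by
  have e : φ =ᶠ[𝓝 p] fun _ => c := eventuallyEq_of_mem (hΩ.mem_nhds hp) h
  have hd : HasFDerivAt φ (0 : Pt →L[ℝ] ℝ) p := (hasFDerivAt_const c p).congr_of_eventuallyEq e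
  rw [dT_eq hd.differentiableAt, dX_eq hd.differentiableAt, dU_eq hd.differentiableAt, hd.fderiv]
  simp

/-- For dependent variables of any sign, power equations are imposed only where u ≠ 0, while vector
fields live across u = 0. Continuity closes this gap. -/
lemma eq_zero_of_eq_zero_off_axis {F : Type*} [NormedAddCommGroup F] {Ω : Set Pt} (hΩ : IsOpen Ω)
    {φ : Pt → F} (hφ : ContinuousOn φ Ω) (h : ∀ p ∈ Ω, p.2.2 ≠ 0 → φ p = 0) {p : Pt}
    (hp : p ∈ Ω) : φ p = 0 := by
  by_cases hu : p.2.2 = 0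
  · have hc : Tendsto (fun s : ℝ => ((p.1, p.2.1, p.2.2 + s) : Pt)) (𝓝[≠] 0) (𝓝 p) := by
      have : ContinuousAt (fun s : ℝ => ((p.1, p.2.1, p.2.2 + s) : Pt)) 0 := by fun_prop
      have h2 := this.tendsto
      simp only [add_zero] at h2
      exact h2.mono_left nhdsWithin_le_nhds
    have h1 := ((hφ.continuousAt (hΩ.mem_nhds hp)).tendsto).comp hc
    refine tendsto_nhds_unique (h1.congr' ?_) (tendsto_const_nhds (x := (0 : F)))
    filter_upwards [hc.eventually (hΩ.mem_nhds hp), self_mem_nhdsWithin] with s hs hs0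
    refine h _ hs ?_
    simpa [hu] using hs0
  · exact h p hp hu

namespace Equation

/-- The only common Lie symmetries of the equations `u_t = u_xx + H(x) u²` are the time
translations. -/
lemma isTimeTranslation_of_models {E₀ : Equation} (hI : IsInterval E₀.I) (hR : Convex ℝ E₀.range)
    {Q : Pt → Pt} (hQ : ∀ H : ℝ → ℝ, ContDiff ℝ ∞ H → (∀ x, H x ≠ 0) → ∃ E : Equation,
      E.I = E₀.I ∧ E.range = E₀.range ∧ E₀.range \ {0} ⊆ E.vals ∧ E.IsQuadraticModel H ∧
        E.IsSymmetry Q) :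
    E₀.IsTimeTranslation Q := by
  have crit : ∀ H : ℝ → ℝ, ContDiff ℝ ∞ H → (∀ x, H x ≠ 0) → ∀ t, ∀ x ∈ E₀.I, ∀ u ∈ E₀.range,
      u ≠ 0 → ∀ ux utx uxx : ℝ,
      etaT Q ⟨t, x, u, uxx + H x * u ^ 2, ux, utx, uxx⟩
        - etaXX Q ⟨t, x, u, uxx + H x * u ^ 2, ux, utx, uxx⟩
        - deriv H x * u ^ 2 * cξ Q (t, x, u) - 2 * H x * u * cη Q (t, x, u) = 0 := by
    intro H hH h0 t x hx u hu hu0 ux utx uxx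
    obtain ⟨E, e1, e2, e3, e4, e5⟩ := hQ H hH h0
    exact e4.criterion hH e5 (e1.symm ▸ hx) (e3 ⟨hu, hu0⟩) ux utx uxx
  have hspace : ∀ E : Equation, E.I = E₀.I → E.range = E₀.range → E.space = E₀.space := by
    intro E h1 h2
    rw [space, space, h1, h2]
  obtain ⟨hQs, hQ0⟩ : ContDiffOn ℝ ∞ Q E₀.space ∧ ∀ p ∉ E₀.space, Q p = 0 := by
    obtain ⟨E, e1, e2, -, -, e5⟩ := hQ (fun _ => 1) contDiff_const (by simp)
    rw [← hspace E e1 e2]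
    exact ⟨e5.1, e5.2.1⟩
  have o := E₀.isOpen_space
  set Ω : Set Pt := E₀.space ∩ {p | p.2.2 ≠ 0} with hΩ
  have oΩ : IsOpen Ω := o.inter (isOpen_ne_fun (by fun_prop) continuous_const)
  have q1 : ContDiffOn ℝ ∞ (cτ Q) E₀.space := hQs.fst
  have q2 : ContDiffOn ℝ ∞ (cξ Q) E₀.space := hQs.snd.fst
  have q3 : ContDiffOn ℝ ∞ (cη Q) E₀.space := hQs.snd.snd
  -- Three test functions suffice. The difference between H = 1 and H = 2 isolates the u² terms
  -- without H', and H = exp then isolates the term H' ξ u².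
  have c1 := fun p (hp : p ∈ Ω) => crit (fun _ => 1) contDiff_const (by simp) p.1 p.2.1 hp.1.2.1
    p.2.2 hp.1.2.2 hp.2
  have c2 := fun p (hp : p ∈ Ω) => crit (fun _ => 2) contDiff_const (by simp) p.1 p.2.1 hp.1.2.1
    p.2.2 hp.1.2.2 hp.2
  have c3 := fun p (hp : p ∈ Ω) => crit Real.exp Real.contDiff_exp Real.exp_ne_zero p.1 p.2.1
    hp.1.2.1 p.2.2 hp.1.2.2 hp.2
  have hpt : ∀ (p : Pt) (a b c d : ℝ), Jet.pt ⟨p.1, p.2.1, p.2.2, a, b, c, d⟩ = p :=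
    fun _ _ _ _ _ => rfl
  simp only [etaT, etaXX, totT, totX, totXX, hpt, Prod.mk.eta] at c1 c2 c3
  -- The coefficient of u_tx is 2(τ_x + u_x τ_u); it is read off at u_x = 0 here and at u_x = 1
  -- below.
  have τX : ∀ p ∈ Ω, dX (cτ Q) p = 0 := by
    intro p hp
    have h1 := c1 p hp 0 0 0
    have h2 := c1 p hp 0 1 0
    linear_combination (h2 - h1) / 2
  have τU : ∀ p ∈ Ω, dU (cτ Q) p = 0 := by
    intro p hp
    have h1 := c1 p hp 1 0 0
    have h2 := c1 p hp 1 1 0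
    have h3 := τX p hp
    linear_combination (h2 - h1) / 2 - h3
  have τXX : ∀ p ∈ Ω, dX (dX (cτ Q)) p = 0 := fun p hp => (dT_of_const oΩ τX hp).2.1
  have τXU : ∀ p ∈ Ω, dX (dU (cτ Q)) p = 0 := fun p hp => (dT_of_const oΩ τU hp).2.1
  have τUU : ∀ p ∈ Ω, dU (dU (cτ Q)) p = 0 := fun p hp => (dT_of_const oΩ τU hp).2.2
  -- The coefficient of u_xx at u_x = 0.
  have τT : ∀ p ∈ Ω, dT (cτ Q) p = 2 * dX (cξ Q) p := by
    intro p hp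
    have h1 := c1 p hp 0 0 0
    have h2 := c1 p hp 0 0 1
    rw [τX p hp, τU p hp, τXX p hp, τXU p hp, τUU p hp] at h1 h2
    linear_combination h1 - h2
  have rest : ∀ p ∈ Ω, cξ Q p = 0 ∧
      p.2.2 * (dU (cη Q) p - dT (cτ Q) p) = 2 * cη Q p := by
    intro p hp
    have h1 := c1 p hp 0 0 0
    have h2 := c2 p hp 0 0 0
    have h3 := c3 p hp 0 0 0
    rw [τX p hp, τU p hp, τXX p hp, τXU p hp, τUU p hp] at h1 h2 h3
    rw [Real.deriv_exp] at h3
    simp only [deriv_const] at h1 h2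
    have hu : p.2.2 ≠ 0 := hp.2
    have h4 : p.2.2 ^ 2 * (dU (cη Q) p - dT (cτ Q) p) = 2 * p.2.2 * cη Q p := by
      linear_combination h2 - h1
    have h5 : p.2.2 * (dU (cη Q) p - dT (cτ Q) p) = 2 * cη Q p :=
      mul_left_cancel₀ hu (by linear_combination h4)
    have h6 : Real.exp p.2.1 * (p.2.2 ^ 2 * cξ Q p) = 0 := by
      linear_combination h1 - h3 + (Real.exp p.2.1 - 1) * h4
    simp only [mul_eq_zero, Real.exp_ne_zero, pow_eq_zero_iff, ne_eq, OfNat.ofNat_ne_zero,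
      not_false_eq_true, hu, false_or] at h6
    exact ⟨h6, h5⟩
  have ξ0 : ∀ p ∈ Ω, cξ Q p = 0 := fun p hp => (rest p hp).1
  have ξX : ∀ p ∈ Ω, dX (cξ Q) p = 0 := fun p hp => (dT_of_const oΩ ξ0 hp).2.1
  have ξT : ∀ p ∈ Ω, dT (cξ Q) p = 0 := fun p hp => (dT_of_const oΩ ξ0 hp).1
  have ξU : ∀ p ∈ Ω, dU (cξ Q) p = 0 := fun p hp => (dT_of_const oΩ ξ0 hp).2.2
  have ξXU : ∀ p ∈ Ω, dX (dU (cξ Q)) p = 0 := fun p hp => (dT_of_const oΩ ξU hp).2.1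
  have ξUU : ∀ p ∈ Ω, dU (dU (cξ Q)) p = 0 := fun p hp => (dT_of_const oΩ ξU hp).2.2
  have τT0 : ∀ p ∈ Ω, dT (cτ Q) p = 0 := fun p hp => by rw [τT p hp, ξX p hp, mul_zero]
  -- A second difference in u_x extracts the coefficient of u_x².
  have ηUU : ∀ p ∈ Ω, dU (dU (cη Q)) p = 0 := by
    intro p hp
    have h0 := c1 p hp 0 0 0
    have h1 := c1 p hp 1 0 0
    have h2 := c1 p hp (-1) 0 0
    rw [τX p hp, τU p hp, τXX p hp, τXU p hp, τUU p hp, ξXU p hp, ξUU p hp, ξU p hp, ξT p hp,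
      ξX p hp] at h0 h1 h2
    linear_combination h0 - (h1 + h2) / 2
  have η1 : ∀ p ∈ Ω, cη Q p = p.2.2 * dU (cη Q) p / 2 := by
    intro p hp
    have := (rest p hp).2
    rw [τT0 p hp] at this
    linear_combination -this / 2
  -- Differentiating η = u η_u / 2 in u gives η_u = u η_uu = 0, and then η = 0 by the same relation.
  have η0 : ∀ p ∈ Ω, cη Q p = 0 := by
    rintro ⟨t, x, u⟩ hp
    have s1 := smooth_dU o q3
    have hd : HasDerivAt (fun s => dU (cη Q) (t, x, s)) (dU (dU (cη Q)) (t, x, u)) u := by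
      refine (hasDerivAt_curve (φ := dU (cη Q)) (a := fun _ => t) (b := fun _ => x)
        (c := fun s => s) (differentiableAt_of_smooth o s1 hp.1) (hasDerivAt_const _ _)
        (hasDerivAt_const _ _) (hasDerivAt_id' u)).congr_deriv ?_
      simp
    have hd2 : HasDerivAt (fun s => cη Q (t, x, s)) (dU (cη Q) (t, x, u)) u := by
      refine (hasDerivAt_curve (φ := cη Q) (a := fun _ => t) (b := fun _ => x)
        (c := fun s => s) (differentiableAt_of_smooth o q3 hp.1) (hasDerivAt_const _ _)
        (hasDerivAt_const _ _) (hasDerivAt_id' u)).congr_deriv ?_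
      simp
    have hd3 := ((hasDerivAt_id' u).mul hd).div_const 2
    have hev : ∀ᶠ s in 𝓝 u, cη Q (t, x, s) = s * dU (cη Q) (t, x, s) / 2 := by
      have hc : ContinuousAt (fun s : ℝ => ((t, x, s) : Pt)) u := by fun_prop
      filter_upwards [hc.eventually_mem (oΩ.mem_nhds hp)] with s hs
      exact η1 _ hs
    have h1 := hd2.unique (hd3.congr_of_eventuallyEq hev)
    rw [ηUU _ hp] at h1
    have h2 := η1 _ hp
    have h3 : dU (cη Q) (t, x, u) = 0 := by linear_combination 2 * h1
    rw [h2, h3]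
    simp
  have hξ : ∀ p ∈ E₀.space, cξ Q p = 0 := fun p hp =>
    eq_zero_of_eq_zero_off_axis o q2.continuousOn (fun p hp hu => ξ0 p ⟨hp, hu⟩) hp
  have hη : ∀ p ∈ E₀.space, cη Q p = 0 := fun p hp =>
    eq_zero_of_eq_zero_off_axis o q3.continuousOn (fun p hp hu => η0 p ⟨hp, hu⟩) hp
  -- Constancy of τ needs a connected domain, and removing u = 0 may disconnect it; so the
  -- differential is extended across u = 0 before integrating.
  have hτ : EqOn (fderiv ℝ (cτ Q)) 0 E₀.space := fun p hp =>
    eq_zero_of_eq_zero_off_axis o (q1.continuousOn_fderiv_of_isOpen o (by simp)) (fun p hp hu => by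
      have hd := differentiableAt_of_smooth o q1 hp
      have e1 := dT_eq hd
      have e2 := dX_eq hd
      have e3 := dU_eq hd
      rw [τT0 p ⟨hp, hu⟩] at e1
      rw [τX p ⟨hp, hu⟩] at e2
      rw [τU p ⟨hp, hu⟩] at e3
      refine ContinuousLinearMap.ext fun v => ?_
      have e : v = v.1 • ((1, 0, 0) : Pt) + v.2.1 • (0, 1, 0) + v.2.2 • (0, 0, 1) := by
        ext <;> simp
      rw [e, map_add, map_add, map_smul, map_smul, map_smul, ← e1, ← e2, ← e3]
      simp) hp
  have hconv : Convex ℝ E₀.space :=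
    convex_univ.prod (hI.ordConnected.convex.prod hR)
  obtain ⟨c, hc⟩ := o.exists_is_const_of_fderiv_eq_zero hconv.isPreconnected
    (fun p hp => (differentiableAt_of_smooth o q1 hp).differentiableWithinAt) hτ
  exact ⟨c, fun p hp => Prod.ext (hc p hp) (Prod.ext (hξ p hp) (hη p hp)), hQ0⟩

end Equation

/-- Conditions on a class of equations that hold for all classes under consideration. -/
structure EqClass.IsRich {Θ : Type} (C : EqClass Θ) (R : Set ℝ) : Prop where
  regular : ∀ θ, (C.eqn θ).Regular
  isInterval : ∀ θ, IsInterval (C.eqn θ).I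
  range_eq : ∀ θ, (C.eqn θ).range = R
  convex : Convex ℝ R
  vals : ∀ θ, R \ {0} ⊆ (C.eqn θ).vals
  exists_model : ∀ θ (H : ℝ → ℝ), ContDiff ℝ ∞ H → (∀ x, H x ≠ 0) → ∃ θ', (C.eqn θ').I =
    (C.eqn θ).I ∧ (C.eqn θ').IsQuadraticModel H

namespace EqClass.IsRich

variable {Θ Θ' : Type} {C : EqClass Θ} {C' : EqClass Θ'} {R R' : Set ℝ}

/-- One inclusion uses the models u_t = u_xx + H u² in the class. The other holds because no
coefficient depends on t and all equations over the same interval have the same domain. -/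
lemma mem_kernel_iff (hC : C.IsRich R) (θ : Θ) (Q : Pt → Pt) :
    Q ∈ C.kernel (C.eqn θ).I ↔ (C.eqn θ).IsTimeTranslation Q := by
  rw [EqClass.kernel, Submodule.mem_iInf]
  constructor
  · intro h
    refine Equation.isTimeTranslation_of_models (hC.isInterval θ) (hC.range_eq θ ▸ hC.convex)
      fun H hH h0 => ?_
    obtain ⟨θ', hI, hm⟩ := hC.exists_model θ H hH h0
    exact ⟨C.eqn θ', hI, by rw [hC.range_eq, hC.range_eq], by rw [hC.range_eq]; exact hC.vals θ',
      hm, h ⟨θ', hI⟩⟩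
  · rintro ⟨c, h1, h0⟩ ⟨θ', hI⟩
    have e : (C.eqn θ').space = (C.eqn θ).space := by
      rw [Equation.space, Equation.space, hI, hC.range_eq, hC.range_eq]
    exact Equation.IsTimeTranslation.isSymmetry ⟨c, e.symm ▸ h1, e.symm ▸ h0⟩

lemma hasExtension_iff (hC : C.IsRich R) (θ : Θ) :
    C.HasExtension θ ↔ ∃ Q ∈ (C.eqn θ).lieAlg, ¬ (C.eqn θ).IsTimeTranslation Q := by
  rw [EqClass.HasExtension, Ne, ← not_iff_not, not_not]
  push Not
  constructor
  · intro h Q hQ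
    rwa [h, hC.mem_kernel_iff] at hQ
  · intro h
    ext Q
    rw [hC.mem_kernel_iff]
    exact ⟨h Q, fun hQ => hQ.isSymmetry⟩

/-- The transformation rescales t by the constant `Φ.a`, so it sends c ∂_t to `Φ.a` c ∂_t. Hence a
symmetry outside the kernel cannot come from one inside it. -/
lemma hasExtension_of_conj (hC : C.IsRich R) (hC' : C'.IsRich R') {θ : Θ} {θ' : Θ'}
    {Φ : PointMap} (hΦ : Φ.Conj (C.eqn θ) (C'.eqn θ')) (h : C'.HasExtension θ') :
    C.HasExtension θ := by
  rw [hC.hasExtension_iff]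
  obtain ⟨Q', hQ', hn⟩ := (hC'.hasExtension_iff θ').1 h
  have h1 : Q' ∈ ((C'.eqn θ').lieAlg : Set (Pt → Pt)) := hQ'
  rw [hΦ.lieAlg_eq_push (hC.regular θ) (hC'.regular θ')] at h1
  obtain ⟨h0, Q, hQ, hQQ'⟩ := h1
  refine ⟨Q, hQ, fun ht => hn ?_⟩
  obtain ⟨c, hc, -⟩ := ht
  obtain ⟨Ψ, hΨ, -, hΦΨ, -⟩ := hΦ.symm
  refine ⟨Φ.a * c, fun q hq => ?_, h0⟩
  have hp := hΨ.mapsTo_space hq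
  rw [← hΦΨ q hq, hQQ' _ hp, hc _ hp, hΦ.fderiv_toFun hp]
  simp

lemma hasExtension_iff_of_conj (hC : C.IsRich R) (hC' : C'.IsRich R') {θ : Θ} {θ' : Θ'}
    {Φ : PointMap} (hΦ : Φ.Conj (C.eqn θ) (C'.eqn θ')) :
    C.HasExtension θ ↔ C'.HasExtension θ' := by
  obtain ⟨Ψ, hΨ, -⟩ := hΦ.symm
  exact ⟨hC'.hasExtension_of_conj hC hΨ, hC.hasExtension_of_conj hC' hΦ⟩

end EqClass.IsRich

/-! ### Equivalence of group classifications -/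

namespace EqClass

variable {Θ Θ' : Type} {C : EqClass Θ} {C' : EqClass Θ'} {R R' : Set ℝ}
  {M : Θ → PointMap → Θ' → Prop}

/-- The equivalence group of a class exhausts the conjugations between equations of the class that
preserve an invariant `κ`. -/
structure IsExhaustive {K : Type} (C : EqClass Θ) (κ : Θ → K) : Prop where
  conj : ∀ θ (Φ : PointMap) θ', C.group θ Φ θ' → κ θ = κ θ' ∧ Φ.Conj (C.eqn θ) (C.eqn θ')
  equivalent : ∀ θ (Φ : PointMap) θ', κ θ = κ θ' → Φ.Conj (C.eqn θ) (C.eqn θ') → C.Equivalent θ θ'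

/-- This replaces the formulas of the equivalence group by a relation in the groupoid of
conjugations. Being an equivalence relation, and compatibility with the mappings, then need no
computation with group parameters. -/
lemma IsExhaustive.equivalent_iff {K : Type} {κ : Θ → K} (h : C.IsExhaustive κ) (θ θ' : Θ) :
    C.Equivalent θ θ' ↔ κ θ = κ θ' ∧ ∃ Φ : PointMap, Φ.Conj (C.eqn θ) (C.eqn θ') :=
  ⟨fun ⟨Φ, hΦ⟩ => ⟨(h.conj θ Φ θ' hΦ).1, Φ, (h.conj θ Φ θ' hΦ).2⟩,
    fun ⟨h1, Φ, hΦ⟩ => h.equivalent θ Φ θ' h1 hΦ⟩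

lemma IsExhaustive.equivalence {K : Type} {κ : Θ → K} (h : C.IsExhaustive κ) :
    Equivalence C.Equivalent where
  refl θ := (h.equivalent_iff θ θ).2 ⟨rfl, _, PointMap.Conj.refl _⟩
  symm {θ θ'} h' := by
    obtain ⟨h1, Φ, hΦ⟩ := (h.equivalent_iff θ θ').1 h'
    obtain ⟨Ψ, hΨ, -⟩ := hΦ.symm
    exact (h.equivalent_iff θ' θ).2 ⟨h1.symm, Ψ, hΨ⟩
  trans {θ θ' θ''} h' h'' := by
    obtain ⟨h1, Φ, hΦ⟩ := (h.equivalent_iff θ θ').1 h'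
    obtain ⟨h2, Ψ, hΨ⟩ := (h.equivalent_iff θ' θ'').1 h''
    exact (h.equivalent_iff θ θ'').2 ⟨h1.trans h2, _, hΦ.trans hΨ⟩

/-- Each defining property of a list is invariant under the mapping. Single-valuedness of the
mapping identifies images of equal members; uniqueness in the selection identifies members with a
common image. -/
lemma list_of_preimages_iff
    (surj : ∀ θ', ∃ θ Φ, M θ Φ θ')
    (image_unique : ∀ θ Φ₁ θ₁' Φ₂ θ₂', M θ Φ₁ θ₁' → M θ Φ₂ θ₂' → θ₁' = θ₂')
    (equivalent_iff : ∀ θ₁ Φ₁ θ₁' θ₂ Φ₂ θ₂', M θ₁ Φ₁ θ₁' → M θ₂ Φ₂ θ₂' →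
      (C.Equivalent θ₁ θ₂ ↔ C'.Equivalent θ₁' θ₂'))
    (extension_iff : ∀ θ Φ θ', M θ Φ θ' → (C.HasExtension θ ↔ C'.HasExtension θ'))
    (rank_eq : ∀ θ Φ θ', M θ Φ θ' →
      Module.rank ℝ (C.eqn θ).lieAlg = Module.rank ℝ (C'.eqn θ').lieAlg)
    (total : ∀ θ, ∃ Φ θ', M θ Φ θ')
    {Γ : Type} {S : Γ → Set Θ} {S' : Γ → Set Θ'} (hS : IsPreimageSelection M S S') :
    C.IsClassificationList S ↔ C'.IsClassificationList S' := by
  constructor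
  · intro h
    refine ⟨?_, ?_, ?_, ?_⟩
    · intro γ θ' hθ'
      obtain ⟨θ, ⟨hθ, Φ, hM⟩, -⟩ := (hS γ).2 θ' hθ'
      exact (extension_iff θ Φ θ' hM).1 (h.extension γ θ hθ)
    · intro γ₁ γ₂ θ₁' h₁ θ₂' h₂ he
      obtain ⟨θ₁, ⟨hθ₁, Φ₁, hM₁⟩, -⟩ := (hS γ₁).2 θ₁' h₁
      obtain ⟨θ₂, ⟨hθ₂, Φ₂, hM₂⟩, -⟩ := (hS γ₂).2 θ₂' h₂
      obtain ⟨e1, e2⟩ := h.inequivalent γ₁ γ₂ θ₁ hθ₁ θ₂ hθ₂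
        ((equivalent_iff _ _ _ _ _ _ hM₁ hM₂).2 he)
      subst e2
      exact ⟨e1, image_unique _ _ _ _ _ hM₁ hM₂⟩
    · intro θ' hθ'
      obtain ⟨θ, Φ, hM⟩ := surj θ'
      obtain ⟨γ, θ₂, hθ₂, he⟩ := h.complete θ ((extension_iff θ Φ θ' hM).2 hθ')
      obtain ⟨θ₂', hθ₂', Φ₂, hM₂⟩ := (hS γ).1 θ₂ hθ₂
      exact ⟨γ, θ₂', hθ₂', (equivalent_iff _ _ _ _ _ _ hM hM₂).1 he⟩
    · intro γ θ₁' h₁ θ₂' h₂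
      obtain ⟨θ₁, ⟨hθ₁, Φ₁, hM₁⟩, -⟩ := (hS γ).2 θ₁' h₁
      obtain ⟨θ₂, ⟨hθ₂, Φ₂, hM₂⟩, -⟩ := (hS γ).2 θ₂' h₂
      rw [← rank_eq _ _ _ hM₁, ← rank_eq _ _ _ hM₂]
      exact h.dim_eq γ θ₁ hθ₁ θ₂ hθ₂
  · intro h
    refine ⟨?_, ?_, ?_, ?_⟩
    · intro γ θ hθ
      obtain ⟨θ', hθ', Φ, hM⟩ := (hS γ).1 θ hθ
      exact (extension_iff θ Φ θ' hM).2 (h.extension γ θ' hθ')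
    · intro γ₁ γ₂ θ₁ h₁ θ₂ h₂ he
      obtain ⟨θ₁', hθ₁', Φ₁, hM₁⟩ := (hS γ₁).1 θ₁ h₁
      obtain ⟨θ₂', hθ₂', Φ₂, hM₂⟩ := (hS γ₂).1 θ₂ h₂
      obtain ⟨e1, e2⟩ := h.inequivalent γ₁ γ₂ θ₁' hθ₁' θ₂' hθ₂'
        ((equivalent_iff _ _ _ _ _ _ hM₁ hM₂).1 he)
      subst e1 e2
      exact ⟨rfl, ((hS γ₁).2 θ₁' hθ₁').unique ⟨h₁, Φ₁, hM₁⟩ ⟨h₂, Φ₂, hM₂⟩⟩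
    · intro θ hθ
      obtain ⟨Φ, θ', hM⟩ := total θ
      obtain ⟨γ, θ₂', hθ₂', he⟩ := h.complete θ' ((extension_iff θ Φ θ' hM).1 hθ)
      obtain ⟨θ₂, ⟨hθ₂, Φ₂, hM₂⟩, -⟩ := (hS γ).2 θ₂' hθ₂'
      exact ⟨γ, θ₂, hθ₂, (equivalent_iff _ _ _ _ _ _ hM hM₂).2 he⟩
    · intro γ θ₁ h₁ θ₂ h₂
      obtain ⟨θ₁', hθ₁', Φ₁, hM₁⟩ := (hS γ).1 θ₁ h₁
      obtain ⟨θ₂', hθ₂', Φ₂, hM₂⟩ := (hS γ).1 θ₂ h₂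
      rw [rank_eq _ _ _ hM₁, rank_eq _ _ _ hM₂]
      exact h.dim_eq γ θ₁' hθ₁' θ₂' hθ₂'

/-- Mappings of classes realized by conjugations give equivalences of group classifications. -/
theorem classificationEquivalence_of_conj {K : Type} {κ : Θ → K} {κ' : Θ' → K}
    (hC : C.IsRich R) (hC' : C'.IsRich R')
    (hκ : C.IsExhaustive κ) (hκ' : C'.IsExhaustive κ')
    (existsUnique_image : ∀ θ, ∃! θ', ∃ Φ, M θ Φ θ') (surjective : ∀ θ', ∃ θ Φ, M θ Φ θ')
    (conj : ∀ θ Φ θ', M θ Φ θ' → κ θ = κ' θ' ∧ Φ.Conj (C.eqn θ) (C'.eqn θ')) :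
    ClassificationEquivalence C C' M := by
  have equivalent_iff : ∀ θ₁ Φ₁ θ₁' θ₂ Φ₂ θ₂', M θ₁ Φ₁ θ₁' → M θ₂ Φ₂ θ₂' →
      (C.Equivalent θ₁ θ₂ ↔ C'.Equivalent θ₁' θ₂') := by
    intro θ₁ Φ₁ θ₁' θ₂ Φ₂ θ₂' hM₁ hM₂
    obtain ⟨k1, h1⟩ := conj _ _ _ hM₁
    obtain ⟨k2, h2⟩ := conj _ _ _ hM₂
    obtain ⟨Ψ₁, g1, -⟩ := h1.symm
    obtain ⟨Ψ₂, g2, -⟩ := h2.symm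
    rw [hκ.equivalent_iff, hκ'.equivalent_iff, k1, k2]
    -- A conjugation between the sources and one between the images determine each other, by
    -- composing around the square with the realizing transformations.
    exact and_congr_right fun _ => ⟨fun ⟨Φ, hΦ⟩ => ⟨_, (g1.trans hΦ).trans h2⟩,
      fun ⟨Φ, hΦ⟩ => ⟨_, (h1.trans hΦ).trans g2⟩⟩
  have image_unique : ∀ θ Φ₁ θ₁' Φ₂ θ₂', M θ Φ₁ θ₁' → M θ Φ₂ θ₂' → θ₁' = θ₂' :=
    fun θ Φ₁ θ₁' Φ₂ θ₂' h1 h2 => (existsUnique_image θ).unique ⟨Φ₁, h1⟩ ⟨Φ₂, h2⟩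
  have extension_iff : ∀ θ Φ θ', M θ Φ θ' → (C.HasExtension θ ↔ C'.HasExtension θ') :=
    fun θ Φ θ' h => hC.hasExtension_iff_of_conj hC' (conj θ Φ θ' h).2
  have list_of_preimages : ∀ (Γ : Type) (S : Γ → Set Θ) (S' : Γ → Set Θ'),
      IsPreimageSelection M S S' → (C.IsClassificationList S ↔ C'.IsClassificationList S') :=
    fun Γ S S' h => list_of_preimages_iff surjective image_unique equivalent_iff
      extension_iff
      (fun θ Φ θ' h => (conj θ Φ θ' h).2.rank_eq (hC.regular θ) (hC'.regular θ'))
      (fun θ => let ⟨θ', ⟨Φ, h⟩, _⟩ := existsUnique_image θ; ⟨Φ, θ', h⟩) h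
  refine
    { group_maps := fun θ Φ θ' h =>
        (hκ.conj θ Φ θ' h).2.mapsEquation (hC.regular θ) (hC.regular θ')
      group_maps' := fun θ Φ θ' h =>
        (hκ'.conj θ Φ θ' h).2.mapsEquation (hC'.regular θ) (hC'.regular θ')
      equivalence := hκ.equivalence
      equivalence' := hκ'.equivalence
      existsUnique_image := existsUnique_image
      surjective := surjective
      maps := fun θ Φ θ' h => (conj θ Φ θ' h).2.mapsEquation (hC.regular θ) (hC'.regular θ')
      equivalent_iff := equivalent_iff
      lieAlg_image := fun θ Φ θ' h =>
        (conj θ Φ θ' h).2.lieAlg_eq_push (hC.regular θ) (hC'.regular θ')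
      extension_iff := extension_iff
      list_of_preimages := list_of_preimages
      exists_preimages := ?_
      list_of_images := ?_ }
  · intro Γ S'
    choose σ hσ using surjective
    refine ⟨fun γ => σ '' S' γ, fun γ => ⟨?_, ?_⟩⟩
    · rintro _ ⟨θ', hθ', rfl⟩
      exact ⟨θ', hθ', hσ θ'⟩
    · intro θ' hθ'
      refine ⟨σ θ', ⟨⟨θ', hθ', rfl⟩, hσ θ'⟩, ?_⟩
      rintro _ ⟨⟨θ'', -, rfl⟩, Φ, hM⟩
      obtain ⟨Φ', hM'⟩ := hσ θ''
      rw [image_unique _ _ _ _ _ hM hM']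
  · intro Γ S hS
    have hsel : IsPreimageSelection M S (fun γ => {θ' | ∃ θ ∈ S γ, ∃ Φ, M θ Φ θ'}) := by
      intro γ
      constructor
      · intro θ hθ
        obtain ⟨θ', ⟨Φ, h⟩, -⟩ := existsUnique_image θ
        exact ⟨θ', ⟨θ, hθ, Φ, h⟩, Φ, h⟩
      · rintro θ' ⟨θ, hθ, Φ, h⟩
        refine ⟨θ, ⟨hθ, Φ, h⟩, ?_⟩
        rintro θ₂ ⟨hθ₂, Φ₂, h₂⟩
        -- Members with a common image are equivalent, hence equal, so the images of a list
        -- automatically have single preimages in it.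
        exact (hS.inequivalent γ γ θ₂ hθ₂ θ hθ
          ((equivalent_iff _ _ _ _ _ _ h₂ h).2 (hκ'.equivalence.refl θ'))).2
    exact ⟨(list_of_preimages Γ S _ hsel).1 hS, hsel⟩

end EqClass


/-! ### Conjugation in terms of coefficients -/

lemma IsInterval.injOn {I : Set ℝ} (hI : IsInterval I) {f : ℝ → ℝ} (hf : ContDiffOn ℝ ∞ f I)
    (hf' : ∀ x ∈ I, deriv f x ≠ 0) : InjOn f I := by
  have key : ∀ x ∈ I, ∀ y ∈ I, x < y → f x ≠ f y := by
    intro x hx y hy hxy he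
    have hs : Icc x y ⊆ I := hI.ordConnected.out hx hy
    obtain ⟨z, hz, h0⟩ := exists_deriv_eq_zero hxy (hf.continuousOn.mono hs) he
    exact hf' z (hs (Ioo_subset_Icc_self hz)) h0
  intro x hx y hy he
  rcases lt_trichotomy x y with h | h | h
  · exact absurd he (key x hx y hy h)
  · exact h
  · exact absurd he.symm (key y hy x hx h)

lemma IsInterval.const_of_deriv_eq_zero {I : Set ℝ} (hI : IsInterval I) {f : ℝ → ℝ}
    (hf : ContDiffOn ℝ ∞ f I) (hf' : ∀ x ∈ I, deriv f x = 0) : ∃ c, ∀ x ∈ I, f x = c :=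
  hI.isOpen.exists_is_const_of_deriv_eq_zero hI.ordConnected.isPreconnected
    (hf.differentiableOn (by simp)) hf'

/-- This expression is met three times: with w = A' in `psiExpr`, with w = B' in the inhomogeneous
term, and as X' g / A² when the law for g is differentiated. -/
lemma deriv_div_sq {I : Set ℝ} (hI : IsOpen I) {g w A : ℝ → ℝ} (hg : ContDiffOn ℝ ∞ g I)
    (hw : ContDiffOn ℝ ∞ w I) (hA : ContDiffOn ℝ ∞ A I) (hA0 : ∀ x ∈ I, A x ≠ 0) {x : ℝ}
    (hx : x ∈ I) : deriv (fun y => g y * w y / A y ^ 2) x =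
      (deriv g x * w x + g x * deriv w x) / A x ^ 2 - 2 * g x * w x * deriv A x / A x ^ 3 := by
  have h := (((smooth_hasDerivAt hI hg hx).mul (smooth_hasDerivAt hI hw hx)).div
    ((smooth_hasDerivAt hI hA hx).pow 2) (pow_ne_zero 2 (hA0 x hx))).deriv
  refine h.trans ?_
  have := hA0 x hx
  simp only [Pi.pow_apply, Pi.mul_apply]
  field_simp
  norm_num
  ring

namespace PointMap

variable {Φ : PointMap} {E E' : Equation}

/-- Sufficient conditions for a conjugation in terms of the coefficients. -/
lemma Nondegenerate.conj_of_coefficients (hΦ : Φ.Nondegenerate E.I) (hE : E.Regular)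
    (hE' : E'.Regular) (hb : BijOn Φ.X E.I E'.I)
    (hr : ∀ x ∈ E.I, ∀ w, w ∈ E.range ↔ Φ.A x * w + Φ.B x ∈ E'.range)
    (hv : ∀ x ∈ E.I, ∀ w, w ∈ E.vals ↔ Φ.A x * w + Φ.B x ∈ E'.vals) {c : ℝ} (hc : c ≠ 0)
    (hf : ∀ x ∈ E.I, E'.f (Φ.X x) = c * Φ.a / (deriv Φ.X x * Φ.A x ^ 2) * E.f x)
    (hg : ∀ x ∈ E.I, E'.g (Φ.X x) = c * deriv Φ.X x / Φ.A x ^ 2 * E.g x)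
    (hN : ∀ x ∈ E.I, ∀ u ∈ E.vals, E'.N (Φ.X x) (Φ.A x * u + Φ.B x) =
      c / deriv Φ.X x * (E.N x u / Φ.A x - psiExpr E.g Φ.A x * u
        - deriv (fun y => E.g y * deriv Φ.B y / Φ.A y ^ 2) x)) :
    Φ.Conj E E' := by
  have sX' := smooth_deriv E.isOpen_I hΦ.smooth_X
  -- The factor is dictated by the u_t terms: A f'(X)/a = l f together with the law for f gives l =
  -- c/(A X').
  refine ⟨hΦ, hb, hr, hv, fun x => c / (Φ.A x * deriv Φ.X x), ?_, ?_, ?_⟩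
  · exact contDiffOn_const.div (hΦ.smooth_A.mul sX')
      fun x hx => mul_ne_zero (hΦ.A_ne x hx) (hΦ.deriv_X_ne x hx)
  · exact fun x hx => div_ne_zero hc (mul_ne_zero (hΦ.A_ne x hx) (hΦ.deriv_X_ne x hx))
  · intro j hx hu
    have X0 := hΦ.deriv_X_ne _ hx
    have A0 := hΦ.A_ne _ hx
    have a0 := hΦ.a_ne
    have e1 : deriv E'.g (Φ.X j.x) * deriv Φ.X j.x =
        c * ((deriv (deriv Φ.X) j.x * E.g j.x + deriv Φ.X j.x * deriv E.g j.x) / Φ.A j.x ^ 2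
          - 2 * deriv Φ.X j.x * E.g j.x * deriv Φ.A j.x / Φ.A j.x ^ 3) := by
      rw [← deriv_smooth_comp E.isOpen_I E'.isOpen_I hΦ.smooth_X hE'.smooth_g hb.mapsTo hx,
        deriv_congr_of_isOpen (g := fun y => c * (deriv Φ.X y * E.g y / Φ.A y ^ 2)) E.isOpen_I
          (fun y hy => by rw [hg y hy]; ring) hx,
        ← deriv_div_sq E.isOpen_I sX' hE.smooth_g hΦ.smooth_A hΦ.A_ne hx]
      exact deriv_const_mul_field c
    have e1' := (eq_div_iff X0).2 e1
    have e2 := deriv_div_sq E.isOpen_I hE.smooth_g (smooth_deriv E.isOpen_I hΦ.smooth_A)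
      hΦ.smooth_A hΦ.A_ne hx
    have e3 := deriv_div_sq E.isOpen_I hE.smooth_g (smooth_deriv E.isOpen_I hΦ.smooth_B)
      hΦ.smooth_A hΦ.A_ne hx
    have e4 := hN _ hx _ hu
    rw [psiExpr, e2, e3] at e4
    simp only [Equation.L, PointMap.jet]
    rw [e4, hf _ hx, hg _ hx, e1']
    field_simp
    ring

/-- Necessary conditions for a conjugation in terms of the coefficients. -/
lemma Conj.coefficients (hΦ : Φ.Conj E E') (hE : E.Regular) (hE' : E'.Regular)
    (hI : IsInterval E.I) (hv : E.vals.Nonempty) (hg0 : ∀ x ∈ E.I, E.g x ≠ 0) :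
    ∃ c : ℝ, c ≠ 0 ∧
    (∀ x ∈ E.I, E'.f (Φ.X x) = c * Φ.a / (deriv Φ.X x * Φ.A x ^ 2) * E.f x) ∧
    (∀ x ∈ E.I, E'.g (Φ.X x) = c * deriv Φ.X x / Φ.A x ^ 2 * E.g x) ∧
    (∀ x ∈ E.I, ∀ u ∈ E.vals, E'.N (Φ.X x) (Φ.A x * u + Φ.B x) =
      c / deriv Φ.X x * (E.N x u / Φ.A x - psiExpr E.g Φ.A x * u
        - deriv (fun y => E.g y * deriv Φ.B y / Φ.A y ^ 2) x)) := by
  obtain ⟨u₀, hu₀⟩ := hv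
  obtain ⟨l, hl, hl0, h⟩ := hΦ.exists_factor
  have a0 := hΦ.a_ne
  have oI := E.isOpen_I
  have sX' := smooth_deriv oI hΦ.smooth_X
  -- The factor identity is affine in u_t, u_x and u_xx, so evaluating at 0 and 1 separates its
  -- coefficients.
  have key := fun x (hx : x ∈ E.I) u (hu : u ∈ E.vals) ut ux uxx =>
    h ⟨0, x, u, ut, ux, 0, uxx⟩ hx hu
  simp only [Equation.L, PointMap.jet] at key
  have kf : ∀ x ∈ E.I, E'.f (Φ.X x) * Φ.A x = l x * E.f x * Φ.a := by
    intro x hx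
    have h0 := key x hx u₀ hu₀ 0 0 0
    have h1 := key x hx u₀ hu₀ 1 0 0
    have : E'.f (Φ.X x) * (Φ.A x / Φ.a) = l x * E.f x := by linear_combination h1 - h0
    field_simp at this
    linear_combination this
  have kg : ∀ x ∈ E.I, E'.g (Φ.X x) * Φ.A x = l x * E.g x * deriv Φ.X x ^ 2 := by
    intro x hx
    have X0 := hΦ.deriv_X_ne _ hx
    have h0 := key x hx u₀ hu₀ 0 0 0
    have h1 := key x hx u₀ hu₀ 0 0 1
    have : E'.g (Φ.X x) * (Φ.A x / deriv Φ.X x ^ 2) = l x * E.g x := by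
      linear_combination h0 - h1
    field_simp at this
    linear_combination this
  have kg' : ∀ x ∈ E.I, deriv E'.g (Φ.X x) * Φ.A x * deriv Φ.X x ^ 2 +
      E'.g (Φ.X x) * (2 * deriv Φ.A x * deriv Φ.X x - deriv (deriv Φ.X) x * Φ.A x) =
      l x * deriv E.g x * deriv Φ.X x ^ 3 := by
    intro x hx
    have X0 := hΦ.deriv_X_ne _ hx
    have h0 := key x hx u₀ hu₀ 0 0 0
    have h1 := key x hx u₀ hu₀ 0 1 0
    have : deriv E'.g (Φ.X x) * (Φ.A x / deriv Φ.X x) +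
      E'.g (Φ.X x) * ((2 * deriv Φ.A x - deriv (deriv Φ.X) x * (Φ.A x / deriv Φ.X x))
        / deriv Φ.X x ^ 2) = l x * deriv E.g x := by
      linear_combination h0 - h1
    field_simp at this
    linear_combination this
  have dg : ∀ x ∈ E.I, deriv E'.g (Φ.X x) * deriv Φ.X x * Φ.A x + E'.g (Φ.X x) * deriv Φ.A x =
      (deriv l x * E.g x + l x * deriv E.g x) * deriv Φ.X x ^ 2 +
        l x * E.g x * (2 * deriv Φ.X x * deriv (deriv Φ.X) x) := by
    intro x hx
    have d1 : HasDerivAt (fun y => E'.g (Φ.X y)) (deriv E'.g (Φ.X x) * deriv Φ.X x) x :=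
      (smooth_hasDerivAt E'.isOpen_I hE'.smooth_g (hΦ.bijOn.mapsTo hx)).comp x
        (smooth_hasDerivAt oI hΦ.smooth_X hx)
    have d2 := d1.mul (smooth_hasDerivAt oI hΦ.smooth_A hx)
    have d3 := ((smooth_hasDerivAt oI hl hx).mul (smooth_hasDerivAt oI hE.smooth_g hx)).mul
      ((smooth_hasDerivAt oI sX' hx).pow 2)
    have := d2.unique (d3.congr_of_eventuallyEq (eventuallyEq_of_mem (oI.mem_nhds hx) kg))
    simpa using this
  -- The u_x coefficient and the derivative of the u_xx coefficient both determine g'' s derivative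
  -- at the image point. Comparing them gives g X'² (l A X')' = 0, and since g ≠ 0 this yields the
  -- constant c.
  have kc : ∀ x ∈ E.I, deriv (fun y => l y * (Φ.A y * deriv Φ.X y)) x = 0 := by
    intro x hx
    rw [deriv_smooth_mul oI hl (hΦ.smooth_A.mul sX') hx, deriv_smooth_mul oI hΦ.smooth_A sX' hx]
    have X0 := hΦ.deriv_X_ne _ hx
    have h1 := kg x hx
    have h2 := kg' x hx
    have h3 := dg x hx
    refine mul_left_cancel₀ (mul_ne_zero (hg0 x hx) (pow_ne_zero 2 X0)) ?_
    linear_combination (-Φ.A x * deriv Φ.X x) * h3 + Φ.A x * h2 -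
      (deriv Φ.A x * deriv Φ.X x - deriv (deriv Φ.X) x * Φ.A x) * h1
  obtain ⟨c, hc⟩ := hI.const_of_deriv_eq_zero (hl.mul (hΦ.smooth_A.mul sX')) kc
  have hlc : ∀ x ∈ E.I, l x = c / (Φ.A x * deriv Φ.X x) := fun x hx =>
    (eq_div_iff (mul_ne_zero (hΦ.A_ne x hx) (hΦ.deriv_X_ne x hx))).2 (hc x hx)
  refine ⟨c, ?_, ?_, ?_, ?_⟩
  · obtain ⟨x, hx⟩ := hI.nonempty
    rw [← hc x hx]
    exact mul_ne_zero (hl0 x hx) (mul_ne_zero (hΦ.A_ne x hx) (hΦ.deriv_X_ne x hx))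
  · intro x hx
    have X0 := hΦ.deriv_X_ne _ hx
    have A0 := hΦ.A_ne _ hx
    have := kf x hx
    rw [hlc x hx] at this
    rw [(eq_div_iff A0).2 this]
    field_simp
  · intro x hx
    have X0 := hΦ.deriv_X_ne _ hx
    have A0 := hΦ.A_ne _ hx
    have := kg x hx
    rw [hlc x hx] at this
    rw [(eq_div_iff A0).2 this]
    field_simp
  · intro x hx u hu
    have X0 := hΦ.deriv_X_ne _ hx
    have A0 := hΦ.A_ne _ hx
    have h0 := key x hx u hu 0 0 0
    have e2 := deriv_div_sq oI hE.smooth_g (smooth_deriv oI hΦ.smooth_A) hΦ.smooth_A hΦ.A_ne hx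
    have e3 := deriv_div_sq oI hE.smooth_g (smooth_deriv oI hΦ.smooth_B) hΦ.smooth_A hΦ.A_ne hx
    rw [psiExpr, e2, e3]
    have h1 := (eq_div_iff A0).2 (kg x hx)
    have h2 := kg' x hx
    rw [← eq_sub_iff_add_eq, mul_assoc] at h2
    have h2' := (eq_div_iff (mul_ne_zero A0 (pow_ne_zero 2 X0))).2 h2
    rw [h2', h1, hlc x hx] at h0
    rw [← sub_eq_zero] at h0 ⊢
    rw [← neg_eq_zero, ← h0]
    field_simp
    ring

end PointMap


/-! ### Powers and conventions -/

lemma spow_mul (m a b : ℝ) : spow m (a * b) = spow m a * spow m b := by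
  unfold spow
  split_ifs
  · exact mul_zpow a b _
  · rw [abs_mul, Real.mul_rpow (abs_nonneg a) (abs_nonneg b)]

lemma spow_of_pos (m : ℝ) {a : ℝ} (ha : 0 < a) : spow m a = a ^ m := by
  unfold spow
  split_ifs with h
  · rw [← Real.rpow_intCast, ← h]
  · rw [abs_of_pos ha]

lemma spow_one (m : ℝ) : spow m 1 = 1 := by
  rw [spow_of_pos m one_pos, Real.one_rpow]

lemma spow_ne_zero (m : ℝ) {a : ℝ} (ha : a ≠ 0) : spow m a ≠ 0 := by
  intro h
  have := spow_mul m a a⁻¹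
  rw [mul_inv_cancel₀ ha, spow_one, h, zero_mul] at this
  exact one_ne_zero this

lemma spow_exponent_two (u : ℝ) : spow 2 u = u ^ 2 := by
  have h : ((⌊(2 : ℝ)⌋ : ℤ) : ℝ) = 2 := by norm_num
  have h' : ⌊(2 : ℝ)⌋ = 2 := by norm_num
  unfold spow
  rw [if_pos h.symm, h']
  rfl

lemma differentiableAt_spow (m : ℝ) {u : ℝ} (hu : u ≠ 0) : DifferentiableAt ℝ (spow m) u := by
  by_cases h : m = (⌊m⌋ : ℝ)
  · have e : spow m = fun u => u ^ ⌊m⌋ := by funext u; unfold spow; rw [if_pos h]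
    rw [e]
    exact differentiableAt_zpow.2 (Or.inl hu)
  · have e : spow m = fun u => |u| ^ m := by funext u; unfold spow; rw [if_neg h]
    rw [e]
    exact (differentiableAt_abs hu).rpow_const (Or.inl (abs_ne_zero.2 hu))

lemma differentiableAt_snd_spow (m x : ℝ) {u : ℝ} (hu : u ≠ 0) :
    DifferentiableAt ℝ (fun q : ℝ × ℝ => spow m q.2) (x, u) :=
  DifferentiableAt.comp (g := spow m) (x, u) (differentiableAt_spow m hu) differentiableAt_snd

/-- As 2^m ≠ 2, the values u = 1 and u = 2 separate u^m from u; both are admissible under either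
convention. -/
lemma spow_two_ne {m : ℝ} (hm : m ≠ 1) : spow m 2 ≠ 2 := by
  rw [spow_of_pos m two_pos]
  intro h
  refine hm ((Real.rpow_right_inj (x := 2) two_pos (by norm_num)).1 ?_)
  rw [h, Real.rpow_one]

namespace Convention

variable (c : Convention)

lemma isOpen_vals : IsOpen c.vals := by
  cases c
  · exact isOpen_Ioi
  · exact isOpen_compl_singleton

lemma ne_zero_of_mem_vals {u : ℝ} (hu : u ∈ c.vals) : u ≠ 0 := by
  cases c
  · exact ne_of_gt hu
  · exact hu

lemma mem_vals_of_pos {u : ℝ} (hu : 0 < u) : u ∈ c.vals := by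
  cases c
  · exact hu
  · exact hu.ne'

lemma Multiplier.ne_zero {c : Convention} {A : ℝ} (h : c.Multiplier A) : A ≠ 0 := by
  cases c
  · exact ne_of_gt h
  · exact h

lemma Multiplier.of_pos {A : ℝ} (h : 0 < A) : c.Multiplier A := by
  cases c
  · exact h
  · exact h.ne'

lemma Multiplier.range_iff {c : Convention} {A : ℝ} (h : c.Multiplier A) (w : ℝ) :
    w ∈ c.range ↔ A * w + 0 ∈ c.range := by
  rw [add_zero]
  cases c
  · exact (mul_pos_iff_of_pos_left h).symm
  · exact Iff.rfl

lemma Multiplier.vals_iff {c : Convention} {A : ℝ} (h : c.Multiplier A) (w : ℝ) :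
    w ∈ c.vals ↔ A * w + 0 ∈ c.vals := by
  rw [add_zero]
  cases c
  · exact (mul_pos_iff_of_pos_left h).symm
  · exact (mul_ne_zero_iff_left h).symm

/-- An affine map preserving the positive half-line, or the punctured line, must fix 0. So shifts of
the dependent variable can occur only in the quadratic classes, where all real values are admitted.
-/
lemma multiplier_of_vals_iff {A B : ℝ} (hA : A ≠ 0)
    (h : ∀ w, w ∈ c.vals ↔ A * w + B ∈ c.vals) : c.Multiplier A ∧ B = 0 := by
  cases c
  · simp only [vals, mem_Ioi] at h
    have hB : B ≤ 0 := by
      by_contra hB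
      have := (h 0).2 (by linarith)
      exact lt_irrefl _ this
    have h1 := (h 1).1 one_pos
    have hA' : 0 < A := by linarith
    refine ⟨hA', le_antisymm hB ?_⟩
    by_contra hB'
    push Not at hB'
    -- This positive value would be sent to B/2 < 0.
    have := (h (-B / (2 * A))).1 (div_pos (by linarith) (by linarith))
    have e : A * (-B / (2 * A)) = -B / 2 := by field_simp
    rw [e] at this
    linarith
  · refine ⟨hA, ?_⟩
    by_contra hB
    exact (h 0).2 (by simpa [vals] using hB) rfl

lemma convex_range : Convex ℝ c.range := by
  cases c
  · exact convex_Ioi 0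
  · exact convex_univ

lemma range_diff_subset : c.range \ {0} ⊆ c.vals := by
  cases c
  · exact sdiff_subset
  · exact fun x hx => hx.2

end Convention

/-! ### Construction of arbitrary elements -/

lemma IsSmoothOn.indicator {I : Set ℝ} {F : ℝ → ℝ} (h : ContDiffOn ℝ ∞ F I) :
    IsSmoothOn I (I.indicator F) where
  smooth := h.congr fun _ hx => indicator_of_mem hx F
  zero_off _ hx := indicator_of_notMem hx F

lemma IsSmoothOn.ext {I : Set ℝ} {F G : ℝ → ℝ} (hF : IsSmoothOn I F) (hG : IsSmoothOn I G)
    (h : ∀ x ∈ I, F x = G x) : F = G := by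
  funext x
  by_cases hx : x ∈ I
  · exact h x hx
  · rw [hF.zero_off x hx, hG.zero_off x hx]

/-- Arbitrary elements with given values on the interval `I`. -/
noncomputable def Coeffs.of {I : Set ℝ} (hI : IsInterval I) {f g h : ℝ → ℝ}
    (hf : ContDiffOn ℝ ∞ f I) (hg : ContDiffOn ℝ ∞ g I) (hh : ContDiffOn ℝ ∞ h I)
    (h0 : ∀ x ∈ I, f x * g x * h x ≠ 0) : Coeffs where
  I := I
  f := I.indicator f
  g := I.indicator g
  h := I.indicator h
  isInterval := hI
  smooth_f := .indicator hf
  smooth_g := .indicator hg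
  smooth_h := .indicator hh
  ne_zero x hx := by simpa only [indicator_of_mem hx] using h0 x hx

/-- Arbitrary elements with given values on the interval `I`. -/
noncomputable def ImagedCoeffs.of {I : Set ℝ} (hI : IsInterval I) {F H : ℝ → ℝ}
    (hF : ContDiffOn ℝ ∞ F I) (hH : ContDiffOn ℝ ∞ H I) (h0 : ∀ x ∈ I, H x ≠ 0)
    (hs : ∃ s : ℝ → ℝ, ContDiffOn ℝ ∞ s I ∧ ∀ x ∈ I, 0 < s x ∧ deriv (deriv s) x + F x * s x = 0) :
    ImagedCoeffs where
  I := I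
  F := I.indicator F
  H := I.indicator H
  isInterval := hI
  smooth_F := .indicator hF
  smooth_H := .indicator hH
  H_ne_zero x hx := by simpa only [indicator_of_mem hx] using h0 x hx
  exists_pos := by
    obtain ⟨s, h1, h2⟩ := hs
    exact ⟨s, h1, fun x hx => by simpa only [indicator_of_mem hx] using h2 x hx⟩

/-- Arbitrary elements with given values on the interval `I`. -/
noncomputable def DoubleImagedCoeffs.of {I : Set ℝ} (hI : IsInterval I) {H G : ℝ → ℝ}
    (hH : ContDiffOn ℝ ∞ H I) (hG : ContDiffOn ℝ ∞ G I) (h0 : ∀ x ∈ I, H x ≠ 0)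
    (hs : ∃ z s : ℝ → ℝ, ContDiffOn ℝ ∞ z I ∧ ContDiffOn ℝ ∞ s I ∧
      ∀ x ∈ I, deriv (deriv z) x + H x * z x ^ 2 + G x = 0 ∧
        0 < s x ∧ deriv (deriv s) x + 2 * H x * z x * s x = 0) :
    DoubleImagedCoeffs where
  I := I
  H := I.indicator H
  G := I.indicator G
  isInterval := hI
  smooth_H := .indicator hH
  smooth_G := .indicator hG
  H_ne_zero x hx := by simpa only [indicator_of_mem hx] using h0 x hx
  exists_pos := by
    obtain ⟨z, s, h1, h2, h3⟩ := hs
    exact ⟨z, s, h1, h2, fun x hx => by simpa only [indicator_of_mem hx] using h3 x hx⟩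

namespace Coeffs

variable (θ : Coeffs) {x : ℝ}

lemma f_ne_zero (hx : x ∈ θ.I) : θ.f x ≠ 0 := fun h => θ.ne_zero x hx (by simp [h])
lemma g_ne_zero (hx : x ∈ θ.I) : θ.g x ≠ 0 := fun h => θ.ne_zero x hx (by simp [h])
lemma h_ne_zero (hx : x ∈ θ.I) : θ.h x ≠ 0 := fun h => θ.ne_zero x hx (by simp [h])

end Coeffs

lemma differentiableAt_fst_smooth {I : Set ℝ} (hI : IsOpen I) {f : ℝ → ℝ}
    (hf : ContDiffOn ℝ ∞ f I) {x : ℝ} (hx : x ∈ I) (u : ℝ) :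
    DifferentiableAt ℝ (fun q : ℝ × ℝ => f q.1) (x, u) :=
  (smooth_hasDerivAt hI hf hx).differentiableAt.comp (x, u) differentiableAt_fst

/-! ### The classes are rich -/

lemma powerClass_isRich (c : Convention) : (powerClass c).IsRich c.range where
  regular θ :=
    { smooth_f := θ.smooth_f.smooth
      smooth_g := θ.smooth_g.smooth
      isOpen_vals := c.isOpen_vals
      differentiableAt_N := fun x hx u hu =>
        (differentiableAt_fst_smooth θ.isInterval.isOpen θ.smooth_h.smooth hx u).mul
          (differentiableAt_snd_spow θ.m x (c.ne_zero_of_mem_vals hu)) }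
  isInterval θ := θ.isInterval
  range_eq _ := rfl
  convex := c.convex_range
  vals _ := c.range_diff_subset
  exists_model θ H hH h0 := by
    refine ⟨⟨.of θ.isInterval (f := fun _ => 1) (g := fun _ => 1) (h := H) contDiffOn_const
      contDiffOn_const hH.contDiffOn (by simpa using fun x _ => h0 x), 2, by norm_num, by norm_num⟩,
      rfl, ⟨fun x hx => indicator_of_mem hx (fun _ => (1 : ℝ)), fun x hx => indicator_of_mem hx (fun _ => (1 : ℝ)),
      fun x hx u => ?_⟩⟩
    have : θ.I.indicator H x = H x := indicator_of_mem hx H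
    simp only [powerClass, powerEqn, Coeffs.of, spow_exponent_two, this]

lemma imagedClass_isRich (c : Convention) : (imagedClass c).IsRich c.range where
  regular θ :=
    { smooth_f := contDiffOn_const
      smooth_g := contDiffOn_const
      isOpen_vals := c.isOpen_vals
      differentiableAt_N := fun x hx u hu =>
        ((differentiableAt_fst_smooth θ.isInterval.isOpen θ.smooth_H.smooth hx u).mul
          (differentiableAt_snd_spow θ.m x (c.ne_zero_of_mem_vals hu))).add
        ((differentiableAt_fst_smooth θ.isInterval.isOpen θ.smooth_F.smooth hx u).mul
          differentiableAt_snd) }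
  isInterval θ := θ.isInterval
  range_eq _ := rfl
  convex := c.convex_range
  vals _ := c.range_diff_subset
  exists_model θ H hH h0 := by
    -- For F = 0 the constant 1 is a positive solution on any interval.
    refine ⟨⟨.of θ.isInterval (F := fun _ => 0) (H := H) contDiffOn_const
      hH.contDiffOn (fun x _ => h0 x) ⟨fun _ => 1, contDiffOn_const, by simp⟩, 2, by norm_num,
      by norm_num⟩, rfl, ⟨fun x hx => rfl, fun x hx => rfl, fun x hx u => ?_⟩⟩
    have : θ.I.indicator H x = H x := indicator_of_mem hx H
    simp [imagedClass, imagedEqn, ImagedCoeffs.of, spow_exponent_two, this]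

lemma quadClass_isRich : quadClass.IsRich univ where
  regular θ :=
    { smooth_f := θ.smooth_f.smooth
      smooth_g := θ.smooth_g.smooth
      isOpen_vals := isOpen_univ
      differentiableAt_N := fun x hx u hu =>
        (differentiableAt_fst_smooth θ.isInterval.isOpen θ.smooth_h.smooth hx u).mul
          (differentiableAt_snd.pow 2) }
  isInterval θ := θ.isInterval
  range_eq _ := rfl
  convex := convex_univ
  vals _ := subset_univ _
  exists_model θ H hH h0 := by
    refine ⟨.of θ.isInterval (f := fun _ => 1) (g := fun _ => 1) (h := H) contDiffOn_const
      contDiffOn_const hH.contDiffOn (by simpa using fun x _ => h0 x),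
      rfl, ⟨fun x hx => indicator_of_mem hx (fun _ => (1 : ℝ)), fun x hx => indicator_of_mem hx (fun _ => (1 : ℝ)),
      fun x hx u => ?_⟩⟩
    have : θ.I.indicator H x = H x := indicator_of_mem hx H
    simp only [quadClass, quadEqn, Coeffs.of, this]

lemma doubleImagedClass_isRich : doubleImagedClass.IsRich univ where
  regular θ :=
    { smooth_f := contDiffOn_const
      smooth_g := contDiffOn_const
      isOpen_vals := isOpen_univ
      differentiableAt_N := fun x hx u hu =>
        ((differentiableAt_fst_smooth θ.isInterval.isOpen θ.smooth_H.smooth hx u).mul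
          (differentiableAt_snd.pow 2)).add
        (differentiableAt_fst_smooth θ.isInterval.isOpen θ.smooth_G.smooth hx u) }
  isInterval θ := θ.isInterval
  range_eq _ := rfl
  convex := convex_univ
  vals _ := subset_univ _
  exists_model θ H hH h0 := by
    -- For G = 0 the pair z = 0, s = 1 meets the condition on the interval.
    refine ⟨.of θ.isInterval (G := fun _ => 0) (H := H) hH.contDiffOn contDiffOn_const
      (fun x _ => h0 x) ⟨fun _ => 0, fun _ => 1, contDiffOn_const, contDiffOn_const, by simp⟩,
      rfl, ⟨fun x hx => rfl, fun x hx => rfl, fun x hx u => ?_⟩⟩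
    have : θ.I.indicator H x = H x := indicator_of_mem hx H
    simp [doubleImagedClass, doubleImagedEqn, DoubleImagedCoeffs.of, this]


/-! ### The equivalence groups exhaust the conjugations -/

lemma psiExpr_const {I : Set ℝ} (hI : IsOpen I) {g A : ℝ → ℝ} {d : ℝ} (hA : ∀ x ∈ I, A x = d)
    {x : ℝ} (hx : x ∈ I) : psiExpr g A x = 0 := by
  have : ∀ y ∈ I, g y * deriv A y / A y ^ 2 = 0 := fun y hy => by
    rw [deriv_congr_of_isOpen (g := fun _ => d) hI hA hy]; simp
  rw [psiExpr, deriv_congr_of_isOpen (g := fun _ => (0 : ℝ)) hI this hx]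
  simp

lemma deriv_shift_zero {I : Set ℝ} (hI : IsOpen I) {g A B : ℝ → ℝ} (hB : ∀ x ∈ I, B x = 0)
    {x : ℝ} (hx : x ∈ I) : deriv (fun y => g y * deriv B y / A y ^ 2) x = 0 := by
  have : ∀ y ∈ I, g y * deriv B y / A y ^ 2 = 0 := fun y hy => by
    rw [deriv_congr_of_isOpen (g := fun _ => (0 : ℝ)) hI hB hy]; simp
  rw [deriv_congr_of_isOpen (g := fun _ => (0 : ℝ)) hI this hx]
  simp

lemma smooth_psiExpr {I : Set ℝ} (hI : IsOpen I) {g A : ℝ → ℝ} (hg : ContDiffOn ℝ ∞ g I)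
    (hA : ContDiffOn ℝ ∞ A I) (h0 : ∀ x ∈ I, A x ≠ 0) : ContDiffOn ℝ ∞ (psiExpr g A) I :=
  smooth_deriv hI ((hg.mul (smooth_deriv hI hA)).div (hA.pow 2) fun x hx => pow_ne_zero 2 (h0 x hx))

lemma bijOn_of_image {I I' : Set ℝ} (hI : IsInterval I) {f : ℝ → ℝ} (hf : ContDiffOn ℝ ∞ f I)
    (hf' : ∀ x ∈ I, deriv f x ≠ 0) (h : I' = f '' I) : BijOn f I I' :=
  h ▸ (hI.injOn hf hf').bijOn_image

/-- A linear combination of `u ^ m` and `u` that vanishes on all admissible values is trivial. -/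
lemma coefficients_eq_zero {m a b : ℝ} (hm : m ≠ 1) (h1 : a * spow m 1 + b * 1 = 0)
    (h2 : a * spow m 2 + b * 2 = 0) : a = 0 ∧ b = 0 := by
  rw [spow_one] at h1
  have h3 : a * (spow m 2 - 2) = 0 := by linear_combination h2 - 2 * h1
  have ha : a = 0 := (mul_eq_zero.1 h3).resolve_right (sub_ne_zero.2 (spow_two_ne hm))
  subst ha
  exact ⟨rfl, by linarith⟩

/-- Since B = 0, the condition on the nonlinearity compares multiples of u^m and of u. The first
gives the law for h, the second the equation for ψ. -/
lemma powerClass_isExhaustive (c : Convention) : (powerClass c).IsExhaustive PowerElt.m where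
  conj := by
    rintro θ Φ θ' ⟨δ₀, δ₁, δ₂, φ, ψ, hδ, hφ, hφ', hψ, hψm, hE, rfl, hI', hm, hc⟩
    have hΦ : (⟨δ₁, δ₂, φ, ψ, fun _ => 0⟩ : PointMap).Nondegenerate θ.I :=
      ⟨right_ne_zero_of_mul hδ, hφ, hψ, contDiffOn_const, hφ', fun x hx => (hψm x hx).ne_zero⟩
    refine ⟨hm.symm, PointMap.Nondegenerate.conj_of_coefficients (E := (powerClass c).eqn θ)
      (E' := (powerClass c).eqn θ') hΦ ((powerClass_isRich c).regular θ)
      ((powerClass_isRich c).regular θ') (bijOn_of_image θ.isInterval hφ hφ' hI')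
      (fun x hx w => (hψm x hx).range_iff w) (fun x hx w => (hψm x hx).vals_iff w)
      (left_ne_zero_of_mul hδ) (fun x hx => (hc x hx).1) (fun x hx => (hc x hx).2.1) ?_⟩
    intro x hx u hu
    have ψ0 := (hψm x hx).ne_zero
    have X0 := hφ' x hx
    have s0 := spow_ne_zero θ.m ψ0
    simp only [powerClass, powerEqn, hE x hx, deriv_const', mul_zero, zero_div, zero_mul, add_zero,
      hm, spow_mul, (hc x hx).2.2]
    field_simp
    ring
  equivalent := by
    intro θ Φ θ' hm hΦ
    obtain ⟨d, hd, hf, hg, hN⟩ := hΦ.coefficients ((powerClass_isRich c).regular θ)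
      ((powerClass_isRich c).regular θ') θ.isInterval ⟨1, c.mem_vals_of_pos one_pos⟩
      (fun x hx => θ.g_ne_zero hx)
    have hAB := fun x hx => c.multiplier_of_vals_iff (hΦ.A_ne x hx) (hΦ.vals_iff x hx)
    have key : ∀ x ∈ θ.I, θ'.h (Φ.X x) * spow θ.m (Φ.A x)
        - d / (deriv Φ.X x * Φ.A x) * θ.h x = 0 ∧ d / deriv Φ.X x * psiExpr θ.g Φ.A x = 0 := by
      intro x hx
      have h1 := hN x hx 1 (c.mem_vals_of_pos one_pos)
      have h2 := hN x hx 2 (c.mem_vals_of_pos two_pos)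
      have X0 := hΦ.deriv_X_ne x hx
      have A0 := hΦ.A_ne x hx
      rw [deriv_shift_zero θ.isInterval.isOpen (fun x hx => (hAB x hx).2) hx, (hAB x hx).2] at h1 h2
      simp only [powerClass, powerEqn, ← hm, spow_mul, add_zero, sub_zero] at h1 h2
      refine coefficients_eq_zero θ.m_ne_one ?_ ?_
      · rw [← sub_eq_zero] at h1
        rw [← h1]
        field_simp
        ring
      · rw [← sub_eq_zero] at h2
        rw [← h2]
        field_simp
        ring
    -- `Φ.B` vanishes over the interval only, so it is replaced by the zero function that the group
    -- prescribes.
    refine ⟨⟨Φ.a, Φ.b, Φ.X, Φ.A, fun _ => 0⟩, d, Φ.a, Φ.b, Φ.X, Φ.A, mul_ne_zero hd hΦ.a_ne,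
      hΦ.smooth_X, hΦ.deriv_X_ne, hΦ.smooth_A, fun x hx => (hAB x hx).1, fun x hx => ?_, rfl,
      hΦ.bijOn.image_eq.symm, hm.symm, fun x hx => ⟨hf x hx, hg x hx, ?_⟩⟩
    · exact (mul_eq_zero.1 (key x hx).2).resolve_left (div_ne_zero hd (hΦ.deriv_X_ne x hx))
    · have h1 := (key x hx).1
      have X0 := hΦ.deriv_X_ne x hx
      have A0 := hΦ.A_ne x hx
      have s0 := spow_ne_zero θ.m A0
      rw [sub_eq_zero] at h1
      rw [(eq_div_iff s0).2 h1]
      field_simp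

/-- Here the shift survives. Splitting the condition on the nonlinearity by powers of u gives the
law for h from u², the formula for χ from u, and the differential equation for ψ from the constant
term. -/
lemma quadClass_isExhaustive : quadClass.IsExhaustive (fun _ => ()) where
  conj := by
    rintro θ Φ θ' ⟨δ₀, δ₁, δ₂, φ, ψ, χ, hδ, hφ, hφ', hψ, hψ0, hE, hχ, rfl, hI', hc⟩
    have o := θ.isInterval.isOpen
    have sB : ContDiffOn ℝ ∞ (fun z => ψ z ^ 2 / (2 * θ.h z) * psiExpr θ.g ψ z) θ.I :=
      ((hψ.pow 2).div (contDiffOn_const.mul θ.smooth_h.smooth)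
        fun x hx => mul_ne_zero two_ne_zero (θ.h_ne_zero hx)).mul
        (smooth_psiExpr o θ.smooth_g.smooth hψ hψ0)
    have hχ' : ∀ x ∈ θ.I, χ x = -(ψ x ^ 2 / (2 * θ.h x) * psiExpr θ.g ψ x) := fun x hx => by
      rw [hχ x hx]; ring
    have hΦ : (⟨δ₁, δ₂, φ, ψ, χ⟩ : PointMap).Nondegenerate θ.I :=
      ⟨right_ne_zero_of_mul hδ, hφ, hψ, sB.neg.congr hχ', hφ', hψ0⟩
    refine ⟨rfl, PointMap.Nondegenerate.conj_of_coefficients (E := quadClass.eqn θ)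
      (E' := quadClass.eqn θ') hΦ (quadClass_isRich.regular θ)
      (quadClass_isRich.regular θ') (bijOn_of_image θ.isInterval hφ hφ' hI')
      (fun _ _ _ => Iff.rfl) (fun _ _ _ => Iff.rfl)
      (left_ne_zero_of_mul hδ) (fun x hx => (hc x hx).1) (fun x hx => (hc x hx).2.1) ?_⟩
    intro x hx u hu
    have ψ0 := hψ0 x hx
    have X0 := hφ' x hx
    have h0 := θ.h_ne_zero hx
    have e1 : ∀ y ∈ θ.I, deriv χ y =
        -deriv (fun z => ψ z ^ 2 / (2 * θ.h z) * psiExpr θ.g ψ z) y := fun y hy => by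
      rw [deriv_congr_of_isOpen o hχ' hy]
      exact deriv.fun_neg
    have e2 : deriv (fun y => θ.g y * deriv χ y / ψ y ^ 2) x =
        -(ψ x / (4 * θ.h x) * psiExpr θ.g ψ x ^ 2) := by
      rw [← hE x hx, deriv_congr_of_isOpen (g := fun y => -(θ.g y / ψ y ^ 2 *
        deriv (fun z => ψ z ^ 2 / (2 * θ.h z) * psiExpr θ.g ψ z) y)) o
        (fun y hy => by rw [e1 y hy]; ring) hx]
      exact deriv.fun_neg
    simp only [quadClass, quadEqn]
    rw [e2, hχ x hx, (hc x hx).2.2]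
    field_simp
    ring
  equivalent := by
    intro θ Φ θ' _ hΦ
    obtain ⟨d, hd, hf, hg, hN⟩ := hΦ.coefficients (quadClass_isRich.regular θ)
      (quadClass_isRich.regular θ') θ.isInterval ⟨1, trivial⟩
      (fun x hx => θ.g_ne_zero hx)
    have o := θ.isInterval.isOpen
    have hh : ∀ x ∈ θ.I, θ'.h (Φ.X x) = d / (deriv Φ.X x * Φ.A x ^ 3) * θ.h x := by
      intro x hx
      have h0 := hN x hx 0 trivial
      have h1 := hN x hx 1 trivial
      have h2 := hN x hx (-1) trivial
      simp only [quadClass, quadEqn] at h0 h1 h2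
      have X0 := hΦ.deriv_X_ne x hx
      have A0 := hΦ.A_ne x hx
      have : θ'.h (Φ.X x) * Φ.A x ^ 2 = d / deriv Φ.X x * (θ.h x / Φ.A x) := by
        linear_combination (h1 + h2) / 2 - h0
      rw [(eq_div_iff (pow_ne_zero 2 A0)).2 this]
      field_simp
    have hB : ∀ x ∈ θ.I, Φ.B x = -(Φ.A x ^ 2 / (2 * θ.h x)) * psiExpr θ.g Φ.A x := by
      intro x hx
      have h1 := hN x hx 1 trivial
      have h2 := hN x hx (-1) trivial
      have X0 := hΦ.deriv_X_ne x hx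
      have A0 := hΦ.A_ne x hx
      have h0 := θ.h_ne_zero hx
      simp only [quadClass, quadEqn, hh x hx] at h1 h2
      have h3 : d / (deriv Φ.X x * Φ.A x ^ 3) * θ.h x * (2 * Φ.A x * Φ.B x) =
          -(d / deriv Φ.X x * psiExpr θ.g Φ.A x) := by
        linear_combination (h1 - h2) / 2
      field_simp at h3 ⊢
      linear_combination h3
    have hB' : ∀ x ∈ θ.I, -Φ.B x = Φ.A x ^ 2 / (2 * θ.h x) * psiExpr θ.g Φ.A x := fun x hx => by
      rw [hB x hx]; ring
    refine ⟨Φ, d, Φ.a, Φ.b, Φ.X, Φ.A, Φ.B, mul_ne_zero hd hΦ.a_ne,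
      hΦ.smooth_X, hΦ.deriv_X_ne, hΦ.smooth_A, hΦ.A_ne, fun x hx => ?_, hB, rfl,
      hΦ.bijOn.image_eq.symm, fun x hx => ⟨hf x hx, hg x hx, hh x hx⟩⟩
    have h3 := hN x hx 0 trivial
    have X0 := hΦ.deriv_X_ne x hx
    have A0 := hΦ.A_ne x hx
    have h0 := θ.h_ne_zero hx
    simp only [quadClass, quadEqn, hh x hx, mul_zero, zero_add] at h3
    have e1 : ∀ y ∈ θ.I, θ.g y / Φ.A y ^ 2 *
        deriv (fun z => Φ.A z ^ 2 / (2 * θ.h z) * psiExpr θ.g Φ.A z) y =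
        -(θ.g y * deriv Φ.B y / Φ.A y ^ 2) := fun y hy => by
      rw [← deriv_congr_of_isOpen o hB' hy, deriv.fun_neg]
      ring
    rw [deriv_congr_of_isOpen o e1 hx, deriv.fun_neg]
    rw [hB x hx] at h3
    have h4 : d / deriv Φ.X x * (-deriv (fun y => θ.g y * deriv Φ.B y / Φ.A y ^ 2) x) =
        d / deriv Φ.X x * (Φ.A x / (4 * θ.h x) * psiExpr θ.g Φ.A x ^ 2) := by
      rw [← sub_eq_zero] at h3 ⊢
      rw [← neg_eq_zero, ← h3]
      field_simp
      ring
    exact mul_left_cancel₀ (div_ne_zero hd X0) h4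

/-- Conjugations between equations with `f = g = 1` are affine. -/
lemma PointMap.Conj.affine {Φ : PointMap} {E E' : Equation} (hΦ : Φ.Conj E E')
    (hE : E.Regular) (hE' : E'.Regular) (hI : IsInterval E.I) (hv : E.vals.Nonempty)
    (hf : ∀ x, E.f x = 1) (hg : ∀ x, E.g x = 1) (hf' : ∀ x, E'.f x = 1) (hg' : ∀ x, E'.g x = 1) :
    ∃ δ₁ δ₃ δ₄ : ℝ, δ₁ ≠ 0 ∧ δ₄ ≠ 0 ∧ (∀ x ∈ E.I, Φ.X x = δ₁ * x + δ₃) ∧ (∀ x ∈ E.I, Φ.A x = δ₄) ∧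
      ∀ x ∈ E.I, ∀ u ∈ E.vals, E'.N (δ₁ * x + δ₃) (δ₄ * u + Φ.B x) =
        δ₄ / δ₁ ^ 2 * E.N x u
          - δ₄ ^ 2 / δ₁ ^ 2 * deriv (fun y => E.g y * deriv Φ.B y / Φ.A y ^ 2) x := by
  obtain ⟨c, hc, h1, h2, h3⟩ := hΦ.coefficients hE hE' hI hv (by simp [hg])
  simp only [hf, hg, hf', hg', mul_one] at h1 h2
  have o := E.isOpen_I
  have sX' := smooth_deriv o hΦ.smooth_X
  -- With unit coefficients the laws read c X' = A² and X'² = a, so X' and A have constant nonzero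
  -- squares and are constant on the interval.
  have k1 : ∀ x ∈ E.I, c * deriv Φ.X x = Φ.A x ^ 2 := fun x hx => by
    have A0 := hΦ.A_ne x hx
    have := h2 x hx
    field_simp at this
    linear_combination -this
  have k2 : ∀ x ∈ E.I, deriv Φ.X x ^ 2 = Φ.a := fun x hx => by
    have A0 := hΦ.A_ne x hx
    have X0 := hΦ.deriv_X_ne x hx
    have := h1 x hx
    field_simp at this
    refine mul_left_cancel₀ hc ?_
    linear_combination this + deriv Φ.X x * k1 x hx
  obtain ⟨δ₁, hδ₁⟩ := hI.const_of_deriv_eq_zero sX' fun x hx => by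
    have X0 := hΦ.deriv_X_ne x hx
    have d1 := ((smooth_hasDerivAt o sX' hx).pow 2).unique
      ((hasDerivAt_const x Φ.a).congr_of_eventuallyEq (eventuallyEq_of_mem (o.mem_nhds hx) k2))
    simpa [X0] using d1
  obtain ⟨δ₃, hδ₃⟩ := hI.const_of_deriv_eq_zero (f := fun x => Φ.X x - δ₁ * x)
    (hΦ.smooth_X.sub (contDiffOn_const.mul contDiffOn_id)) fun x hx => by
    have := ((smooth_hasDerivAt o hΦ.smooth_X hx).sub ((hasDerivAt_id x).const_mul δ₁)).deriv
    refine this.trans ?_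
    rw [hδ₁ x hx]; ring
  obtain ⟨δ₄, hδ₄⟩ := hI.const_of_deriv_eq_zero hΦ.smooth_A fun x hx => by
    have A0 := hΦ.A_ne x hx
    have e : ∀ y ∈ E.I, Φ.A y ^ 2 = c * δ₁ := fun y hy => by rw [← k1 y hy, hδ₁ y hy]
    have d1 := ((smooth_hasDerivAt o hΦ.smooth_A hx).pow 2).unique
      ((hasDerivAt_const x (c * δ₁)).congr_of_eventuallyEq
        (eventuallyEq_of_mem (o.mem_nhds hx) e))
    simpa [A0] using d1
  obtain ⟨x₀, hx₀⟩ := hI.nonempty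
  have δ₁0 : δ₁ ≠ 0 := hδ₁ x₀ hx₀ ▸ hΦ.deriv_X_ne x₀ hx₀
  have δ₄0 : δ₄ ≠ 0 := hδ₄ x₀ hx₀ ▸ hΦ.A_ne x₀ hx₀
  have hcδ : c = δ₄ ^ 2 / δ₁ := by
    rw [eq_div_iff δ₁0, ← hδ₁ x₀ hx₀, k1 x₀ hx₀, hδ₄ x₀ hx₀]
  have hX : ∀ x ∈ E.I, Φ.X x = δ₁ * x + δ₃ := fun x hx => by linarith [hδ₃ x hx]
  refine ⟨δ₁, δ₃, δ₄, δ₁0, δ₄0, hX, hδ₄, fun x hx u hu => ?_⟩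
  have h := h3 x hx u hu
  rw [psiExpr_const o hδ₄ hx, hX x hx, hδ₄ x hx, hδ₁ x hx, hcδ] at h
  rw [h]
  field_simp
  ring

lemma PointMap.nondegenerate_affine {I : Set ℝ} {δ₁ δ₂ δ₃ δ₄ : ℝ} (h1 : δ₁ ≠ 0) (h4 : δ₄ ≠ 0) :
    (⟨δ₁ ^ 2, δ₂, fun x => δ₁ * x + δ₃, fun _ => δ₄, fun _ => 0⟩ : PointMap).Nondegenerate I where
  a_ne := pow_ne_zero 2 h1
  smooth_X := (contDiffOn_const.mul contDiffOn_id).add contDiffOn_const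
  smooth_A := contDiffOn_const
  smooth_B := contDiffOn_const
  deriv_X_ne x _ := by simpa using h1
  A_ne _ _ := h4

lemma deriv_affine (δ₁ δ₃ x : ℝ) : deriv (fun x => δ₁ * x + δ₃) x = δ₁ := by simp

lemma imagedClass_isExhaustive (c : Convention) : (imagedClass c).IsExhaustive ImagedElt.m where
  conj := by
    rintro θ Φ θ' ⟨δ₁, δ₂, δ₃, δ₄, h1, hm4, rfl, hI', hm, hc⟩
    have h4 := hm4.ne_zero
    have hΦ := PointMap.nondegenerate_affine (I := θ.I) (δ₂ := δ₂) (δ₃ := δ₃) h1 h4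
    refine ⟨hm.symm, PointMap.Nondegenerate.conj_of_coefficients (E := (imagedClass c).eqn θ)
      (E' := (imagedClass c).eqn θ') hΦ ((imagedClass_isRich c).regular θ)
      ((imagedClass_isRich c).regular θ')
      (bijOn_of_image θ.isInterval hΦ.smooth_X hΦ.deriv_X_ne hI')
      (fun x hx w => hm4.range_iff w) (fun x hx w => hm4.vals_iff w)
      (c := δ₄ ^ 2 / δ₁) (div_ne_zero (pow_ne_zero 2 h4) h1) (fun x hx => ?_) (fun x hx => ?_) ?_⟩
    · simp only [imagedClass, imagedEqn, deriv_affine]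
      field_simp
    · simp only [imagedClass, imagedEqn, deriv_affine]
      field_simp
    · intro x hx u hu
      have s0 := spow_ne_zero θ.m h4
      rw [psiExpr_const θ.isInterval.isOpen (fun _ _ => rfl) hx]
      simp only [imagedClass, imagedEqn, deriv_affine, deriv_const', mul_zero, zero_div, zero_mul,
        add_zero, sub_zero, hm, spow_mul, (hc x hx).1, (hc x hx).2]
      field_simp
  equivalent := by
    intro θ Φ θ' hm hΦ
    obtain ⟨δ₁, δ₃, δ₄, h1, h4, hX, hA, hN⟩ := hΦ.affine ((imagedClass_isRich c).regular θ)
      ((imagedClass_isRich c).regular θ') θ.isInterval ⟨1, c.mem_vals_of_pos one_pos⟩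
      (fun _ => rfl) (fun _ => rfl) (fun _ => rfl) (fun _ => rfl)
    have hAB := fun x hx => c.multiplier_of_vals_iff (hΦ.A_ne x hx) (hΦ.vals_iff x hx)
    have s0 := spow_ne_zero θ.m h4
    have key : ∀ x ∈ θ.I, θ'.H (δ₁ * x + δ₃) * spow θ.m δ₄ - δ₄ / δ₁ ^ 2 * θ.H x = 0 ∧
        θ'.F (δ₁ * x + δ₃) * δ₄ - δ₄ / δ₁ ^ 2 * θ.F x = 0 := by
      intro x hx
      have h1 := hN x hx 1 (c.mem_vals_of_pos one_pos)
      have h2 := hN x hx 2 (c.mem_vals_of_pos two_pos)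
      rw [deriv_shift_zero θ.isInterval.isOpen (fun x hx => (hAB x hx).2) hx, (hAB x hx).2] at h1 h2
      simp only [imagedClass, imagedEqn, ← hm, spow_mul, add_zero, sub_zero, mul_zero] at h1 h2
      refine coefficients_eq_zero θ.m_ne_one ?_ ?_
      · linear_combination h1
      · linear_combination h2
    obtain ⟨x₀, hx₀⟩ := θ.isInterval.nonempty
    -- The witness is the affine transformation itself; `Φ` agrees with it over `θ.I` but is
    -- unrestricted elsewhere.
    refine ⟨_, δ₁, Φ.b, δ₃, δ₄, h1, hA x₀ hx₀ ▸ (hAB x₀ hx₀).1, rfl, ?_, hm.symm,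
      fun x hx => ⟨?_, ?_⟩⟩
    · have h := hΦ.bijOn.image_eq
      rw [image_congr hX] at h
      exact h.symm
    · have := (key x hx).2
      rw [sub_eq_zero] at this
      rw [(eq_div_iff h4).2 this]
      field_simp
    · have := (key x hx).1
      rw [sub_eq_zero] at this
      rw [(eq_div_iff s0).2 this]
      field_simp

lemma doubleImagedClass_isExhaustive : doubleImagedClass.IsExhaustive (fun _ => ()) where
  conj := by
    rintro θ Φ θ' ⟨δ₁, δ₂, δ₃, δ₄, h14, rfl, hI', hc⟩
    have h1 := left_ne_zero_of_mul h14
    have h4 := right_ne_zero_of_mul h14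
    have hΦ := PointMap.nondegenerate_affine (I := θ.I) (δ₂ := δ₂) (δ₃ := δ₃) h1 h4
    refine ⟨rfl, PointMap.Nondegenerate.conj_of_coefficients (E := doubleImagedClass.eqn θ)
      (E' := doubleImagedClass.eqn θ') hΦ (doubleImagedClass_isRich.regular θ)
      (doubleImagedClass_isRich.regular θ')
      (bijOn_of_image θ.isInterval hΦ.smooth_X hΦ.deriv_X_ne hI')
      (fun _ _ _ => Iff.rfl) (fun _ _ _ => Iff.rfl)
      (c := δ₄ ^ 2 / δ₁) (div_ne_zero (pow_ne_zero 2 h4) h1) (fun x hx => ?_) (fun x hx => ?_) ?_⟩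
    · simp only [doubleImagedClass, doubleImagedEqn, deriv_affine]
      field_simp
    · simp only [doubleImagedClass, doubleImagedEqn, deriv_affine]
      field_simp
    · intro x hx u hu
      rw [psiExpr_const θ.isInterval.isOpen (fun _ _ => rfl) hx]
      simp only [doubleImagedClass, doubleImagedEqn, deriv_affine, deriv_const', mul_zero, zero_div,
        zero_mul, add_zero, sub_zero, (hc x hx).1, (hc x hx).2]
      field_simp
  equivalent := by
    intro θ Φ θ' _ hΦ
    obtain ⟨δ₁, δ₃, δ₄, h1, h4, hX, hA, hN⟩ := hΦ.affine (doubleImagedClass_isRich.regular θ)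
      (doubleImagedClass_isRich.regular θ') θ.isInterval ⟨1, trivial⟩
      (fun _ => rfl) (fun _ => rfl) (fun _ => rfl) (fun _ => rfl)
    have hH : ∀ x ∈ θ.I, θ'.H (δ₁ * x + δ₃) = θ.H x / (δ₁ ^ 2 * δ₄) := by
      intro x hx
      have e0 := hN x hx 0 trivial
      have e1 := hN x hx 1 trivial
      have e2 := hN x hx (-1) trivial
      simp only [doubleImagedClass, doubleImagedEqn] at e0 e1 e2
      have e3 : θ'.H (δ₁ * x + δ₃) * δ₄ ^ 2 = δ₄ / δ₁ ^ 2 * θ.H x := by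
        linear_combination (e1 + e2) / 2 - e0
      rw [(eq_div_iff (pow_ne_zero 2 h4)).2 e3]
      field_simp
    -- Neither equation has a term linear in w, so the odd part in u leaves a nonzero multiple of B
    -- equal to zero.
    have hB : ∀ x ∈ θ.I, Φ.B x = 0 := by
      intro x hx
      have e1 := hN x hx 1 trivial
      have e2 := hN x hx (-1) trivial
      simp only [doubleImagedClass, doubleImagedEqn, hH x hx] at e1 e2
      have e3 : θ.H x / (δ₁ ^ 2 * δ₄) * (2 * δ₄) * Φ.B x = 0 := by
        linear_combination (e1 - e2) / 2
      have := θ.H_ne_zero x hx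
      exact (mul_eq_zero.1 e3).resolve_left (by positivity)
    refine ⟨_, δ₁, Φ.b, δ₃, δ₄, mul_ne_zero h1 h4, rfl, ?_, fun x hx => ⟨?_, hH x hx⟩⟩
    · have h := hΦ.bijOn.image_eq
      rw [image_congr hX] at h
      exact h.symm
    · have e0 := hN x hx 0 trivial
      rw [deriv_shift_zero θ.isInterval.isOpen hB hx, hB x hx] at e0
      simp only [doubleImagedClass, doubleImagedEqn] at e0
      linear_combination e0


/-! ### The gauge transformation -/

lemma IsInterval.sign_eq {I : Set ℝ} (hI : IsInterval I) {f : ℝ → ℝ} (hf : ContinuousOn f I)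
    (h0 : ∀ x ∈ I, f x ≠ 0) {x y : ℝ} (hx : x ∈ I) (hy : y ∈ I) :
    SignType.sign (f x) = SignType.sign (f y) := by
  have h : ContinuousOn (fun x => SignType.sign (f x)) I := fun z hz =>
    (continuousAt_sign_of_ne_zero (h0 z hz)).comp_continuousWithinAt (hf z hz)
  exact hI.ordConnected.isPreconnected.constant h hx hy

lemma smooth_sqrt_abs {I : Set ℝ} {f : ℝ → ℝ} (hf : ContDiffOn ℝ ∞ f I)
    (h0 : ∀ x ∈ I, f x ≠ 0) : ContDiffOn ℝ ∞ (fun x => √|f x|) I :=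
  (hf.abs h0).sqrt fun x hx => abs_ne_zero.2 (h0 x hx)

lemma sqrt_abs_pos {a : ℝ} (h : a ≠ 0) : 0 < √|a| := Real.sqrt_pos.2 (abs_pos.2 h)

lemma sign_mul_self_coe (a : ℝ) : (SignType.sign a : ℝ) * a = |a| := sign_mul_self a

lemma sign_coe_sq {a : ℝ} (h : a ≠ 0) : (SignType.sign a : ℝ) ^ 2 = 1 := by
  rcases h.lt_or_gt with h | h <;> simp [h]

lemma sign_coe_ne_zero {a : ℝ} (h : a ≠ 0) : (SignType.sign a : ℝ) ≠ 0 := by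
  intro h'
  have := sign_coe_sq h
  rw [h'] at this
  norm_num at this

namespace Coeffs

variable (θ : Coeffs) {x₀ x : ℝ}

lemma smooth_rate : ContDiffOn ℝ ∞ (fun y => √|θ.f y / θ.g y|) θ.I :=
  smooth_sqrt_abs (θ.smooth_f.smooth.div θ.smooth_g.smooth fun _ hx => θ.g_ne_zero hx)
    fun _ hx => div_ne_zero (θ.f_ne_zero hx) (θ.g_ne_zero hx)

lemma hasDerivAt_gaugeX (hx₀ : x₀ ∈ θ.I) (hx : x ∈ θ.I) :
    HasDerivAt (gaugeX θ x₀) √|θ.f x / θ.g x| x := by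
  have hc := θ.smooth_rate.continuousOn
  have hs : uIcc x₀ x ⊆ θ.I := θ.isInterval.ordConnected.uIcc_subset hx₀ hx
  have hm : θ.I ∈ 𝓝 x := θ.isInterval.isOpen.mem_nhds hx
  exact (intervalIntegral.integral_hasDerivAt_right ((hc.mono hs).intervalIntegrable)
    (hc.stronglyMeasurableAtFilter θ.isInterval.isOpen x hx) (hc.continuousAt hm)).add_const x₀

lemma deriv_gaugeX (hx₀ : x₀ ∈ θ.I) (hx : x ∈ θ.I) :
    deriv (gaugeX θ x₀) x = √|θ.f x / θ.g x| := (θ.hasDerivAt_gaugeX hx₀ hx).deriv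

lemma deriv_gaugeX_ne_zero (hx₀ : x₀ ∈ θ.I) (hx : x ∈ θ.I) : deriv (gaugeX θ x₀) x ≠ 0 := by
  rw [θ.deriv_gaugeX hx₀ hx]
  exact (sqrt_abs_pos (div_ne_zero (θ.f_ne_zero hx) (θ.g_ne_zero hx))).ne'

lemma smooth_gaugeX (hx₀ : x₀ ∈ θ.I) : ContDiffOn ℝ ∞ (gaugeX θ x₀) θ.I :=
  (contDiffOn_infty_iff_deriv_of_isOpen θ.isInterval.isOpen).2
    ⟨fun _ hx => (θ.hasDerivAt_gaugeX hx₀ hx).differentiableAt.differentiableWithinAt,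
      θ.smooth_rate.congr fun _ hx => θ.deriv_gaugeX hx₀ hx⟩

lemma isInterval_image_gaugeX (hx₀ : x₀ ∈ θ.I) : IsInterval (gaugeX θ x₀ '' θ.I) where
  isOpen := isOpen_bijOn_image θ.isInterval.isOpen (θ.smooth_gaugeX hx₀)
    fun _ hx => θ.deriv_gaugeX_ne_zero hx₀ hx
  nonempty := θ.isInterval.nonempty.image _
  ordConnected := (θ.isInterval.ordConnected.isPreconnected.image _
    (θ.smooth_gaugeX hx₀).continuousOn).ordConnected

lemma ext_of_eqOn {θ θ' : Coeffs} (hI : θ.I = θ'.I) (hf : ∀ x ∈ θ.I, θ.f x = θ'.f x)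
    (hg : ∀ x ∈ θ.I, θ.g x = θ'.g x) (hh : ∀ x ∈ θ.I, θ.h x = θ'.h x) : θ = θ' := by
  have ef := θ.smooth_f.ext (hI ▸ θ'.smooth_f) hf
  have eg := θ.smooth_g.ext (hI ▸ θ'.smooth_g) hg
  have eh := θ.smooth_h.ext (hI ▸ θ'.smooth_h) hh
  cases θ
  cases θ'
  simp only [Coeffs.mk.injEq]
  exact ⟨hI, ef, eg, eh⟩

end Coeffs

lemma ImagedCoeffs.ext_of_eqOn {θ θ' : ImagedCoeffs} (hI : θ.I = θ'.I)
    (hF : ∀ x ∈ θ.I, θ.F x = θ'.F x) (hH : ∀ x ∈ θ.I, θ.H x = θ'.H x) : θ = θ' := by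
  have eF := θ.smooth_F.ext (hI ▸ θ'.smooth_F) hF
  have eH := θ.smooth_H.ext (hI ▸ θ'.smooth_H) hH
  cases θ
  cases θ'
  simp only [ImagedCoeffs.mk.injEq]
  exact ⟨hI, eF, eH⟩

lemma DoubleImagedCoeffs.ext_of_eqOn {θ θ' : DoubleImagedCoeffs} (hI : θ.I = θ'.I)
    (hH : ∀ x ∈ θ.I, θ.H x = θ'.H x) (hG : ∀ x ∈ θ.I, θ.G x = θ'.G x) : θ = θ' := by
  have eH := θ.smooth_H.ext (hI ▸ θ'.smooth_H) hH
  have eG := θ.smooth_G.ext (hI ▸ θ'.smooth_G) hG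
  cases θ
  cases θ'
  simp only [DoubleImagedCoeffs.mk.injEq]
  exact ⟨hI, eH, eG⟩

lemma exists_gaugesTo (θ : Coeffs) {x₀ : ℝ} (hx₀ : x₀ ∈ θ.I) : ∃ θ₁, GaugesTo θ x₀ θ₁ := by
  have hX := θ.smooth_gaugeX hx₀
  have hX' := fun x (hx : x ∈ θ.I) => θ.deriv_gaugeX_ne_zero hx₀ hx
  obtain ⟨Y, hY, hYb, hYX, -⟩ := exists_smooth_inverse θ.isInterval.isOpen hX hX'
    (θ.isInterval.injOn hX hX').bijOn_image
  -- The sign is frozen at `x₀` to make smoothness evident; it is constant since g does not vanish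
  -- on the interval.
  have hfg : ContDiffOn ℝ ∞ (fun y => (SignType.sign (θ.g x₀) : ℝ) * √|θ.f (Y y) * θ.g (Y y)|)
      (gaugeX θ x₀ '' θ.I) :=
    contDiffOn_const.mul ((smooth_sqrt_abs (θ.smooth_f.smooth.mul θ.smooth_g.smooth) fun _ hx =>
      mul_ne_zero (θ.f_ne_zero hx) (θ.g_ne_zero hx)).comp hY hYb.mapsTo)
  have hh : ContDiffOn ℝ ∞ (fun y => √|θ.g (Y y) / θ.f (Y y)| * θ.h (Y y))
      (gaugeX θ x₀ '' θ.I) :=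
    ((smooth_sqrt_abs (θ.smooth_g.smooth.div θ.smooth_f.smooth fun _ hx => θ.f_ne_zero hx)
      fun _ hx => div_ne_zero (θ.g_ne_zero hx) (θ.f_ne_zero hx)).mul θ.smooth_h.smooth).comp hY
        hYb.mapsTo
  refine ⟨.of (θ.isInterval_image_gaugeX hx₀) hfg hfg hh fun y hy => ?_, rfl, fun x hx => ?_⟩
  · have hy := hYb.mapsTo hy
    have hf0 := θ.f_ne_zero hy
    have hg0 := θ.g_ne_zero hy
    have h1 := mul_ne_zero (sign_coe_ne_zero (θ.g_ne_zero hx₀))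
      (sqrt_abs_pos (mul_ne_zero hf0 hg0)).ne'
    exact mul_ne_zero (mul_ne_zero h1 h1)
      (mul_ne_zero (sqrt_abs_pos (div_ne_zero hg0 hf0)).ne' (θ.h_ne_zero hy))
  · simp only [Coeffs.of, indicator_of_mem (mem_image_of_mem (gaugeX θ x₀) hx), hYX x hx,
      θ.isInterval.sign_eq θ.smooth_g.smooth.continuousOn (fun _ hx => θ.g_ne_zero hx) hx₀ hx,
      and_self]

namespace GaugesTo

variable {θ θ₁ θ₂ : Coeffs} {x₀ : ℝ}

lemma unique (h₁ : GaugesTo θ x₀ θ₁) (h₂ : GaugesTo θ x₀ θ₂) : θ₁ = θ₂ := by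
  refine Coeffs.ext_of_eqOn (h₁.1.trans h₂.1.symm) ?_ ?_ ?_ <;> rw [h₁.1] <;>
    rintro _ ⟨x, hx, rfl⟩
  · rw [(h₁.2 x hx).1, (h₂.2 x hx).1]
  · rw [(h₁.2 x hx).2.1, (h₂.2 x hx).2.1]
  · rw [(h₁.2 x hx).2.2, (h₂.2 x hx).2.2]

lemma g_eq_f (h : GaugesTo θ x₀ θ₁) {x : ℝ} (hx : x ∈ θ₁.I) : θ₁.g x = θ₁.f x := by
  rw [h.1] at hx
  obtain ⟨x, hx, rfl⟩ := hx
  rw [(h.2 x hx).1, (h.2 x hx).2.1]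

/-- For f = g > 0 the integrand is 1 and the added `x₀` cancels the lower limit. So the first step
fixes such equations whatever the base point, and preimages need only be found for the second step.
-/
lemma of_eq_of_pos (hx₀ : x₀ ∈ θ.I) (hfg : ∀ x ∈ θ.I, θ.g x = θ.f x)
    (hpos : ∀ x ∈ θ.I, 0 < θ.f x) : GaugesTo θ x₀ θ := by
  have hX : ∀ x ∈ θ.I, gaugeX θ x₀ x = x := by
    intro x hx
    have : ∫ y in x₀..x, √|θ.f y / θ.g y| = ∫ y in x₀..x, (1 : ℝ) := by
      refine intervalIntegral.integral_congr fun y hy => ?_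
      have hy' := θ.isInterval.ordConnected.uIcc_subset hx₀ hx hy
      simp [hfg y hy', (hpos y hy').ne']
    simp [gaugeX, this]
  refine ⟨by rw [image_congr hX, image_id'], fun x hx => ?_⟩
  have h0 := hpos x hx
  simp [hX x hx, hfg x hx, h0, h0.ne', h0.le]

/-- The gauge transformation conjugates equations with the same nonlinearity. -/
lemma conj (h : GaugesTo θ x₀ θ₁) (hx₀ : x₀ ∈ θ.I) {E E' : Equation} (hE : E.Regular)
    (hE' : E'.Regular) {k : ℝ → ℝ} (hI : E.I = θ.I) (hI' : E'.I = θ₁.I) (hr : E'.range = E.range)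
    (hv : E'.vals = E.vals) (hf : E.f = θ.f) (hg : E.g = θ.g) (hf' : E'.f = θ₁.f)
    (hg' : E'.g = θ₁.g) (hN : ∀ x u, E.N x u = θ.h x * k u)
    (hN' : ∀ x u, E'.N x u = θ₁.h x * k u) : (gaugeMap θ x₀).Conj E E' := by
  have hX := θ.smooth_gaugeX hx₀
  have hX' := fun x (hx : x ∈ θ.I) => θ.deriv_gaugeX_ne_zero hx₀ hx
  have hΦ : (gaugeMap θ x₀).Nondegenerate E.I :=
    { a_ne := sign_coe_ne_zero (mul_ne_zero (θ.f_ne_zero hx₀) (θ.g_ne_zero hx₀))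
      smooth_X := hI ▸ hX
      smooth_A := contDiffOn_const
      smooth_B := contDiffOn_const
      deriv_X_ne := hI ▸ hX'
      A_ne := fun _ _ => one_ne_zero }
  have hsign : ∀ x ∈ θ.I, SignType.sign (θ.f x₀ * θ.g x₀) = SignType.sign (θ.f x * θ.g x) :=
    fun x hx => θ.isInterval.sign_eq (f := fun y => θ.f y * θ.g y)
      (θ.smooth_f.smooth.mul θ.smooth_g.smooth).continuousOn
      (fun _ hx => mul_ne_zero (θ.f_ne_zero hx) (θ.g_ne_zero hx)) hx₀ hx
  refine hΦ.conj_of_coefficients hE hE' ?_ (fun x _ w => by simp [hr, gaugeMap])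
    (fun x _ w => by simp [hv, gaugeMap]) (c := 1) one_ne_zero ?_ ?_ ?_ <;> rw [hI]
  · rw [hI', h.1]
    exact (θ.isInterval.injOn hX hX').bijOn_image
  · intro x hx
    have hf0 := θ.f_ne_zero hx
    have hg0 := θ.g_ne_zero hx
    have p1 := sqrt_abs_pos (div_ne_zero hf0 hg0)
    simp only [hf', hf, gaugeMap, θ.deriv_gaugeX hx₀ hx, (h.2 x hx).1, hsign x hx]
    rw [div_mul_eq_mul_div, eq_div_iff (by positivity), one_pow, mul_one, mul_assoc,
      ← Real.sqrt_mul (abs_nonneg _), ← abs_mul,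
      show θ.f x * θ.g x * (θ.f x / θ.g x) = θ.f x * θ.f x by field_simp, abs_mul,
      Real.sqrt_mul_self (abs_nonneg _), sign_mul, SignType.coe_mul, ← sign_mul_self_coe]
    ring
  · intro x hx
    have hf0 := θ.f_ne_zero hx
    have hg0 := θ.g_ne_zero hx
    simp only [hg', hg, gaugeMap, θ.deriv_gaugeX hx₀ hx, (h.2 x hx).2.1]
    rw [show θ.f x * θ.g x = θ.f x / θ.g x * (θ.g x * θ.g x) by field_simp, abs_mul,
      Real.sqrt_mul (abs_nonneg _), abs_mul, Real.sqrt_mul_self (abs_nonneg _)]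
    have e := sign_coe_sq hg0
    rw [← sign_mul_self_coe (θ.g x)]
    linear_combination √|θ.f x / θ.g x| * θ.g x * e
  · intro x hx u hu
    have hf0 := θ.f_ne_zero hx
    have hg0 := θ.g_ne_zero hx
    rw [psiExpr_const (A := (gaugeMap θ x₀).A) (d := 1) E.isOpen_I (fun _ _ => rfl) (hI ▸ hx)]
    simp only [gaugeMap, hN, hN', θ.deriv_gaugeX hx₀ hx, (h.2 x hx).2.2]
    rw [show θ.g x / θ.f x = (θ.f x / θ.g x)⁻¹ by rw [inv_div], abs_inv, Real.sqrt_inv]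
    simp
    ring

end GaugesTo


/-! ### The second and third steps of the mappings -/

/-- By the definition of F, the function |f|^{1/2} itself is the positive solution of y'' + Fy = 0
required of the image. -/
lemma exists_imagesTo (θ : Coeffs) (m : ℝ) : ∃ ϑ, ImagesTo θ m ϑ := by
  have hs := smooth_sqrt_abs θ.smooth_f.smooth fun _ hx => θ.f_ne_zero hx
  have hpos : ∀ x ∈ θ.I, 0 < √|θ.f x| := fun x hx => sqrt_abs_pos (θ.f_ne_zero hx)
  have hs2 := smooth_deriv θ.isInterval.isOpen (smooth_deriv θ.isInterval.isOpen hs)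
  obtain ⟨x₀, hx₀⟩ := θ.isInterval.nonempty
  have hF : ContDiffOn ℝ ∞ (fun x => -(deriv (deriv (fun y => √|θ.f y|)) x / √|θ.f x|)) θ.I :=
    (hs2.div hs fun x hx => (hpos x hx).ne').neg
  have hH : ContDiffOn ℝ ∞
      (fun x => θ.h x * (SignType.sign (θ.f x₀) : ℝ) / √|θ.f x| ^ (m + 1)) θ.I :=
    (θ.smooth_h.smooth.mul contDiffOn_const).div
      (hs.rpow_const_of_ne fun x hx => (hpos x hx).ne') fun x hx =>
        (Real.rpow_pos_of_pos (hpos x hx) _).ne'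
  refine ⟨.of θ.isInterval hF hH (fun x hx => ?_) ⟨_, hs, fun x hx => ⟨hpos x hx, ?_⟩⟩, rfl,
    fun x hx => ?_⟩
  · exact div_ne_zero (mul_ne_zero (θ.h_ne_zero hx) (sign_coe_ne_zero (θ.f_ne_zero hx₀)))
      (Real.rpow_pos_of_pos (hpos x hx) _).ne'
  · have := (hpos x hx).ne'
    field_simp
    ring
  · simp only [ImagedCoeffs.of, indicator_of_mem hx,
      θ.isInterval.sign_eq θ.smooth_f.smooth.continuousOn (fun _ hx => θ.f_ne_zero hx) hx₀ hx,
      and_self]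

/-- The shift z = F/(2H) satisfies z'' + Hz² + G = 0 by the definition of G. As 2Hz = F, the
positive solution for F serves again. -/
lemma exists_doublesTo (ϑ : ImagedCoeffs) : ∃ κ, DoublesTo ϑ κ := by
  have hB : ContDiffOn ℝ ∞ (fun x => ϑ.F x / (2 * ϑ.H x)) ϑ.I :=
    ϑ.smooth_F.smooth.div (contDiffOn_const.mul ϑ.smooth_H.smooth)
      fun x hx => mul_ne_zero two_ne_zero (ϑ.H_ne_zero x hx)
  have hB2 := smooth_deriv ϑ.isInterval.isOpen (smooth_deriv ϑ.isInterval.isOpen hB)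
  have hG : ContDiffOn ℝ ∞ (fun x => -deriv (deriv (fun y => ϑ.F y / (2 * ϑ.H y))) x
      - ϑ.F x ^ 2 / (4 * ϑ.H x)) ϑ.I :=
    hB2.neg.sub ((ϑ.smooth_F.smooth.pow 2).div (contDiffOn_const.mul ϑ.smooth_H.smooth)
      fun x hx => mul_ne_zero four_ne_zero (ϑ.H_ne_zero x hx))
  obtain ⟨s, hs, hs'⟩ := ϑ.exists_pos
  refine ⟨.of ϑ.isInterval ϑ.smooth_H.smooth hG ϑ.H_ne_zero
    ⟨_, s, hB, hs, fun x hx => ⟨?_, (hs' x hx).1, ?_⟩⟩, rfl, fun x hx => ?_⟩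
  · have := ϑ.H_ne_zero x hx
    field_simp
    ring
  · have := ϑ.H_ne_zero x hx
    rw [← (hs' x hx).2]
    field_simp
  · simp only [DoubleImagedCoeffs.of, indicator_of_mem hx, and_self]

lemma ImagesTo.unique {θ : Coeffs} {m : ℝ} {ϑ₁ ϑ₂ : ImagedCoeffs} (h₁ : ImagesTo θ m ϑ₁)
    (h₂ : ImagesTo θ m ϑ₂) : ϑ₁ = ϑ₂ := by
  refine ImagedCoeffs.ext_of_eqOn (h₁.1.trans h₂.1.symm) ?_ ?_ <;> rw [h₁.1] <;> intro x hx
  · rw [(h₁.2 x hx).1, (h₂.2 x hx).1]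
  · rw [(h₁.2 x hx).2, (h₂.2 x hx).2]

lemma DoublesTo.unique {ϑ : ImagedCoeffs} {κ₁ κ₂ : DoubleImagedCoeffs} (h₁ : DoublesTo ϑ κ₁)
    (h₂ : DoublesTo ϑ κ₂) : κ₁ = κ₂ := by
  refine DoubleImagedCoeffs.ext_of_eqOn (h₁.1.trans h₂.1.symm) ?_ ?_ <;> rw [h₁.1] <;> intro x hx
  · rw [(h₁.2 x hx).1, (h₂.2 x hx).1]
  · rw [(h₁.2 x hx).2, (h₂.2 x hx).2]

/-- Every equation `v_t = v_xx + H v^m + F v` of the class is an image of an equation with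
`f = g`. -/
lemma exists_gauged_preimage (ϑ : ImagedCoeffs) (m : ℝ) :
    ∃ θ : Coeffs, (∀ x₀ ∈ θ.I, GaugesTo θ x₀ θ) ∧ ImagesTo θ m ϑ := by
  obtain ⟨s, hs, hs'⟩ := ϑ.exists_pos
  have hs0 : ∀ x ∈ ϑ.I, s x ≠ 0 := fun x hx => (hs' x hx).1.ne'
  have hh : ContDiffOn ℝ ∞ (fun x => ϑ.H x * s x ^ (m + 1)) ϑ.I :=
    ϑ.smooth_H.smooth.mul (hs.rpow_const_of_ne hs0)
  -- The second step is inverted by f = g = s² and h = H s^{m+1}; positivity of s gives |f|^{1/2} =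
  -- s.
  let θ : Coeffs := .of ϑ.isInterval (hs.pow 2) (hs.pow 2) hh fun x hx => by
    have h1 := hs0 x hx
    have h2 := (Real.rpow_pos_of_pos (hs' x hx).1 (m + 1)).ne'
    have h3 := ϑ.H_ne_zero x hx
    positivity
  have hf : ∀ x ∈ ϑ.I, θ.f x = s x ^ 2 := fun x hx =>
    indicator_of_mem hx (fun x => s x ^ 2)
  have hg : ∀ x ∈ ϑ.I, θ.g x = s x ^ 2 := fun x hx =>
    indicator_of_mem hx (fun x => s x ^ 2)
  have hh : ∀ x ∈ ϑ.I, θ.h x = ϑ.H x * s x ^ (m + 1) := fun x hx =>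
    indicator_of_mem hx (fun x => ϑ.H x * s x ^ (m + 1))
  have hfpos : ∀ x ∈ ϑ.I, 0 < θ.f x := fun x hx => by
    rw [hf x hx]; exact pow_pos (hs' x hx).1 2
  have hsq : ∀ x ∈ ϑ.I, √|θ.f x| = s x := fun x hx => by
    rw [hf x hx, abs_of_nonneg (sq_nonneg _), Real.sqrt_sq (hs' x hx).1.le]
  refine ⟨θ, fun x₀ hx₀ => GaugesTo.of_eq_of_pos hx₀ (fun x hx => (hg x hx).trans (hf x hx).symm)
    hfpos, rfl, fun x hx => ⟨?_, ?_⟩⟩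
  · rw [deriv_deriv_congr_of_isOpen ϑ.isInterval.isOpen hsq hx, hsq x hx]
    have h1 := hs0 x hx
    have := (hs' x hx).2
    field_simp
    linear_combination this
  · rw [hsq x hx, hh x hx, sign_pos (hfpos x hx)]
    have := (Real.rpow_pos_of_pos (hs' x hx).1 (m + 1)).ne'
    simp only [SignType.coe_one, mul_one]
    field_simp

/-- Every equation `w_t = w_xx + H w² + G` of the class is an image. -/
lemma exists_doublesTo_preimage (κ : DoubleImagedCoeffs) : ∃ ϑ, DoublesTo ϑ κ := by
  obtain ⟨z, s, hz, hs, h⟩ := κ.exists_pos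
  -- F = 2Hz makes the shift F/(2H) equal to z.
  have hF : ContDiffOn ℝ ∞ (fun x => 2 * κ.H x * z x) κ.I :=
    (contDiffOn_const.mul κ.smooth_H.smooth).mul hz
  let ϑ : ImagedCoeffs := .of κ.isInterval hF κ.smooth_H.smooth κ.H_ne_zero
    ⟨s, hs, fun x hx => (h x hx).2⟩
  have hF : ∀ x ∈ κ.I, ϑ.F x = 2 * κ.H x * z x := fun x hx =>
    indicator_of_mem hx (fun x => 2 * κ.H x * z x)
  have hH : ∀ x ∈ κ.I, ϑ.H x = κ.H x := fun x hx => indicator_of_mem hx κ.H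
  have hB : ∀ x ∈ κ.I, ϑ.F x / (2 * ϑ.H x) = z x := fun x hx => by
    have := κ.H_ne_zero x hx
    rw [hF x hx, hH x hx]
    field_simp
  refine ⟨ϑ, rfl, fun x hx => ⟨(hH x hx).symm, ?_⟩⟩
  have := κ.H_ne_zero x hx
  rw [deriv_deriv_congr_of_isOpen κ.isInterval.isOpen hB hx, hF x hx, hH x hx]
  field_simp
  linear_combination 4 * (h x hx).1

/-- The transformation `v = |f|^{1/2} u` conjugates equations with corresponding
nonlinearities. -/
lemma ImagesTo.conj {θ : Coeffs} {m : ℝ} {ϑ : ImagedCoeffs} (h : ImagesTo θ m ϑ)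
    (hfg : ∀ x ∈ θ.I, θ.g x = θ.f x) {E E' : Equation} (hE : E.Regular) (hE' : E'.Regular)
    {k : ℝ → ℝ} (hk : ∀ a u, 0 < a → k (a * u) = a ^ m * k u) (hI : E.I = θ.I)
    (hI' : E'.I = ϑ.I)
    (hr : ∀ a, 0 < a → ∀ w, w ∈ E.range ↔ a * w + 0 ∈ E'.range)
    (hv : ∀ a, 0 < a → ∀ w, w ∈ E.vals ↔ a * w + 0 ∈ E'.vals) (hf : E.f = θ.f) (hg : E.g = θ.g)
    (hf' : ∀ x, E'.f x = 1) (hg' : ∀ x, E'.g x = 1) (hN : ∀ x u, E.N x u = θ.h x * k u)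
    (hN' : ∀ x u, E'.N x u = ϑ.H x * k u + ϑ.F x * u) : (imageMap θ).Conj E E' := by
  have o := θ.isInterval.isOpen
  have hs := smooth_sqrt_abs θ.smooth_f.smooth fun _ hx => θ.f_ne_zero hx
  have hpos : ∀ x ∈ θ.I, 0 < √|θ.f x| := fun x hx => sqrt_abs_pos (θ.f_ne_zero hx)
  have hsq : ∀ x, √|θ.f x| ^ 2 = |θ.f x| := fun x => Real.sq_sqrt (abs_nonneg _)
  have hΦ : (imageMap θ).Nondegenerate E.I :=
    { a_ne := one_ne_zero
      smooth_X := contDiffOn_id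
      smooth_A := hI ▸ hs
      smooth_B := contDiffOn_const
      deriv_X_ne := fun x _ => by simp [imageMap]
      A_ne := fun x hx => (hpos x (hI ▸ hx)).ne' }
  obtain ⟨x₀, hx₀⟩ := θ.isInterval.nonempty
  have hsign : ∀ x ∈ θ.I, SignType.sign (θ.f x₀) = SignType.sign (θ.f x) := fun x hx =>
    θ.isInterval.sign_eq θ.smooth_f.smooth.continuousOn (fun _ hx => θ.f_ne_zero hx) hx₀ hx
  -- The image must have unit coefficients, so c f/|f| = 1; this forces c to be the sign of f.
  have key : ∀ x ∈ θ.I, (SignType.sign (θ.f x₀) : ℝ) / √|θ.f x| ^ 2 * θ.f x = 1 := by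
    intro x hx
    rw [hsq, hsign x hx, div_mul_eq_mul_div, sign_mul_self_coe,
      div_self (abs_ne_zero.2 (θ.f_ne_zero hx))]
  refine hΦ.conj_of_coefficients hE hE' ?_
    (fun x hx => hr _ (hpos x (hI ▸ hx))) (fun x hx => hv _ (hpos x (hI ▸ hx)))
    (c := SignType.sign (θ.f x₀)) (sign_coe_ne_zero (θ.f_ne_zero hx₀)) ?_ ?_ ?_ <;> rw [hI]
  · rw [hI', h.1]
    exact bijOn_id _
  · intro x hx
    simp only [imageMap, deriv_id'', hf, hf', one_mul, mul_one, key x hx]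
  · intro x hx
    simp only [imageMap, deriv_id'', hg, hg', mul_one, hfg x hx, key x hx]
  · intro x hx u hu
    have h0 := hpos x hx
    have hc := sign_coe_sq (θ.f_ne_zero hx₀)
    -- As g = f = ±A², the quotient g/A² is the constant sign of f, and the expression reduces to
    -- that sign times A''. It produces the term Fv.
    have e1 : psiExpr E.g (imageMap θ).A x =
        SignType.sign (θ.f x₀) * deriv (deriv (fun y => √|θ.f y|)) x := by
      rw [psiExpr, deriv_congr_of_isOpen
        (g := fun y => SignType.sign (θ.f x₀) * deriv (fun y => √|θ.f y|) y) o (fun y hy => ?_) hx]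
      · exact deriv_const_mul_field _
      · have h1 := key y hy
        have h2 := (hpos y hy).ne'
        simp only [imageMap, hg, hfg y hy]
        field_simp at h1 ⊢
        linear_combination
          SignType.sign (θ.f x₀) * deriv (fun y => √|θ.f y|) y * h1 -
            deriv (fun y => √|θ.f y|) y * θ.f y * hc
    rw [e1]
    simp only [imageMap, hN, hN', deriv_id'', (h.2 x hx).1, (h.2 x hx).2, add_zero, hk _ _ h0,
      deriv_const', mul_zero, zero_div, sub_zero, ← hsign x hx, Real.rpow_add_one h0.ne']
    have h1 := (Real.rpow_pos_of_pos h0 m).ne'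
    field_simp
    linear_combination u * √|θ.f x| * deriv (deriv (fun y => √|θ.f y|)) x * hc

/-- The transformation `w = v + F / (2 H)` conjugates equations with quadratic nonlinearities. -/
lemma DoublesTo.conj {ϑ : ImagedCoeffs} {κ : DoubleImagedCoeffs} (h : DoublesTo ϑ κ)
    {E E' : Equation} (hE : E.Regular) (hE' : E'.Regular) (hI : E.I = ϑ.I) (hI' : E'.I = κ.I)
    (hr : E.range = univ) (hr' : E'.range = univ) (hv : E.vals = univ) (hv' : E'.vals = univ)
    (hf : ∀ x, E.f x = 1) (hg : ∀ x, E.g x = 1) (hf' : ∀ x, E'.f x = 1) (hg' : ∀ x, E'.g x = 1)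
    (hN : ∀ x u, E.N x u = ϑ.H x * u ^ 2 + ϑ.F x * u)
    (hN' : ∀ x u, E'.N x u = κ.H x * u ^ 2 + κ.G x) : (doubleMap ϑ).Conj E E' := by
  have hB : ContDiffOn ℝ ∞ (fun x => ϑ.F x / (2 * ϑ.H x)) ϑ.I :=
    ϑ.smooth_F.smooth.div (contDiffOn_const.mul ϑ.smooth_H.smooth)
      fun x hx => mul_ne_zero two_ne_zero (ϑ.H_ne_zero x hx)
  have hΦ : (doubleMap ϑ).Nondegenerate E.I :=
    { a_ne := one_ne_zero
      smooth_X := contDiffOn_id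
      smooth_A := contDiffOn_const
      smooth_B := hI ▸ hB
      deriv_X_ne := fun x _ => by simp [doubleMap]
      A_ne := fun _ _ => one_ne_zero }
  refine hΦ.conj_of_coefficients hE hE' ?_ (fun x _ w => by simp [hr, hr'])
    (fun x _ w => by simp [hv, hv']) (c := 1) one_ne_zero ?_ ?_ ?_ <;> rw [hI]
  · rw [hI', h.1]
    exact bijOn_id _
  · intro x hx
    simp [doubleMap, hf, hf']
  · intro x hx
    simp [doubleMap, hg, hg']
  · intro x hx u hu
    rw [psiExpr_const (A := (doubleMap ϑ).A) (d := 1) E.isOpen_I (fun _ _ => rfl) (hI ▸ hx)]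
    have := ϑ.H_ne_zero x hx
    simp only [doubleMap, hN, hN', hg, deriv_id'', (h.2 x hx).1, (h.2 x hx).2, one_mul, one_pow,
      div_one, zero_mul, sub_zero]
    field_simp
    ring


/-! ### Smooth solutions of ordinary differential equations -/

/-- Adjoining x as an unknown with velocity 1 makes the system autonomous, so Picard–Lindelöf for C¹
fields applies. Smoothness then follows by bootstrapping. -/
lemma exists_smooth_solution {E : Type*} [NormedAddCommGroup E] [NormedSpace ℝ E]
    [CompleteSpace E] {J : Set ℝ} (hJ : IsOpen J) {V : ℝ × E → E}
    (hV : ContDiffOn ℝ ∞ V (J ×ˢ univ)) {x₀ : ℝ} (hx₀ : x₀ ∈ J) (e₀ : E) :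
    ∃ ε > 0, Ioo (x₀ - ε) (x₀ + ε) ⊆ J ∧ ∃ α : ℝ → E, α x₀ = e₀ ∧
      ContDiffOn ℝ ∞ α (Ioo (x₀ - ε) (x₀ + ε)) ∧
      ∀ x ∈ Ioo (x₀ - ε) (x₀ + ε), HasDerivAt α (V (x, α x)) x := by
  have ho : J ×ˢ (univ : Set E) ∈ 𝓝 (x₀, e₀) := (hJ.prod isOpen_univ).mem_nhds ⟨hx₀, trivial⟩
  have hW : ContDiffAt ℝ 1 (fun p : ℝ × E => ((1 : ℝ), V p)) (x₀, e₀) :=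
    contDiffAt_const.prodMk ((hV.contDiffAt ho).of_le (by simp))
  obtain ⟨β, hβ0, δ, hδ, hβ⟩ :=
    hW.exists_forall_mem_closedBall_exists_eq_forall_mem_Ioo_hasDerivAt₀ x₀
  obtain ⟨r, hr, hrJ⟩ := Metric.isOpen_iff.1 hJ x₀ hx₀
  rw [Real.ball_eq_Ioo] at hrJ
  have hsub : Ioo (x₀ - min δ r) (x₀ + min δ r) ⊆ Ioo (x₀ - δ) (x₀ + δ) :=
    Ioo_subset_Ioo (by linarith [min_le_left δ r]) (by linarith [min_le_left δ r])
  have hsub' : Ioo (x₀ - min δ r) (x₀ + min δ r) ⊆ J :=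
    (Ioo_subset_Ioo (by linarith [min_le_right δ r]) (by linarith [min_le_right δ r])).trans hrJ
  have hε : 0 < min δ r := lt_min hδ hr
  -- The adjoined component has derivative 1 and starts at `x₀`.
  have hfst : ∀ x ∈ Ioo (x₀ - δ) (x₀ + δ), (β x).1 = x := by
    intro x hx
    have hd : ∀ t ∈ Ioo (x₀ - δ) (x₀ + δ), HasDerivAt (fun t => (β t).1 - t) 0 t := fun t ht => by
      have := (hasFDerivAt_fst.comp_hasDerivAt t (hβ t ht)).sub (hasDerivAt_id t)
      rw [← sub_self (1 : ℝ)]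
      exact this
    have := (isOpen_Ioo).is_const_of_deriv_eq_zero isPreconnected_Ioo
      (fun t ht => (hd t ht).differentiableAt.differentiableWithinAt) (fun t ht => (hd t ht).deriv)
      hx (show x₀ ∈ Ioo (x₀ - δ) (x₀ + δ) from ⟨by linarith, by linarith⟩)
    simp only [hβ0, sub_self] at this
    linarith
  have hα : ∀ x ∈ Ioo (x₀ - min δ r) (x₀ + min δ r),
      HasDerivAt (fun x => (β x).2) (V (x, (β x).2)) x := fun x hx => by
    have := hasFDerivAt_snd.comp_hasDerivAt x (hβ x (hsub hx))
    have e : β x = (x, (β x).2) := Prod.ext (hfst x (hsub hx)) rfl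
    rw [e] at this
    exact this
  refine ⟨min δ r, hε, hsub', fun x => (β x).2, by simp [hβ0], ?_, hα⟩
  -- If α is C^n then so is α' = V(x, α), hence α is C^{n+1}.
  refine contDiffOn_infty.2 fun n => ?_
  induction n with
  | zero => exact contDiffOn_zero.2 fun x hx => (hα x hx).continuousAt.continuousWithinAt
  | succ n ih =>
    rw [Nat.cast_succ, contDiffOn_succ_iff_deriv_of_isOpen isOpen_Ioo]
    refine ⟨fun x hx => (hα x hx).differentiableAt.differentiableWithinAt, by simp, ?_⟩
    refine ContDiffOn.congr ?_ fun x hx => (hα x hx).deriv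
    exact (hV.of_le (by exact_mod_cast le_top)).comp (contDiffOn_id.prodMk ih)
      fun x hx => ⟨hsub' hx, trivial⟩

/-- Local smooth solutions of `y'' = N(x, y)`. -/
lemma exists_smooth_solution_second_order {J : Set ℝ} (hJ : IsOpen J) {N : ℝ × ℝ → ℝ}
    (hN : ContDiffOn ℝ ∞ N (J ×ˢ univ)) {x₀ : ℝ} (hx₀ : x₀ ∈ J) (y₀ : ℝ) :
    ∃ ε > 0, Ioo (x₀ - ε) (x₀ + ε) ⊆ J ∧ ∃ y : ℝ → ℝ, y x₀ = y₀ ∧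
      ContDiffOn ℝ ∞ y (Ioo (x₀ - ε) (x₀ + ε)) ∧
      ∀ x ∈ Ioo (x₀ - ε) (x₀ + ε), deriv (deriv y) x = N (x, y x) := by
  have hV : ContDiffOn ℝ ∞ (fun p : ℝ × (ℝ × ℝ) => (p.2.2, N (p.1, p.2.1))) (J ×ˢ univ) :=
    contDiffOn_snd.snd.prodMk (hN.comp (contDiffOn_fst.prodMk contDiffOn_snd.fst)
      fun p hp => ⟨hp.1, trivial⟩)
  obtain ⟨ε, hε, hsub, α, h0, hα, hα'⟩ := exists_smooth_solution hJ hV hx₀ (y₀, 0)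
  refine ⟨ε, hε, hsub, fun x => (α x).1, by simp [h0], hα.fst, fun x hx => ?_⟩
  have h1 : ∀ x ∈ Ioo (x₀ - ε) (x₀ + ε), deriv (fun x => (α x).1) x = (α x).2 := fun x hx =>
    (hasFDerivAt_fst (p := α x) |>.comp_hasDerivAt x (hα' x hx)).deriv
  rw [deriv_congr_of_isOpen isOpen_Ioo h1 hx]
  exact (hasFDerivAt_snd (p := α x) |>.comp_hasDerivAt x (hα' x hx)).deriv

/-- The solution starting from 1 stays positive after the interval is shrunk. -/
lemma exists_pos_solution {J : Set ℝ} (hJ : IsOpen J) {F : ℝ → ℝ} (hF : ContDiffOn ℝ ∞ F J)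
    {x₀ : ℝ} (hx₀ : x₀ ∈ J) :
    ∃ ε > 0, Ioo (x₀ - ε) (x₀ + ε) ⊆ J ∧ ∃ s : ℝ → ℝ,
      ContDiffOn ℝ ∞ s (Ioo (x₀ - ε) (x₀ + ε)) ∧
      ∀ x ∈ Ioo (x₀ - ε) (x₀ + ε), 0 < s x ∧ deriv (deriv s) x + F x * s x = 0 := by
  have hN : ContDiffOn ℝ ∞ (fun p : ℝ × ℝ => -(F p.1 * p.2)) (J ×ˢ univ) :=
    ((hF.comp contDiffOn_fst fun p hp => hp.1).mul contDiffOn_snd).neg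
  obtain ⟨ε, hε, hsub, s, hs0, hs, hs'⟩ := exists_smooth_solution_second_order hJ hN hx₀ 1
  have hx : x₀ ∈ Ioo (x₀ - ε) (x₀ + ε) := ⟨by linarith, by linarith⟩
  have hpos : {x | 0 < s x} ∈ 𝓝 x₀ :=
    (hs.continuousOn.continuousAt (isOpen_Ioo.mem_nhds hx)).eventually
      (lt_mem_nhds (by rw [hs0]; exact one_pos))
  obtain ⟨r, hr, hrs⟩ := Metric.mem_nhds_iff.1 (inter_mem hpos (isOpen_Ioo.mem_nhds hx))
  rw [Real.ball_eq_Ioo] at hrs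
  refine ⟨r, hr, fun x hx => hsub (hrs hx).2, s, hs.mono fun x hx => (hrs hx).2, fun x hx =>
    ⟨(hrs hx).1, ?_⟩⟩
  rw [hs' x (hrs hx).2]
  ring

lemma isInterval_Ioo {a b : ℝ} (h : a < b) : IsInterval (Ioo a b) :=
  ⟨isOpen_Ioo, nonempty_Ioo.2 h, ordConnected_Ioo⟩

lemma exists_local_imagedCoeffs {J : Set ℝ} {F H : ℝ → ℝ} (hJ : IsOpen J)
    (hF : ContDiffOn ℝ ∞ F J) (hH : ContDiffOn ℝ ∞ H J) (h0 : ∀ x ∈ J, H x ≠ 0) {x : ℝ}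
    (hx : x ∈ J) : ∃ ϑ : ImagedCoeffs, x ∈ ϑ.I ∧ ϑ.I ⊆ J ∧ EqOn ϑ.F F ϑ.I ∧ EqOn ϑ.H H ϑ.I := by
  obtain ⟨ε, hε, hsub, s, hs, hs'⟩ := exists_pos_solution hJ hF hx
  exact ⟨.of (isInterval_Ioo (by linarith)) (hF.mono hsub) (hH.mono hsub)
    (fun x hx => h0 x (hsub hx)) ⟨s, hs, hs'⟩, ⟨by linarith, by linarith⟩, hsub,
    eqOn_indicator, eqOn_indicator⟩

/-- The nonlinear equation is solved for z near the point, and then the linear one with coefficient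
2Hz on a smaller interval. -/
lemma exists_local_doubleImagedCoeffs {J : Set ℝ} {H G : ℝ → ℝ} (hJ : IsOpen J)
    (hH : ContDiffOn ℝ ∞ H J) (hG : ContDiffOn ℝ ∞ G J) (h0 : ∀ x ∈ J, H x ≠ 0) {x : ℝ}
    (hx : x ∈ J) :
    ∃ κ : DoubleImagedCoeffs, x ∈ κ.I ∧ κ.I ⊆ J ∧ EqOn κ.H H κ.I ∧ EqOn κ.G G κ.I := by
  have hN : ContDiffOn ℝ ∞ (fun p : ℝ × ℝ => -(H p.1 * p.2 ^ 2 + G p.1)) (J ×ˢ univ) :=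
    (((hH.comp contDiffOn_fst fun p hp => hp.1).mul (contDiffOn_snd.pow 2)).add
      (hG.comp contDiffOn_fst fun p hp => hp.1)).neg
  obtain ⟨δ, hδ, hsub, z, -, hz, hz'⟩ := exists_smooth_solution_second_order hJ hN hx 0
  have hF : ContDiffOn ℝ ∞ (fun x => 2 * H x * z x) (Ioo (x - δ) (x + δ)) :=
    (contDiffOn_const.mul (hH.mono hsub)).mul hz
  obtain ⟨ε, hε, hsub', s, hs, hs'⟩ :=
    exists_pos_solution isOpen_Ioo hF (x₀ := x) ⟨by linarith, by linarith⟩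
  have hsubJ := hsub'.trans hsub
  refine ⟨.of (isInterval_Ioo (a := x - ε) (b := x + ε) (by linarith)) (hH.mono hsubJ)
    (hG.mono hsubJ) (fun x hx => h0 x (hsubJ hx)) ⟨z, s, hz.mono hsub', hs, fun y hy =>
      ⟨?_, hs' y hy⟩⟩, ⟨by linarith, by linarith⟩, hsubJ, eqOn_indicator, eqOn_indicator⟩
  rw [hz' y (hsub' hy)]
  ring


/-! ### The mappings of classes -/

lemma spow_mul_of_pos (m : ℝ) {a : ℝ} (u : ℝ) (ha : 0 < a) :
    spow m (a * u) = a ^ m * spow m u := by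
  rw [spow_mul, spow_of_pos m ha]

/-- The class `f u_t = (g u_x)_x + h u^m` maps onto `v_t = v_xx + H v^m + F v`. -/
theorem classificationEquivalence_powerClass (c : Convention) {x₀ : Coeffs → ℝ}
    (hx₀ : ∀ θ, x₀ θ ∈ θ.I) :
    EqClass.ClassificationEquivalence (powerClass c) (imagedClass c) (powerMapping x₀) := by
  refine EqClass.classificationEquivalence_of_conj (powerClass_isRich c) (imagedClass_isRich c)
    (powerClass_isExhaustive c) (imagedClass_isExhaustive c) ?_ ?_ ?_
  · rintro ⟨θ, m, hm0, hm1⟩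
    obtain ⟨θ₁, h₁⟩ := exists_gaugesTo θ (hx₀ θ)
    obtain ⟨ϑ, h₂⟩ := exists_imagesTo θ₁ m
    refine ⟨⟨ϑ, m, hm0, hm1⟩, ⟨_, θ₁, h₁, h₂, rfl, rfl⟩, ?_⟩
    rintro ⟨ϑ', m', _, _⟩ ⟨Φ, θ₁', h₁', h₂', rfl, -⟩
    obtain rfl := h₁.unique h₁'
    obtain rfl := h₂.unique h₂'
    rfl
  · rintro ⟨ϑ, m, hm0, hm1⟩
    obtain ⟨θ, h₁, h₂⟩ := exists_gauged_preimage ϑ m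
    exact ⟨⟨θ, m, hm0, hm1⟩, _, θ, h₁ _ (hx₀ θ), h₂, rfl, rfl⟩
  · rintro ⟨θ, m, hm0, hm1⟩ Φ ⟨ϑ, m', hm0', hm1'⟩ ⟨θ₁, h₁, h₂, rfl, rfl⟩
    -- The intermediate equation is the gauged member of the same class, with f = g.
    refine ⟨rfl, PointMap.Conj.trans (E' := powerEqn c ⟨θ₁, m', hm0, hm1⟩) ?_ ?_⟩
    · exact h₁.conj (hx₀ θ) ((powerClass_isRich c).regular _) ((powerClass_isRich c).regular _)
        rfl rfl rfl rfl rfl rfl rfl rfl (fun _ _ => rfl) (fun _ _ => rfl)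
    · exact h₂.conj (fun _ => h₁.g_eq_f) ((powerClass_isRich c).regular _)
        ((imagedClass_isRich c).regular _) (fun _ => spow_mul_of_pos m') rfl rfl
        (fun a ha => (Convention.Multiplier.of_pos c ha).range_iff)
        (fun a ha => (Convention.Multiplier.of_pos c ha).vals_iff) rfl rfl (fun _ => rfl)
        (fun _ => rfl) (fun _ _ => rfl) (fun _ _ => rfl)

/-- The equation `v_t = v_xx + H v² + F v`, for `v` of any sign. -/
def quadImagedEqn (ϑ : ImagedCoeffs) : Equation where
  I := ϑ.I
  isOpen_I := ϑ.isInterval.isOpen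
  range := univ
  isOpen_range := isOpen_univ
  vals := univ
  vals_subset := subset_rfl
  f := fun _ => 1
  g := fun _ => 1
  N := fun x v => ϑ.H x * v ^ 2 + ϑ.F x * v

lemma quadImagedEqn_regular (ϑ : ImagedCoeffs) : (quadImagedEqn ϑ).Regular where
  smooth_f := contDiffOn_const
  smooth_g := contDiffOn_const
  isOpen_vals := isOpen_univ
  differentiableAt_N _ hx u _ :=
    ((differentiableAt_fst_smooth ϑ.isInterval.isOpen ϑ.smooth_H.smooth hx u).mul
      (differentiableAt_snd.pow 2)).add
      ((differentiableAt_fst_smooth ϑ.isInterval.isOpen ϑ.smooth_F.smooth hx u).mul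
        differentiableAt_snd)

lemma mul_sq_eq_rpow_mul (a u : ℝ) : (a * u) ^ 2 = a ^ (2 : ℝ) * u ^ 2 := by
  rw [mul_pow, Real.rpow_two]

/-- The class `f u_t = (g u_x)_x + h u²` maps onto `w_t = w_xx + H w² + G`. -/
theorem classificationEquivalence_quadClass {x₀ : Coeffs → ℝ} (hx₀ : ∀ θ, x₀ θ ∈ θ.I) :
    EqClass.ClassificationEquivalence quadClass doubleImagedClass (quadMapping x₀) := by
  refine EqClass.classificationEquivalence_of_conj quadClass_isRich doubleImagedClass_isRich
    quadClass_isExhaustive doubleImagedClass_isExhaustive ?_ ?_ ?_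
  · intro θ
    obtain ⟨θ₁, h₁⟩ := exists_gaugesTo θ (hx₀ θ)
    obtain ⟨ϑ, h₂⟩ := exists_imagesTo θ₁ 2
    obtain ⟨κ, h₃⟩ := exists_doublesTo ϑ
    refine ⟨κ, ⟨_, θ₁, ϑ, h₁, h₂, h₃, rfl⟩, ?_⟩
    rintro κ' ⟨Φ, θ₁', ϑ', h₁', h₂', h₃', -⟩
    obtain rfl := h₁.unique h₁'
    obtain rfl := h₂.unique h₂'
    exact h₃'.unique h₃
  · intro κ
    obtain ⟨ϑ, h₃⟩ := exists_doublesTo_preimage κ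
    obtain ⟨θ, h₁, h₂⟩ := exists_gauged_preimage ϑ 2
    exact ⟨θ, _, θ, ϑ, h₁ _ (hx₀ θ), h₂, h₃, rfl⟩
  · rintro θ Φ κ ⟨θ₁, ϑ, h₁, h₂, h₃, rfl⟩
    have c₁ : (gaugeMap θ (x₀ θ)).Conj (quadEqn θ) (quadEqn θ₁) :=
      h₁.conj (k := fun u => u ^ 2) (hx₀ θ) (quadClass_isRich.regular _)
        (quadClass_isRich.regular _) rfl rfl rfl rfl rfl rfl rfl rfl (fun _ _ => rfl)
        (fun _ _ => rfl)
    -- The intermediate equation is imposed for all real v, unlike `imagedEqn`, because the shift by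
    -- F/(2H) in general preserves neither positive nor nonzero values.
    have c₂ : (imageMap θ₁).Conj (quadEqn θ₁) (quadImagedEqn ϑ) :=
      h₂.conj (k := fun u => u ^ 2) (fun _ => h₁.g_eq_f) (quadClass_isRich.regular _)
        (quadImagedEqn_regular ϑ) (fun a u _ => mul_sq_eq_rpow_mul a u) rfl rfl
        (fun _ _ _ => Iff.rfl) (fun _ _ _ => Iff.rfl) rfl rfl (fun _ => rfl) (fun _ => rfl)
        (fun _ _ => rfl) (fun _ _ => rfl)
    have c₃ : (doubleMap ϑ).Conj (quadImagedEqn ϑ) (doubleImagedEqn κ) :=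
      h₃.conj (quadImagedEqn_regular ϑ) (doubleImagedClass_isRich.regular _) rfl rfl rfl rfl rfl
        rfl (fun _ => rfl) (fun _ => rfl) (fun _ => rfl) (fun _ => rfl) (fun _ _ => rfl)
        (fun _ _ => rfl)
    exact ⟨rfl, (c₁.trans c₂).trans c₃⟩

end ReactionDiffusion

theorem mainTheorem11 (x₀ : ReactionDiffusion.Coeffs → ℝ) (hx₀ : ∀ θ, x₀ θ ∈ θ.I) :
    (∀ c : ReactionDiffusion.Convention,
      ReactionDiffusion.EqClass.ClassificationEquivalence
        (ReactionDiffusion.powerClass c) (ReactionDiffusion.imagedClass c)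
        (ReactionDiffusion.powerMapping x₀)) ∧
    ReactionDiffusion.EqClass.ClassificationEquivalence
      ReactionDiffusion.quadClass ReactionDiffusion.doubleImagedClass
      (ReactionDiffusion.quadMapping x₀) ∧
    (∀ (J : Set ℝ) (F H : ℝ → ℝ), IsOpen J → ContDiffOn ℝ ∞ F J → ContDiffOn ℝ ∞ H J →
      (∀ x ∈ J, H x ≠ 0) → ∀ x ∈ J, ∃ ϑ : ReactionDiffusion.ImagedCoeffs,
        x ∈ ϑ.I ∧ ϑ.I ⊆ J ∧ EqOn ϑ.F F ϑ.I ∧ EqOn ϑ.H H ϑ.I) ∧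
    (∀ (J : Set ℝ) (H G : ℝ → ℝ), IsOpen J → ContDiffOn ℝ ∞ H J → ContDiffOn ℝ ∞ G J →
      (∀ x ∈ J, H x ≠ 0) → ∀ x ∈ J, ∃ κ : ReactionDiffusion.DoubleImagedCoeffs,
        x ∈ κ.I ∧ κ.I ⊆ J ∧ EqOn κ.H H κ.I ∧ EqOn κ.G G κ.I) :=
  ⟨fun c => ReactionDiffusion.classificationEquivalence_powerClass c hx₀,
    ReactionDiffusion.classificationEquivalence_quadClass hx₀,
    fun _ _ _ hJ hF hH h0 _ hx => ReactionDiffusion.exists_local_imagedCoeffs hJ hF hH h0 hx,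
    fun _ _ _ hJ hH hG h0 _ hx =>
      ReactionDiffusion.exists_local_doubleImagedCoeffs hJ hH hG h0 hx⟩
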